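/- Let $\mathbb{D}$ be the open unit disk in $\mathbb{C}$ and let $\mathbb{F}$ be a field. A Blaschke product is a function on $\mathbb{D}$ of the form $$B(z)=\lambda z^{m}\prod_{n}\frac{|\alpha_n|}{\alpha_n}\,\frac{\alpha_n-z}{1-\overline{\alpha_n}z},$$ where $|\lambda|=1$, $m\ge 0$ is an integer and $(\alpha_n)$ is a finite or infinite sequence in $\mathbb{D}\setminus\{0\}$ (repetitions allowed, possibly empty) with $\sum_n(1-|\alpha_n|)<\infty$. It has Property $\mathfrak{B}$ if for every $\theta\in(0,1)$ each connected component of $\{z\in\mathbb{D}:|B(z)|<\theta\}$ has its closure (in $\mathbb{C}$) contained in $\mathbb{D}$. A persistence module over $\mathbb{F}$ is a family of $\mathbb{F}$-vector spaces $(V_t)_{t\in\mathbb{R}}$ with linear maps $\pi_{s,t}:V_s\to V_t$ for $s\le t$ such that $\pi_{t,t}=\mathrm{id}$, $\pi_{s,r}=\pi_{t,r}\circ\pi_{s,t}$ for $s\le t\le r$, and $V_t=0$ for all sufficiently small $t$; direct sums and isomorphisms are taken at each $t$, compatibly with the maps $\pi_{s,t}$. For an interval $J\subseteq\mathbb{R}$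 that is bounded below, $\mathbb{F}J$ is the interval module with $(\mathbb{F}J)_t=\mathbb{F}$ for $t\in J$ and $0$ otherwise, and with $\pi_{s,t}=\mathrm{id}$ if $s,t\in J$ and $0$ otherwise. The persistence module $\mathbb{B}$ induced by $B$ has $V_t=H_0(\Sigma_t;\mathbb{F})$ (singular homology), where $$\Sigma_t=\Big\{z\in\mathbb{D}:|B(z)|<\frac{e^t-1}{e^t+1}\Big\},$$ which is empty for $t\le 0$, and its maps $\pi_{s,t}$ are induced by the inclusions $\Sigma_s\subseteq\Sigma_t$. A persistence module is of locally finite type if every $V_t$ is finite-dimensional, the set of those $t\in\mathbb{R}$ such that every neighbourhood of $t$ contains $s<r$ with $\pi_{s,r}$ not an isomorphism is a closed, discrete subset of $\mathbb{R}$ that is bounded below, and for every $t$ the map $\pi_{s,t}$ is an isomorphism for all $s\le t$ sufficiently close to $t$. **Theorem A.** (1) Let $B$ be a non-constant Blaschke product with Property $\mathfrak{B}$. Let $(w_j)_j$ be the distinct points $w\in\mathbb{D}$ with $B'(w)=0$ and $B(w)\neq 0$, let $m_j$ be the order of $w_j$, i.e. $B^{(k)}(w_j)=0$ for $k=1,\dots,m_j$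 and $B^{(m_j+1)}(w_j)\ne 0$, and put $s_j=\ln\frac{1+|B(w_j)|}{1-|B(w_j)|}$. Then $$\mathbb{B}\;\cong\;\mathbb{F}(0,+\infty)\oplus\bigoplus_j\big(\mathbb{F}(0,s_j]\big)^{m_j}.$$ (2) The module $\mathbb{B}$ need not be of locally finite type: for every field $\mathbb{F}$ there is a Blaschke product with Property $\mathfrak{B}$ whose induced persistence module is not of locally finite type. -/

import Mathlib

universe u

noncomputable section

namespace InnerPersistence

/-! ### Persistence modules over a field -/

/-- A persistence module over the field `F`, indexed by the real line. -/
structure PersistenceModule (F : Type u) [Field F] where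
  /-- the vector space at time `t` -/
  V : ℝ → Type u
  [acg : ∀ t, AddCommGroup (V t)]
  [mod : ∀ t, Module F (V t)]
  /-- the structure map from time `s` to time `t` -/
  map : ∀ {s t : ℝ}, s ≤ t → V s →ₗ[F] V t
  map_comp : ∀ {s t r : ℝ} (hst : s ≤ t) (htr : t ≤ r),
    map (hst.trans htr) = map htr ∘ₗ map hst
  map_id : ∀ t : ℝ, map (le_refl t) = LinearMap.id
  exists_trivial : ∃ s₀ : ℝ, ∀ s ≤ s₀, Subsingleton (V s)

attribute [instance] PersistenceModule.acg PersistenceModule.mod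

namespace PersistenceModule

variable {F : Type u} [Field F]

/-- A morphism of persistence modules. -/
structure Hom (M N : PersistenceModule F) where
  app : ∀ t : ℝ, M.V t →ₗ[F] N.V t
  naturality : ∀ {s t : ℝ} (h : s ≤ t), app t ∘ₗ M.map h = N.map h ∘ₗ app s

/-- Two persistence modules are isomorphic if there are mutually inverse morphisms. -/
def Isomorphic (M N : PersistenceModule F) : Prop :=
  ∃ (φ : Hom M N) (ψ : Hom N M),
    ∀ t : ℝ, ψ.app t ∘ₗ φ.app t = LinearMap.id ∧ φ.app t ∘ₗ ψ.app t = LinearMap.id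

/-- The direct sum of two persistence modules. -/
def prod (M N : PersistenceModule F) : PersistenceModule F where
  V t := M.V t × N.V t
  map h := (M.map h).prodMap (N.map h)
  map_comp hst htr := by
    ext x <;> simp [M.map_comp hst htr, N.map_comp hst htr]
  map_id t := by
    ext x <;> simp [M.map_id, N.map_id]
  exists_trivial := by
    obtain ⟨a, ha⟩ := M.exists_trivial
    obtain ⟨b, hb⟩ := N.exists_trivial
    refine ⟨min a b, fun s hs => ?_⟩
    have := ha s (hs.trans (min_le_left _ _))
    have := hb s (hs.trans (min_le_right _ _))
    infer_instance

open scoped DirectSum in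
/-- The direct sum of a family of persistence modules which all vanish below a common time. -/
def directSum {ι : Type} (M : ι → PersistenceModule F)
    (hM : ∃ s₀ : ℝ, ∀ i, ∀ s ≤ s₀, Subsingleton ((M i).V s)) : PersistenceModule F where
  V t := ⨁ i, (M i).V t
  map h := DFinsupp.mapRange.linearMap fun i => (M i).map h
  map_comp hst htr := by
    refine LinearMap.ext fun x => DFinsupp.ext fun i => ?_
    exact congrArg (fun f => f (x i)) ((M i).map_comp hst htr)
  map_id t := by
    refine LinearMap.ext fun x => DFinsupp.ext fun i => ?_
    exact congrArg (fun f => f (x i)) ((M i).map_id t)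
  exists_trivial := by
    obtain ⟨a, ha⟩ := hM
    refine ⟨a, fun s hs => ⟨fun x y => DFinsupp.ext fun i => ?_⟩⟩
    exact (ha i s hs).elim _ _

variable (F) in
/-- The space at time `t` of the interval module on `J`: all of `F` if `t ∈ J`, else zero. -/
def intervalSpace (J : Set ℝ) (t : ℝ) : Submodule F F where
  carrier := {x | t ∉ J → x = 0}
  add_mem' {x y} hx hy ht := by rw [hx ht, hy ht, add_zero]
  zero_mem' _ := rfl
  smul_mem' c x hx ht := by rw [hx ht, smul_zero]

open Classical in
variable (F) in
/-- The interval module `F J` on an interval `J` that is bounded below: `F` at the times in `J`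
and `0` elsewhere; the structure maps are the identity between times in `J` and `0` otherwise. -/
def intervalModule (J : Set ℝ) (hJ : J.OrdConnected) (hb : BddBelow J) :
    PersistenceModule F where
  V t := intervalSpace F J t
  map {s t} _ :=
    if h : s ∈ J ∧ t ∈ J then Submodule.inclusion fun _ _ ht => absurd h.2 ht else 0
  map_comp {s t r} hst htr := by
    refine LinearMap.ext fun x => Subtype.ext ?_
    by_cases hs : s ∈ J
    · by_cases hr : r ∈ J
      · have ht : t ∈ J := hJ.out hs hr ⟨hst, htr⟩
        simp only [hs, ht, hr, and_self, dif_pos]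
        rfl
      · simp [hr]
    · simp [hs]
  map_id t := by
    refine LinearMap.ext fun x => Subtype.ext ?_
    by_cases ht : t ∈ J
    · simp only [ht, and_self, dif_pos]
      rfl
    · have := x.2 ht
      simp [ht, this]
  exists_trivial := by
    obtain ⟨a, ha⟩ := hb
    refine ⟨a - 1, fun s hs => ⟨fun x y => Subtype.ext ?_⟩⟩
    have hsJ : s ∉ J := fun h => by linarith [ha h]
    rw [x.2 hsJ, y.2 hsJ]

variable (F) in
/-- The interval module `F(a, b]`. -/
def intervalIoc (a b : ℝ) : PersistenceModule F :=
  intervalModule F (Set.Ioc a b) Set.ordConnected_Ioc bddBelow_Ioc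

variable (F) in
/-- The interval module `F(a, +∞)`. -/
def intervalIoi (a : ℝ) : PersistenceModule F :=
  intervalModule F (Set.Ioi a) Set.ordConnected_Ioi bddBelow_Ioi

theorem subsingleton_intervalIoc {a b t : ℝ} (h : t ≤ a) :
    Subsingleton ((intervalIoc F a b).V t) := by
  have ht : t ∉ Set.Ioc a b := fun h' => absurd h'.1 (not_lt.2 h)
  refine ⟨fun x y => Subtype.ext ?_⟩
  rw [x.2 ht, y.2 ht]

/-- The direct sum of the interval modules `F(a, b i]`. -/
def sumIoc (F : Type u) [Field F] (a : ℝ) {ι : Type} (b : ι → ℝ) : PersistenceModule F :=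
  directSum (fun i => intervalIoc F a (b i)) ⟨a, fun _ _ hs => subsingleton_intervalIoc hs⟩

/-- The finite spectral points of a persistence module. -/
def spectrum (M : PersistenceModule F) : Set ℝ :=
  {t | ∀ U ∈ nhds t, ∃ s ∈ U, ∃ r ∈ U, ∃ h : s < r, ¬ Function.Bijective (M.map h.le)}

/-- Persistence modules of locally finite type. -/
structure IsLocallyFiniteType (M : PersistenceModule F) : Prop where
  finite : ∀ t : ℝ, FiniteDimensional F (M.V t)
  isClosed_spectrum : IsClosed M.spectrum
  discrete_spectrum : IsDiscrete M.spectrum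
  bddBelow_spectrum : BddBelow M.spectrum
  semicontinuous : ∀ t : ℝ, ∃ ε > 0, ∀ (s : ℝ) (h : s ≤ t), t - ε < s →
    Function.Bijective (M.map h)

end PersistenceModule

/-! ### Blaschke products and their level sets -/

/-- The open unit disk. -/
def disk : Set ℂ := Metric.ball 0 1

/-- `B` is (on the unit disk) a Blaschke product
`c z ^ m ∏ₙ (|αₙ| / αₙ) (αₙ - z) / (1 - conj αₙ z)`, where the family of the `αₙ` (with
repetitions allowed) is finite or countably infinite and satisfies `∑ₙ (1 - |αₙ|) < ∞`. -/
def IsBlaschkeProduct (B : ℂ → ℂ) : Prop :=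
  ∃ (c : ℂ) (m : ℕ) (N : Set ℕ) (α : N → ℂ), ‖c‖ = 1 ∧ (∀ n, α n ∈ disk \ {0}) ∧
    Summable (fun n => 1 - ‖α n‖) ∧
    ∀ z ∈ disk, ∃ p : ℂ,
      HasProd (fun n => (‖α n‖ : ℂ) / α n *
        ((α n - z) / (1 - (starRingEnd ℂ) (α n) * z))) p ∧
      B z = c * z ^ m * p

/-- The level set `{z ∈ 𝔻 : |B z| < θ}`. -/
def levelSet (B : ℂ → ℂ) (θ : ℝ) : Set ℂ := {z ∈ disk | ‖B z‖ < θ}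

/-- For every `θ ∈ (0, 1)`, the closure of each connected component of the `θ`-level set is
contained in the open unit disk. -/
def PropertyB (B : ℂ → ℂ) : Prop :=
  ∀ θ ∈ Set.Ioo (0 : ℝ) 1, ∀ z ∈ levelSet B θ,
    closure (connectedComponentIn (levelSet B θ) z) ⊆ disk

/-- The change of parameter `θ(t) = (eᵗ - 1) / (eᵗ + 1)`, the inverse of
`θ ↦ ln ((1 + θ) / (1 - θ))`. -/
def theta (t : ℝ) : ℝ := (Real.exp t - 1) / (Real.exp t + 1)

theorem theta_mono : Monotone theta := by
  intro s t h
  have h1 := Real.exp_pos s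
  have h2 := Real.exp_pos t
  have h3 := Real.exp_le_exp.2 h
  unfold theta
  rw [div_le_div_iff₀ (by linarith) (by linarith)]
  nlinarith

theorem theta_nonpos {t : ℝ} (h : t ≤ 0) : theta t ≤ 0 :=
  div_nonpos_of_nonpos_of_nonneg (by linarith [Real.exp_le_one_iff.2 h])
    (by linarith [Real.exp_pos t])

/-- The reparametrized level set at time `t` (empty for `t ≤ 0`). -/
def sublevel (B : ℂ → ℂ) (t : ℝ) : Set ℂ := levelSet B (theta t)

theorem sublevel_mono (B : ℂ → ℂ) {s t : ℝ} (h : s ≤ t) : sublevel B s ⊆ sublevel B t :=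
  fun _ hz => ⟨hz.1, hz.2.trans_le (theta_mono h)⟩

theorem isEmpty_sublevel (B : ℂ → ℂ) {t : ℝ} (h : t ≤ 0) : IsEmpty (sublevel B t) :=
  ⟨fun z => absurd z.2.2 (not_lt.2 ((theta_nonpos h).trans (norm_nonneg _)))⟩

/-! ### The persistence module of a function on the disk -/

section Homology

open CategoryTheory

/-- The inclusion of level sets, as a continuous map. -/
def sublevelInclusion (B : ℂ → ℂ) {s t : ℝ} (h : s ≤ t) :
    TopCat.of (sublevel B s) ⟶ TopCat.of (sublevel B t) :=
  TopCat.ofHom ⟨Set.inclusion (sublevel_mono B h), continuous_inclusion _⟩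

/-- Zeroth singular homology with coefficients in the field `F`. -/
def H0 (F : Type u) [Field F] : TopCat.{0} ⥤ ModuleCat.{u} F :=
  (AlgebraicTopology.singularHomologyFunctor (ModuleCat.{u} F) 0).obj (ModuleCat.of F F)

theorem subsingleton_H0_of_isEmpty (F : Type u) [Field F] (X : TopCat.{0}) [IsEmpty X] :
    Subsingleton ((H0 F).obj X) := by
  have e := AlgebraicTopology.singularHomologyFunctorZeroOfTotallyDisconnectedSpace
    (ModuleCat.{u} F) (ModuleCat.of F F) X
  have hz : Limits.IsZero (∐ fun _ : X => ModuleCat.of F F) := by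
    refine (Limits.IsZero.iff_id_eq_zero _).2 ?_
    exact Limits.Sigma.hom_ext _ _ fun x => isEmptyElim x
  exact ModuleCat.subsingleton_of_isZero (hz.of_iso e)

/-- The persistence module of the zeroth homology of the level sets of `B`. -/
def sublevelModule (F : Type u) [Field F] (B : ℂ → ℂ) : PersistenceModule F where
  V t := (H0 F).obj (TopCat.of (sublevel B t))
  map h := ((H0 F).map (sublevelInclusion B h)).hom
  map_comp hst htr := by
    rw [← ModuleCat.hom_comp, ← CategoryTheory.Functor.map_comp]
    rfl
  map_id t := by
    have : sublevelInclusion B (le_refl t) = 𝟙 _ := rfl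
    rw [this, CategoryTheory.Functor.map_id, ModuleCat.hom_id]
  exists_trivial := ⟨0, fun s hs => by
    have := isEmpty_sublevel B hs
    exact subsingleton_H0_of_isEmpty F (TopCat.of (sublevel B s))⟩

end Homology

/-! ### Critical points -/

/-- The critical points of `B` in the unit disk that are not zeros of `B`. -/
def critPoints (B : ℂ → ℂ) : Set ℂ := {w ∈ disk | deriv B w = 0 ∧ B w ≠ 0}

/-- The order of a critical point: the number `m` with `B⁽ᵏ⁾(w) = 0` for `1 ≤ k ≤ m` and
`B⁽ᵐ⁺¹⁾(w) ≠ 0`. -/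
def critOrder (B : ℂ → ℂ) (w : ℂ) : ℕ := sInf {m | iteratedDeriv (m + 1) B w ≠ 0}

/-- The death time `ln ((1 + |B w|) / (1 - |B w|))`. -/
def critTime (B : ℂ → ℂ) (w : ℂ) : ℝ := Real.log ((1 + ‖B w‖) / (1 - ‖B w‖))

end InnerPersistence

end

open InnerPersistence

/-!
The zeroth homology of the level sets `{‖B‖ < θ}` only records how their components merge as `θ`
grows. By Property `𝔅` every component is relatively compact in the disk, so by the minimum principle
it contains a zero of `B`, and only finitely many of them. The module is therefore the
module of a merge tree on the set of zeros (`IsTrapping.isClusterModule`): at time `t > 0` it is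
spanned by the classes of the zeros, two of which agree exactly when the zeros lie in a common
component.

The barcode of any such module follows from the elder rule (`IsClusterModule.isomorphic`). Enumerate the
zeros; each zero other than the first one dies when it is joined to an earlier one. The
class of the first zero generates the bar `(0, ∞)`, and the difference of a zero and an earlier one
that it joins generates a bar `(0, d]`, where `d` is its death time; the bars are closed on the right
because the level sets are open.

It remains to match the death times with the critical values. For this it is enough to know, for
every component `U` of every level set, the Riemann–Hurwitz formula: the number of distinct
zeros of `B` in `U` is one more than the number of critical points in `U`, counted with their orders,
that are not zeros (`riemannHurwitz_levelComponent`). Indeed, if `U` is a component at time `t`, then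
counting zeros minus critical points in the components of `U` at an earlier time `s` shows that in
`U` there are as many critical points with critical time below `s` as zeros that die before `s`
(`MarkedTree.ncard_death_lt`), and exhausting the disk by components yields the bijection
`MarkedTree.exists_equiv`.

The Riemann–Hurwitz formula is proved without triangulations or covering theory. Near a critical
point of order `m`, a function has the normal form `f w * exp (ψ ^ (m + 1))` in a local coordinate `ψ`,
so at most `m + 1` components of the lower level set meet there. Hence the number of components
drops by at most the number of critical points as the level rises (`card_zeros_le`), which gives
`#zeros ≤ 1 + #critical points` in each component. For a polynomial `p` the roots of `p` and `p'` can
be counted, and the total is an equality; so all these inequalities are equalities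
(`riemannHurwitz_polynomial`). A component of a level set of `B` is reduced to this case by a
polynomial which approximates `B` and interpolates it at the zeros and critical points to such an
order that zeros, critical points and their orders in the component agree.

For the second part, a Blaschke product whose zeros `1 - εₖ` tend to the circle extremely fast has
modulus close to `1` on circles that separate the zeros. These circles trap the components of the level
sets, which gives Property `𝔅`; since each component contains finitely many of the infinitely
many zeros, each level set has infinitely many components, and the homology is infinite-dimensional.
-/

namespace InnerPersistence

open Filter Topology

/-! ### Local normal form and sectors at a point of a level curve -/

/-- If `f - f w` vanishes to order `k` at `w` and `f w ≠ 0`, then `f = f w * exp (ψ ^ k)` near `w`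
for some local coordinate `ψ` at `w`. -/
theorem exists_eventually_eq_mul_exp_pow {f : ℂ → ℂ} {w : ℂ} {k : ℕ} (hf : AnalyticAt ℂ f w)
    (hw : f w ≠ 0) (hk : analyticOrderAt (fun z => f z - f w) w = k) (hk0 : k ≠ 0) :
    ∃ ψ : ℂ → ℂ, AnalyticAt ℂ ψ w ∧ ψ w = 0 ∧ deriv ψ w ≠ 0 ∧
      ∀ᶠ z in 𝓝 w, f z = f w * Complex.exp (ψ z ^ k) := by
  set G : ℂ → ℂ := fun z => f z / f w with hG
  have hGan : AnalyticAt ℂ G w := by fun_prop (disch := exact hw)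
  have hGw : G w = 1 := div_self hw
  have hlog : AnalyticAt ℂ Complex.log (G w) := by
    rw [hGw]; exact analyticAt_id.clog (by simp)
  have hlog1 : analyticOrderAt Complex.log (G w) = 1 := by
    refine hlog.analyticOrderAt_eq_one_of_zero_deriv_ne_zero (by simp [hGw]) ?_
    rw [hGw, (Complex.hasDerivAt_log (by simp)).deriv]
    simp
  have hGord : analyticOrderAt (fun z => G z - G w) w = k := by
    have h1 : (fun z => G z - G w) = (fun _ => (f w)⁻¹) * (fun z => f z - f w) := by
      ext z; simp only [hG, Pi.mul_apply]; field_simp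
    rw [h1, analyticOrderAt_mul analyticAt_const (hf.fun_sub analyticAt_const), hk,
      (AnalyticAt.analyticOrderAt_eq_zero analyticAt_const).2 (inv_ne_zero hw), zero_add]
  have hord : analyticOrderAt (Complex.log ∘ G) w = k := by
    rw [hlog.analyticOrderAt_comp hGan, hlog1, hGord, one_mul]
  obtain ⟨h, hh, hh0, hhe⟩ := (hlog.comp hGan).analyticOrderAt_eq_natCast.1 hord
  obtain ⟨c, hc⟩ := IsAlgClosed.exists_pow_nat_eq (h w) (Nat.pos_of_ne_zero hk0)
  have hc0 : c ≠ 0 := by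
    rintro rfl
    rw [zero_pow hk0] at hc
    exact hh0 hc.symm
  -- A local `k`-th root `r` of the unit `h`; the quotient `h z / h w` is near `1`, where the
  -- principal branch of the logarithm is analytic.
  set r : ℂ → ℂ := fun z => c * Complex.exp (Complex.log (h z / h w) / k) with hr
  have hran : AnalyticAt ℂ r w := by
    have h1 : AnalyticAt ℂ (fun z => h z / h w) w := by fun_prop (disch := exact hh0)
    have h2 : AnalyticAt ℂ (fun z => Complex.log (h z / h w)) w := h1.clog (by simp [hh0])
    have h3 : (k : ℂ) ≠ 0 := by exact_mod_cast hk0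
    fun_prop (disch := exact h3)
  have hrw : r w = c := by simp [hr, hh0]
  have hrk : ∀ᶠ z in 𝓝 w, r z ^ k = h z := by
    filter_upwards [hh.continuousAt.eventually_ne hh0] with z hz
    have h3 : (k : ℂ) ≠ 0 := by exact_mod_cast hk0
    rw [hr, mul_pow, ← Complex.exp_nat_mul, mul_div_cancel₀ _ h3,
      Complex.exp_log (div_ne_zero hz hh0), hc]
    field_simp
  refine ⟨fun z => (z - w) * r z, by fun_prop, by simp, ?_, ?_⟩
  · have hd : HasDerivAt (fun z => (z - w) * r z) (1 * r w + (w - w) * deriv r w) w :=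
      ((hasDerivAt_id w).sub_const w).mul hran.differentiableAt.hasDerivAt
    rw [hd.deriv]
    simpa [hrw] using hc0
  · filter_upwards [hrk, hhe, hGan.continuousAt.eventually_ne (hGw ▸ one_ne_zero)] with z h1 h2 h3
    rw [mul_pow, h1, ← smul_eq_mul (a := (z - w) ^ k), ← h2, Function.comp_apply,
      Complex.exp_log h3]
    simp only [hG]
    field_simp

/-- The sector around the direction `ω * exp (i π / k)` in the disk of radius `ρ`, of opening
angle `π / k`. -/
def sector (k : ℕ) (ρ : ℝ) (ω : ℂ) : Set ℂ :=
  (fun p : ℝ × ℝ => ω * (p.1 * Complex.exp ((Real.pi + p.2) / k * Complex.I))) ''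
    (Set.Ioo 0 ρ ×ˢ Set.Ioo (-(Real.pi / 2)) (Real.pi / 2))

theorem isPreconnected_sector (k : ℕ) (ρ : ℝ) (ω : ℂ) : IsPreconnected (sector k ρ ω) :=
  (isPreconnected_Ioo.prod isPreconnected_Ioo).image _ (by fun_prop)

theorem sector_subset {k : ℕ} (hk : k ≠ 0) {ρ : ℝ} {ω : ℂ} (hω : ω ^ k = 1) :
    sector k ρ ω ⊆ {ζ | ‖ζ‖ < ρ ∧ (ζ ^ k).re < 0} := by
  rintro _ ⟨⟨r, θ⟩, ⟨hr, hθ⟩, rfl⟩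
  have h3 : (k : ℂ) ≠ 0 := by exact_mod_cast hk
  simp only [Set.mem_Ioo] at hr hθ
  constructor
  · have h1 : ‖ω‖ = 1 := Complex.norm_eq_one_of_pow_eq_one hω hk
    have h2 : ((Real.pi : ℂ) + θ) / k * Complex.I = (((Real.pi + θ) / k : ℝ) : ℂ) * Complex.I := by
      push_cast; ring
    simp only [norm_mul, h1, h2, Complex.norm_exp_ofReal_mul_I, one_mul, mul_one]
    rw [Complex.norm_real, Real.norm_of_nonneg hr.1.le]
    exact hr.2
  · have h4 : (k : ℂ) * (((Real.pi : ℂ) + θ) / k * Complex.I)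
        = ((Real.pi + θ : ℝ) : ℂ) * Complex.I := by
      push_cast; field_simp
    simp only [mul_pow, hω, ← Complex.exp_nat_mul, h4, one_mul]
    rw [← Complex.ofReal_pow, Complex.re_ofReal_mul, Complex.exp_ofReal_mul_I_re, Real.cos_add]
    have := Real.cos_pos_of_mem_Ioo hθ
    have := pow_pos hr.1 k
    simp only [Real.cos_pi, Real.sin_pi]
    nlinarith

theorem exists_mem_sector {k : ℕ} (hk : k ≠ 0) {ρ : ℝ} {ζ : ℂ} (hζ : ‖ζ‖ < ρ)
    (hre : (ζ ^ k).re < 0) : ∃ ω : ℂ, ω ^ k = 1 ∧ ζ ∈ sector k ρ ω := by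
  have h3 : (k : ℂ) ≠ 0 := by exact_mod_cast hk
  have hζ0 : ζ ≠ 0 := by
    rintro rfl
    simp [zero_pow hk] at hre
  set θ := Complex.arg (-(ζ ^ k)) with hθ
  have hθ2 : |θ| < Real.pi / 2 := Complex.abs_arg_lt_pi_div_two_iff.2 (Or.inl (by simpa using hre))
  set ξ : ℂ := (‖ζ‖ : ℂ) * Complex.exp ((Real.pi + θ) / k * Complex.I) with hξ
  have hξk : ξ ^ k = ζ ^ k := by
    have h4 : (k : ℂ) * (((Real.pi : ℂ) + θ) / k * Complex.I)
        = Real.pi * Complex.I + θ * Complex.I := by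
      field_simp
    rw [hξ, mul_pow, ← Complex.exp_nat_mul, h4, Complex.exp_add, Complex.exp_pi_mul_I]
    have := Complex.norm_mul_exp_arg_mul_I (-(ζ ^ k))
    rw [norm_neg, norm_pow, ← hθ] at this
    push_cast at this
    linear_combination -this
  have hξ0 : ξ ≠ 0 := by
    simp [hξ, hζ0, Complex.exp_ne_zero]
  refine ⟨ζ / ξ, ?_, (‖ζ‖, θ), ⟨⟨norm_pos_iff.2 hζ0, hζ⟩, abs_lt.1 hθ2⟩, ?_⟩
  · rw [div_pow, hξk, div_self (pow_ne_zero _ hζ0)]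
  · change ζ / ξ * ξ = ζ
    field_simp

/-- Near a point `w` with `f w ≠ 0` at which `f - f w` vanishes to order `k`, the set
`{‖f‖ < ‖f w‖}` is a union of `k` connected sets. -/
theorem exists_local_sectors {f : ℂ → ℂ} {w : ℂ} {k : ℕ} (hf : AnalyticAt ℂ f w)
    (hw : f w ≠ 0) (hk : analyticOrderAt (fun z => f z - f w) w = k) (hk0 : k ≠ 0)
    {V : Set ℂ} (hV : V ∈ 𝓝 w) :
    ∃ (ι : Finset ℂ) (S : ℂ → Set ℂ), ι.card = k ∧
      (∀ j ∈ ι, IsPreconnected (S j) ∧ S j ⊆ V ∩ {z | ‖f z‖ < ‖f w‖}) ∧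
      ∃ N ∈ 𝓝 w, N ∩ {z | ‖f z‖ < ‖f w‖} ⊆ ⋃ j ∈ ι, S j := by
  obtain ⟨ψ, hψ, hψw, hψ', he⟩ := exists_eventually_eq_mul_exp_pow hf hw hk hk0
  set Φ := (hψ.hasStrictDerivAt.hasStrictFDerivAt_equiv hψ').toOpenPartialHomeomorph ψ with hΦ
  have hΦψ : (Φ : ℂ → ℂ) = ψ := HasStrictFDerivAt.toOpenPartialHomeomorph_coe _
  have hwΦ : w ∈ Φ.source := HasStrictFDerivAt.mem_toOpenPartialHomeomorph_source _
  have h0Φ : (0 : ℂ) ∈ Φ.target := by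
    have := Φ.map_source hwΦ
    rwa [hΦψ, hψw] at this
  have hsymm0 : Φ.symm 0 = w := by
    have := Φ.left_inv hwΦ
    rwa [hΦψ, hψw] at this
  have hcont : ContinuousAt Φ.symm 0 := Φ.continuousAt_symm h0Φ
  have hev : ∀ᶠ ζ in 𝓝 (0 : ℂ), ζ ∈ Φ.target ∧ Φ.symm ζ ∈ V ∧
      f (Φ.symm ζ) = f w * Complex.exp (ψ (Φ.symm ζ) ^ k) := by
    have h1 : ∀ᶠ z in 𝓝 (Φ.symm 0), z ∈ V := by rw [hsymm0]; exact hV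
    have h2 : ∀ᶠ z in 𝓝 (Φ.symm 0), f z = f w * Complex.exp (ψ z ^ k) := by rwa [hsymm0]
    exact (Φ.open_target.eventually_mem h0Φ).and ((hcont.eventually h1).and (hcont.eventually h2))
  obtain ⟨ρ, hρ, hball⟩ := Metric.eventually_nhds_iff_ball.1 hev
  have hlt : ∀ z, f z = f w * Complex.exp (ψ z ^ k) → (‖f z‖ < ‖f w‖ ↔ (ψ z ^ k).re < 0) := by
    intro z hz
    rw [hz, norm_mul, Complex.norm_exp, mul_lt_iff_lt_one_right (norm_pos_iff.2 hw),
      Real.exp_lt_one_iff]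
  -- In the coordinate `ψ` the set `{‖f‖ < ‖f w‖}` is `{Re ζ ^ k < 0}`, a union of sectors, one for
  -- each `k`-th root of unity.
  refine ⟨Polynomial.nthRootsFinset k 1, fun ω => Φ.symm '' sector k ρ ω,
    (Complex.isPrimitiveRoot_exp k hk0).card_nthRootsFinset, ?_, ?_⟩
  · intro ω hω
    have hω' : ω ^ k = 1 := (Polynomial.mem_nthRootsFinset (Nat.pos_of_ne_zero hk0) _).1 hω
    have hsub : ∀ ζ ∈ sector k ρ ω, ζ ∈ Metric.ball (0 : ℂ) ρ := fun ζ hζ => by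
      simpa using (sector_subset hk0 hω' hζ).1
    refine ⟨(isPreconnected_sector k ρ ω).image _
      (Φ.continuousOn_symm.mono fun ζ hζ => (hball ζ (hsub ζ hζ)).1), ?_⟩
    rintro _ ⟨ζ, hζ, rfl⟩
    obtain ⟨h1, h2, h3⟩ := hball ζ (hsub ζ hζ)
    refine ⟨h2, (hlt _ h3).2 ?_⟩
    rw [← hΦψ, Φ.right_inv h1]
    exact (sector_subset hk0 hω' hζ).2
  · refine ⟨Φ.source ∩ ψ ⁻¹' Metric.ball 0 ρ, inter_mem (Φ.open_source.mem_nhds hwΦ)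
      (hψ.continuousAt.preimage_mem_nhds (by rw [hψw]; exact Metric.ball_mem_nhds _ hρ)), ?_⟩
    rintro z ⟨⟨hz1, hz2⟩, hz3⟩
    have hz2' : ‖ψ z‖ < ρ := by simpa using hz2
    have hz4 : Φ.symm (ψ z) = z := by rw [← hΦψ, Φ.left_inv hz1]
    have h3 := (hball _ hz2).2.2
    rw [hz4] at h3
    obtain ⟨ω, hω, hmem⟩ := exists_mem_sector hk0 hz2' ((hlt _ h3).1 hz3)
    simp only [Set.mem_iUnion]
    exact ⟨ω, (Polynomial.mem_nthRootsFinset (Nat.pos_of_ne_zero hk0) _).2 hω, ψ z, hmem, hz4⟩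

/-! ### Components of sublevel sets of a proper holomorphic function -/

/-- The connected component of `z` in the part of the open set `A` where `‖f‖ < t`. -/
def levelComponent (f : ℂ → ℂ) (A : Set ℂ) (t : ℝ) (z : ℂ) : Set ℂ :=
  connectedComponentIn {y ∈ A | ‖f y‖ < t} z

/-- `f` is holomorphic on the open set `A`, nowhere locally constant, and proper over the open disk
of radius `b`: the parts of `A` where `‖f‖ ≤ s` are compact for all `s < b`. -/
structure IsProperLevel (f : ℂ → ℂ) (A : Set ℂ) (b : ℝ) : Prop where
  isOpen : IsOpen A
  analytic : AnalyticOnNhd ℂ f A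
  compact : ∀ s < b, IsCompact {z ∈ A | ‖f z‖ ≤ s}
  order_ne_top : ∀ z ∈ A, analyticOrderAt (fun y => f y - f z) z ≠ ⊤

section LevelComponent

variable {f : ℂ → ℂ} {A : Set ℂ} {b s t : ℝ} {z w : ℂ}

theorem isOpen_inter_sublevel (hA : IsOpen A) (hf : ContinuousOn f A) (t : ℝ) :
    IsOpen {y ∈ A | ‖f y‖ < t} :=
  hf.norm.isOpen_inter_preimage hA isOpen_Iio

theorem mem_levelComponent_self (hz : z ∈ A) (h : ‖f z‖ < t) : z ∈ levelComponent f A t z :=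
  mem_connectedComponentIn ⟨hz, h⟩

theorem levelComponent_subset : levelComponent f A t z ⊆ {y ∈ A | ‖f y‖ < t} :=
  connectedComponentIn_subset _ _

theorem levelComponent_eq (h : w ∈ levelComponent f A t z) :
    levelComponent f A t z = levelComponent f A t w :=
  connectedComponentIn_eq h

theorem levelComponent_eq_iff (hw : w ∈ A) (h : ‖f w‖ < t) :
    levelComponent f A t z = levelComponent f A t w ↔ w ∈ levelComponent f A t z :=
  ⟨fun e => e ▸ mem_levelComponent_self hw h, levelComponent_eq⟩

theorem levelComponent_mono (h : s ≤ t) : levelComponent f A s z ⊆ levelComponent f A t z :=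
  connectedComponentIn_mono _ fun _ hy => ⟨hy.1, hy.2.trans_le h⟩

theorem isPreconnected_levelComponent : IsPreconnected (levelComponent f A t z) :=
  isPreconnected_connectedComponentIn

/-- Two points in one component of an open sublevel set lie in one component of a slightly lower
sublevel set, since a path joining them is compact. -/
theorem exists_lt_mem_levelComponent (hA : IsOpen A) (hf : ContinuousOn f A)
    (h : w ∈ levelComponent f A t z) : ∃ s < t, w ∈ levelComponent f A s z := by
  have hz : z ∈ {y ∈ A | ‖f y‖ < t} := by
    by_contra hz
    rw [levelComponent, connectedComponentIn_eq_empty hz] at h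
    exact h
  have hop : IsOpen (levelComponent f A t z) := (isOpen_inter_sublevel hA hf t).connectedComponentIn
  have hco : IsConnected (levelComponent f A t z) :=
    isConnected_connectedComponentIn_iff.2 hz
  obtain ⟨γ, hγ⟩ := ((hop.isConnected_iff_isPathConnected).1 hco).joinedIn z
    (mem_connectedComponentIn hz) w h
  have hcomp : IsCompact (Set.range γ) := isCompact_range γ.continuous
  have hsub : Set.range γ ⊆ {y ∈ A | ‖f y‖ < t} := by
    rintro _ ⟨x, rfl⟩
    exact levelComponent_subset (hγ x)
  obtain ⟨y, hy, hmax⟩ := hcomp.exists_isMaxOn ⟨γ 0, 0, rfl⟩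
    (hf.norm.mono fun y hy => (hsub hy).1)
  obtain ⟨s, hs1, hs2⟩ := exists_between (hsub hy).2
  refine ⟨s, hs2, ?_⟩
  have hpre : IsPreconnected (Set.range γ) := isPreconnected_range γ.continuous
  refine hpre.subset_connectedComponentIn ⟨0, by simp⟩ ?_ ⟨1, by simp⟩
  intro x hx
  exact ⟨(hsub hx).1, (hmax hx).trans_lt hs1⟩

namespace IsProperLevel

variable (hP : IsProperLevel f A b)
include hP

theorem continuousOn : ContinuousOn f A := hP.analytic.continuousOn

theorem isOpen_levelComponent (t : ℝ) (z : ℂ) : IsOpen (levelComponent f A t z) :=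
  (isOpen_inter_sublevel hP.isOpen hP.continuousOn t).connectedComponentIn

theorem closure_levelComponent_subset (hs : s < b) :
    closure (levelComponent f A s z) ⊆ {y ∈ A | ‖f y‖ ≤ s} :=
  closure_minimal (fun _ hy => ⟨(levelComponent_subset hy).1, (levelComponent_subset hy).2.le⟩)
    (hP.compact s hs).isClosed

/-- A component is relatively closed in the sublevel set. -/
theorem mem_levelComponent_of_mem_closure (hw : w ∈ closure (levelComponent f A s z))
    (hwA : w ∈ A) (hlt : ‖f w‖ < s) : w ∈ levelComponent f A s z := by
  have hop := hP.isOpen_levelComponent s w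
  obtain ⟨y, hy1, hy2⟩ := mem_closure_iff.1 hw _ hop (mem_levelComponent_self hwA hlt)
  rw [levelComponent_eq hy2, ← levelComponent_eq hy1]
  exact mem_levelComponent_self hwA hlt

/-- Minimum principle: each component of a sublevel set contains a zero. -/
theorem exists_zero_mem (ht : t ≤ b) (hz : z ∈ A) (hzt : ‖f z‖ < t) :
    ∃ y ∈ levelComponent f A t z, f y = 0 := by
  -- Below the level `t` the component is relatively compact in `A`, even if `t = b`.
  obtain ⟨s, hs1, hs2⟩ := exists_between hzt
  by_contra! hne
  have hs0 : 0 < s := (norm_nonneg _).trans_lt hs1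
  set U := levelComponent f A s z with hU
  have hcl := hP.closure_levelComponent_subset (z := z) (hs2.trans_le ht)
  have hne' : ∀ y ∈ closure U, f y ≠ 0 := by
    intro y hy h0
    refine hne y (levelComponent_mono hs2.le ?_) h0
    exact hP.mem_levelComponent_of_mem_closure hy (hcl hy).1 (by simpa [h0] using hs0)
  have hbd : Bornology.IsBounded U :=
    ((hP.compact s (hs2.trans_le ht)).isBounded).subset (subset_closure.trans hcl)
  have hdiff : DiffContOnCl ℂ (fun y => (f y)⁻¹) U := by
    refine DifferentiableOn.diffContOnCl fun y hy => ?_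
    exact ((hP.analytic y (hcl hy).1).differentiableAt.inv (hne' y hy)).differentiableWithinAt
  have hfr : ∀ y ∈ frontier U, ‖(f y)⁻¹‖ ≤ s⁻¹ := by
    intro y hy
    rw [(hP.isOpen_levelComponent s z).frontier_eq] at hy
    rw [norm_inv]
    refine inv_anti₀ hs0 (not_lt.1 fun h => hy.2 ?_)
    exact hP.mem_levelComponent_of_mem_closure hy.1 (hcl hy.1).1 h
  have hzU : z ∈ U := mem_levelComponent_self hz hs1
  -- The maximum principle for `1 / f` on `U`, whose boundary lies on the curve `‖f‖ = s`.
  have := Complex.norm_le_of_forall_mem_frontier_norm_le hbd hdiff hfr (subset_closure hzU)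
  rw [norm_inv, inv_le_inv₀ (norm_pos_iff.2 (hne' z (subset_closure hzU))) hs0] at this
  exact absurd hs1 (not_lt.2 this)

/-- If the compact set `{‖f‖ ≤ s}` is split into finitely many disjoint compact parts, then points
of different parts stay in different components of `{‖f‖ < s'}` for `s' > s` close to `s`. -/
theorem exists_separating_level {X : Type*} (hs : s < b) (C : Finset X)
    (col : ℂ → X) (hcol : ∀ z ∈ A, ‖f z‖ ≤ s → col z ∈ C)
    (hclosed : ∀ x ∈ C, IsClosed {z | (z ∈ A ∧ ‖f z‖ ≤ s) ∧ col z = x}) :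
    ∃ s', s < s' ∧ s' < b ∧ ∀ z z', ‖f z‖ ≤ s → z' ∈ A → ‖f z'‖ ≤ s →
      z' ∈ levelComponent f A s' z → col z' = col z := by
  classical
  set K := {z ∈ A | ‖f z‖ ≤ s} with hK
  have hKc : IsCompact K := hP.compact s hs
  have hsep : ∀ x ∈ C, ∃ s', s < s' ∧ s' < b ∧ ∀ z z', ‖f z‖ ≤ s → z' ∈ A → ‖f z'‖ ≤ s →
      z' ∈ levelComponent f A s' z → col z = x → col z' = x := by
    intro x hx
    have hx1 : IsCompact {z | z ∈ K ∧ col z = x} :=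
      hKc.of_isClosed_subset (hclosed x hx) fun _ h => h.1
    have hx2 : IsCompact (⋃ y ∈ C.erase x, {z | z ∈ K ∧ col z = y}) := by
      refine (C.erase x).isCompact_biUnion fun y hy => ?_
      exact hKc.of_isClosed_subset (hclosed y (Finset.mem_of_mem_erase hy)) fun _ h => h.1
    have hdisj : Disjoint {z | z ∈ K ∧ col z = x} (⋃ y ∈ C.erase x, {z | z ∈ K ∧ col z = y}) := by
      rw [Set.disjoint_left]
      rintro z ⟨-, h1⟩ h2
      simp only [Set.mem_iUnion] at h2
      obtain ⟨y, hy, -, h3⟩ := h2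
      exact (Finset.ne_of_mem_erase hy) (h3.symm.trans h1)
    obtain ⟨U, V, hU, hV, hUK, hVK, hUV⟩ := SeparatedNhds.of_isCompact_isCompact hx1 hx2 hdisj
    have hKUV : K ⊆ U ∪ V := by
      intro z hz
      by_cases h : col z = x
      · exact Or.inl (hUK ⟨hz, h⟩)
      · refine Or.inr (hVK ?_)
        simp only [Set.mem_iUnion]
        exact ⟨col z, Finset.mem_erase.2 ⟨h, hcol z hz.1 hz.2⟩, hz, rfl⟩
    obtain ⟨s1, hs1, hs1b⟩ := exists_between hs
    -- As `K` is the intersection of the compact sets `{‖f‖ ≤ s'}` with `s' > s`, one of them lies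
    -- in `U ∪ V`.
    obtain ⟨s', hs', hs'b, hsub⟩ : ∃ s', s < s' ∧ s' < b ∧ ∀ z ∈ A, ‖f z‖ < s' → z ∈ U ∪ V := by
      have hcomp : IsCompact ({z ∈ A | ‖f z‖ ≤ s1} \ (U ∪ V)) :=
        (hP.compact s1 hs1b).diff (hU.union hV)
      rcases Set.eq_empty_or_nonempty ({z ∈ A | ‖f z‖ ≤ s1} \ (U ∪ V)) with he | hne
      · refine ⟨s1, hs1, hs1b, fun z hz h => ?_⟩
        by_contra hzn
        exact (Set.eq_empty_iff_forall_notMem.1 he z) ⟨⟨hz, h.le⟩, hzn⟩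
      · obtain ⟨y, hy, hmin⟩ := hcomp.exists_isMinOn hne
          (hP.continuousOn.norm.mono fun y hy => hy.1.1)
        have hys : s < ‖f y‖ := not_le.1 fun h => hy.2 (hKUV ⟨hy.1.1, h⟩)
        refine ⟨min s1 ‖f y‖, lt_min hs1 hys, (min_le_left _ _).trans_lt hs1b, fun z hz h => ?_⟩
        by_contra hzn
        have := hmin ⟨⟨hz, (h.trans_le (min_le_left _ _)).le⟩, hzn⟩
        exact absurd (h.trans_le (min_le_right _ _)) (not_lt.2 this)
    refine ⟨s', hs', hs'b, fun z z' hz hzA' hz' hmem hcz => ?_⟩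
    by_contra hcz'
    have hzA : z ∈ {y ∈ A | ‖f y‖ < s'} := by
      by_contra h
      rw [levelComponent, connectedComponentIn_eq_empty h] at hmem
      exact hmem
    have hzU : z ∈ U := hUK ⟨⟨hzA.1, hz⟩, hcz⟩
    have hzV' : z' ∈ V := by
      refine hVK ?_
      simp only [Set.mem_iUnion]
      exact ⟨col z', Finset.mem_erase.2 ⟨hcz', hcol z' hzA' hz'⟩, ⟨hzA', hz'⟩, rfl⟩
    have hsubU : levelComponent f A s' z ⊆ U :=
      isPreconnected_levelComponent.subset_left_of_subset_union hU hV hUV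
        (fun y hy => hsub y (levelComponent_subset hy).1 (levelComponent_subset hy).2)
        ⟨z, mem_levelComponent_self hzA.1 hzA.2, hzU⟩
    exact Set.disjoint_left.1 hUV (hsubU hmem) hzV'
  choose! σ hσ1 hσ2 hσ3 using hsep
  obtain ⟨s1, hs1, hs1b⟩ := exists_between hs
  obtain ⟨s', hs's, hs'le⟩ : ∃ s', s < s' ∧ (s' ≤ s1 ∧ ∀ x ∈ C, s' ≤ σ x) := by
    have h1 : ∀ᶠ s' in 𝓝[>] s, s' ≤ s1 :=
      mem_nhdsWithin_of_mem_nhds (Iic_mem_nhds hs1)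
    have h2 : ∀ᶠ s' in 𝓝[>] s, ∀ x ∈ C, s' ≤ σ x :=
      (C.eventually_all).2 fun x hx =>
        mem_nhdsWithin_of_mem_nhds (Iic_mem_nhds (hσ1 x hx))
    obtain ⟨s', h⟩ := ((h1.and h2).and self_mem_nhdsWithin).exists
    exact ⟨s', h.2, h.1⟩
  refine ⟨s', hs's, hs'le.1.trans_lt hs1b, fun z z' hz hzA' hz' hmem => ?_⟩
  have hzA : z ∈ A := by
    by_contra h
    rw [levelComponent, connectedComponentIn_eq_empty fun h' => h h'.1] at hmem
    exact hmem
  have hx := hcol z hzA hz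
  exact hσ3 _ hx z z' hz hzA' hz' (levelComponent_mono (hs'le.2 _ hx) hmem) rfl

end IsProperLevel

end LevelComponent

/-! ### The merging inequality -/

/-- Merging, for each of finitely many sets `J w`, the colours of its elements into one loses at
most `#(J w) - 1` colours at a time. -/
theorem exists_coloring {α β : Type*} [DecidableEq α] (I : Finset α) (W : Finset β) (J : β → Finset α)
    (hJ : ∀ w ∈ W, J w ⊆ I) :
    ∃ c : α → α, (∀ w ∈ W, ∀ i ∈ J w, ∀ j ∈ J w, c i = c j) ∧
      I.card ≤ (I.image c).card + ∑ w ∈ W, ((J w).card - 1) := by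
  classical
  induction W using Finset.induction_on with
  | empty => exact ⟨id, by simp⟩
  | insert w W hw ih =>
    obtain ⟨c, hc, hcard⟩ := ih fun w' hw' => hJ w' (Finset.mem_insert_of_mem hw')
    rw [Finset.sum_insert hw]
    rcases (J w).eq_empty_or_nonempty with he | ⟨i₀, hi₀⟩
    · refine ⟨c, fun w' hw' => ?_, by omega⟩
      rcases Finset.mem_insert.1 hw' with rfl | h
      · simp [he]
      · exact hc w' h
    · refine ⟨fun i => if c i ∈ (J w).image c then c i₀ else c i, fun w' hw' i hi j hj => ?_, ?_⟩
      · rcases Finset.mem_insert.1 hw' with rfl | h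
        · simp only
          rw [if_pos (Finset.mem_image_of_mem c hi), if_pos (Finset.mem_image_of_mem c hj)]
        · simp only [hc w' h i hi j hj]
      · set c' : α → α := fun i => if c i ∈ (J w).image c then c i₀ else c i with hc'
        have hsub : I.image c ⊆ I.image c' ∪ ((J w).image c).erase (c i₀) := by
          intro x hx
          obtain ⟨i, hi, rfl⟩ := Finset.mem_image.1 hx
          by_cases h : c i ∈ (J w).image c
          · by_cases h2 : c i = c i₀
            · refine Finset.mem_union_left _ (Finset.mem_image.2 ⟨i₀, ?_, ?_⟩)
              · exact hJ w (Finset.mem_insert_self _ _) hi₀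
              · simp only [hc']
                rw [if_pos (Finset.mem_image_of_mem c hi₀), h2]
            · exact Finset.mem_union_right _ (Finset.mem_erase.2 ⟨h2, h⟩)
          · refine Finset.mem_union_left _ (Finset.mem_image.2 ⟨i, hi, ?_⟩)
            simp only [hc', if_neg h]
        have h1 := (Finset.card_le_card hsub).trans (Finset.card_union_le _ _)
        rw [Finset.card_erase_of_mem (Finset.mem_image_of_mem c hi₀)] at h1
        have h2 : ((J w).image c).card ≤ (J w).card := Finset.card_image_le
        omega

open Classical in
/-- The number of components of `{z ∈ A : ‖f z‖ < t}` that meet the finite set `Z`. -/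
noncomputable def numComponents (f : ℂ → ℂ) (A : Set ℂ) (Z : Finset ℂ) (t : ℝ) : ℕ :=
  (Z.image (levelComponent f A t)).card

theorem analyticOrderAt_sub_eq {f : ℂ → ℂ} {w : ℂ} (hf : AnalyticAt ℂ f w)
    (h : analyticOrderAt (fun y => f y - f w) w ≠ ⊤) :
    analyticOrderAt (fun y => f y - f w) w = ((analyticOrderNatAt (deriv f) w + 1 : ℕ) : ℕ∞) := by
  have h1 := hf.analyticOrderAt_deriv_add_one
  rw [← h1, Nat.cast_add, Nat.cast_one, Nat.cast_analyticOrderNatAt]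
  intro h2
  rw [h2, top_add] at h1
  exact h h1.symm

/-- If points in one class for `g` are in one class for `h`, then `h` takes no more values. -/
theorem card_image_le_of_imp {α β γ : Type*} [DecidableEq β] [DecidableEq γ] (Z : Finset α)
    (g : α → β) (h : α → γ) (H : ∀ x ∈ Z, ∀ y ∈ Z, g x = g y → h x = h y) :
    (Z.image h).card ≤ (Z.image g).card := by
  rcases Z.eq_empty_or_nonempty with rfl | ⟨z, -⟩
  · simp
  have : Nonempty α := ⟨z⟩
  have h1 : ∀ y ∈ Z.image h, ∃ x ∈ Z, h x = y := fun y hy => Finset.mem_image.1 hy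
  choose! x hx1 hx2 using h1
  refine Finset.card_le_card_of_injOn (fun y => g (x y))
    (fun y hy => Finset.mem_image_of_mem _ (hx1 y hy)) fun y hy y' hy' he => ?_
  rw [← hx2 y hy, ← hx2 y' hy']
  exact H _ (hx1 y hy) _ (hx1 y' hy') he

namespace IsProperLevel

variable {f : ℂ → ℂ} {A : Set ℂ} {b s : ℝ} (hP : IsProperLevel f A b) {Z : Finset ℂ}
include hP

open Classical in
/-- At most `m + 1` components of `{‖f‖ < s}` touch a point of the level curve at which the
derivative vanishes to order `m`. -/
theorem card_touching_le (hs0 : 0 < s) {w : ℂ} (hw : w ∈ A)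
    (hws : ‖f w‖ = s) :
    ((Z.image (levelComponent f A s)).filter (w ∈ closure ·)).card ≤
      analyticOrderNatAt (deriv f) w + 1 := by
  have hfw : f w ≠ 0 := by
    intro h0
    rw [h0, norm_zero] at hws
    exact hs0.ne hws
  obtain ⟨ι, S, hι, hS, N, hN, hNS⟩ := exists_local_sectors (hP.analytic w hw) hfw
    (analyticOrderAt_sub_eq (hP.analytic w hw) (hP.order_ne_top w hw)) (Nat.succ_ne_zero _)
    (hP.isOpen.mem_nhds hw)
  rw [← hι]
  -- Each component that touches `w` contains one of the `m + 1` sectors at `w`.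
  refine (Finset.card_le_card (t := ι.image fun j =>
    if h : (S j).Nonempty then levelComponent f A s h.choose else ∅) ?_).trans Finset.card_image_le
  intro U hU
  obtain ⟨hU, hwU⟩ := Finset.mem_filter.1 hU
  obtain ⟨z, hz, rfl⟩ := Finset.mem_image.1 hU
  obtain ⟨y, hyN, hyU⟩ := mem_closure_iff_nhds.1 hwU N hN
  have hy := levelComponent_subset hyU
  have hyS := hNS ⟨hyN, show ‖f y‖ < ‖f w‖ from hws ▸ hy.2⟩
  simp only [Set.mem_iUnion] at hyS
  obtain ⟨j, hj, hyj⟩ := hyS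
  refine Finset.mem_image.2 ⟨j, hj, ?_⟩
  have hne : (S j).Nonempty := ⟨y, hyj⟩
  rw [dif_pos hne, levelComponent_eq hyU]
  have hsub : S j ⊆ {y ∈ A | ‖f y‖ < s} := fun x hx =>
    ⟨((hS j hj).2 hx).1, lt_of_lt_of_eq ((hS j hj).2 hx).2 hws⟩
  exact (levelComponent_eq
    ((hS j hj).1.subset_connectedComponentIn hyj hsub hne.choose_spec)).symm

variable (hZ : ∀ z, z ∈ Z ↔ z ∈ A ∧ f z = 0)
include hZ

theorem levelComponent_mem_image [DecidableEq (Set ℂ)] (hs : s ≤ b) {z : ℂ} (hz : z ∈ A)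
    (hzs : ‖f z‖ < s) : levelComponent f A s z ∈ Z.image (levelComponent f A s) := by
  obtain ⟨y, hy, hy0⟩ := hP.exists_zero_mem hs hz hzs
  exact Finset.mem_image.2 ⟨y, (hZ y).2 ⟨(levelComponent_subset hy).1, hy0⟩,
    (levelComponent_eq hy).symm⟩

theorem exists_mem_closure [DecidableEq (Set ℂ)] (hs : s ≤ b) (hs0 : 0 < s) {z : ℂ} (hz : z ∈ A)
    (hzs : ‖f z‖ ≤ s) : ∃ U ∈ Z.image (levelComponent f A s), z ∈ closure U := by
  rcases hzs.lt_or_eq with h | h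
  · exact ⟨_, hP.levelComponent_mem_image hZ hs hz h,
      subset_closure (mem_levelComponent_self hz h)⟩
  · have h1 : z ∈ closure (⋃ U ∈ Z.image (levelComponent f A s), U) := by
      have hfz : f z ≠ 0 := by
        intro h0
        rw [h0, norm_zero] at h
        exact hs0.ne h
      obtain ⟨ι, S, -, -, -⟩ := exists_local_sectors (hP.analytic z hz) hfz
        (analyticOrderAt_sub_eq (hP.analytic z hz) (hP.order_ne_top z hz)) (Nat.succ_ne_zero _)
        (hP.isOpen.mem_nhds hz)
      rw [mem_closure_iff_nhds]
      intro V hV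
      have hmap : 𝓝 (f z) ≤ map f (𝓝 z) := by
        refine (hP.analytic z hz).eventually_constant_or_nhds_le_map_nhds.resolve_left fun hc => ?_
        refine hP.order_ne_top z hz (analyticOrderAt_eq_top.2 ?_)
        filter_upwards [hc] with y hy
        rw [hy, sub_self]
      have hVA : f '' (V ∩ A) ∈ 𝓝 (f z) :=
        hmap (image_mem_map (inter_mem hV (hP.isOpen.mem_nhds hz)))
      have hcl : f z ∈ closure (Metric.ball (0 : ℂ) s) := by
        rw [closure_ball _ hs0.ne']; simp [h]
      obtain ⟨_, ⟨y, hy, rfl⟩, hy2⟩ := mem_closure_iff_nhds.1 hcl _ hVA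
      have hys : ‖f y‖ < s := by simpa using hy2
      refine ⟨y, hy.1, ?_⟩
      simp only [Set.mem_iUnion]
      exact ⟨_, hP.levelComponent_mem_image hZ hs hy.2 hys, mem_levelComponent_self hy.2 hys⟩
    rw [Finset.closure_biUnion] at h1
    simpa only [Set.mem_iUnion, exists_prop] using h1

open Classical in
/-- Crossing the level `s` upwards loses at most as many components as there are critical points
of modulus `s`, counted with multiplicity. -/
theorem exists_gt_numComponents_le (hs : s < b) (hs0 : 0 < s) (W : Finset ℂ)
    (hW : ∀ w ∈ A, ‖f w‖ = s → deriv f w = 0 → w ∈ W) :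
    ∃ s', s < s' ∧ s' < b ∧ numComponents f A Z s ≤ numComponents f A Z s' +
      ∑ w ∈ W with w ∈ A ∧ ‖f w‖ = s, analyticOrderNatAt (deriv f) w := by
  classical
  set I := Z.image (levelComponent f A s) with hI
  set J : ℂ → Finset (Set ℂ) := fun w => I.filter (w ∈ closure ·) with hJ
  set W' := W.filter fun w => w ∈ A ∧ ‖f w‖ = s with hW'
  -- Colour the components so that those which touch at a common critical point agree.
  obtain ⟨c, hc, hcard⟩ := exists_coloring I W' J fun w _ => Finset.filter_subset _ _
  have hcol : ∀ z ∈ A, ‖f z‖ ≤ s → ∃ U ∈ I, z ∈ closure U :=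
    fun z hz h => hP.exists_mem_closure hZ hs.le hs0 hz h
  -- Components whose closures meet have the same colour, since only one component touches a
  -- regular point of the level curve.
  have huniq : ∀ z ∈ A, ‖f z‖ ≤ s → ∀ U ∈ I, ∀ V ∈ I, z ∈ closure U → z ∈ closure V →
      c U = c V := by
    intro z hz hzs U hU V hV hzU hzV
    rcases hzs.lt_or_eq with h | h
    · obtain ⟨x, -, rfl⟩ := Finset.mem_image.1 hU
      obtain ⟨y, -, rfl⟩ := Finset.mem_image.1 hV
      rw [levelComponent_eq (hP.mem_levelComponent_of_mem_closure hzU hz h),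
        levelComponent_eq (hP.mem_levelComponent_of_mem_closure hzV hz h)]
    · by_cases hd : deriv f z = 0
      · exact hc z (Finset.mem_filter.2 ⟨hW z hz h hd, hz, h⟩) U (Finset.mem_filter.2 ⟨hU, hzU⟩) V
          (Finset.mem_filter.2 ⟨hV, hzV⟩)
      · have h1 := hP.card_touching_le (Z := Z) hs0 hz h
        have h2 : analyticOrderNatAt (deriv f) z = 0 := by
          rw [analyticOrderNatAt, ((hP.analytic z hz).deriv.analyticOrderAt_eq_zero).2 hd]
          rfl
        rw [h2, zero_add, Finset.card_le_one] at h1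
        rw [h1 U (Finset.mem_filter.2 ⟨hU, hzU⟩) V (Finset.mem_filter.2 ⟨hV, hzV⟩)]
  -- The colours split `{‖f‖ ≤ s}` into disjoint compact sets, which stay separated at a slightly
  -- higher level.
  choose! u hu1 hu2 using hcol
  obtain ⟨s', hs', hs'b, hsep⟩ := hP.exists_separating_level hs (I.image c) (fun z => c (u z))
    (fun z hz h => Finset.mem_image_of_mem c (hu1 z hz h)) (by
      intro x hx
      have he : {z | (z ∈ A ∧ ‖f z‖ ≤ s) ∧ c (u z) = x} =
          {z ∈ A | ‖f z‖ ≤ s} ∩ ⋃ U ∈ I.filter (c · = x), closure U := by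
        ext z
        simp only [Set.mem_ofPred_eq, Set.mem_inter_iff, Set.mem_iUnion, Finset.mem_filter,
          exists_prop]
        refine and_congr_right fun hz => ⟨fun h => ⟨u z, ⟨hu1 z hz.1 hz.2, h⟩, hu2 z hz.1 hz.2⟩, ?_⟩
        rintro ⟨U, ⟨hU, rfl⟩, hzU⟩
        exact huniq z hz.1 hz.2 _ (hu1 z hz.1 hz.2) _ hU (hu2 z hz.1 hz.2) hzU
      rw [he]
      exact (hP.compact s hs).isClosed.inter
        ((I.filter (c · = x)).finite_toSet.isClosed_biUnion fun U _ => isClosed_closure))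
  refine ⟨s', hs', hs'b, ?_⟩
  have h1 : (I.image c).card ≤ numComponents f A Z s' := by
    have he : I.image c = Z.image fun z => c (levelComponent f A s z) := by
      rw [hI, Finset.image_image]; rfl
    rw [he]
    refine card_image_le_of_imp Z _ _ fun z hz z' hz' h => ?_
    obtain ⟨hzA, hz0⟩ := (hZ z).1 hz
    obtain ⟨hzA', hz0'⟩ := (hZ z').1 hz'
    have hzs : ‖f z‖ < s := by simpa [hz0] using hs0
    have hzs' : ‖f z'‖ < s := by simpa [hz0'] using hs0
    have hmem := (levelComponent_eq_iff hzA' (hzs'.trans hs')).1 h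
    have h3 := hsep z z' hzs.le hzA' hzs'.le hmem
    have h4 := huniq z hzA hzs.le _ (hu1 z hzA hzs.le) _ (Finset.mem_image_of_mem _ hz)
      (hu2 z hzA hzs.le) (subset_closure (mem_levelComponent_self hzA hzs))
    have h5 := huniq z' hzA' hzs'.le _ (hu1 z' hzA' hzs'.le) _ (Finset.mem_image_of_mem _ hz')
      (hu2 z' hzA' hzs'.le) (subset_closure (mem_levelComponent_self hzA' hzs'))
    rw [← h4, ← h5, ← h3]
  have h2 : ∑ w ∈ W', ((J w).card - 1) ≤ ∑ w ∈ W', analyticOrderNatAt (deriv f) w := by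
    refine Finset.sum_le_sum fun w hw => ?_
    obtain ⟨-, hwA, hws⟩ := Finset.mem_filter.1 hw
    have h : (J w).card ≤ _ := hP.card_touching_le hs0 hwA hws
    omega
  have h3 : numComponents f A Z s = I.card := rfl
  omega

/-- For small positive levels, distinct zeros lie in distinct components. -/
theorem exists_pos_card_le_numComponents (hb : 0 < b) :
    ∃ s', 0 < s' ∧ s' < b ∧ Z.card ≤ numComponents f A Z s' := by
  classical
  obtain ⟨s', hs', hs'b, hsep⟩ := hP.exists_separating_level hb Z id
    (fun z hz h => (hZ z).2 ⟨hz, by simpa using h⟩) (by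
      intro x hx
      refine Set.Subsingleton.isClosed ?_
      rintro y ⟨-, hy⟩ z ⟨-, hz⟩
      exact hy.trans hz.symm)
  refine ⟨s', hs', hs'b, ?_⟩
  rw [numComponents, Finset.card_image_of_injOn]
  intro z hz z' hz' h
  obtain ⟨hzA, hz0⟩ := (hZ z).1 hz
  obtain ⟨hzA', hz0'⟩ := (hZ z').1 hz'
  refine (hsep z z' (by simp [hz0]) hzA' (by simp [hz0']) ?_).symm
  exact (levelComponent_eq_iff hzA' (by simpa [hz0'] using hs')).1 h

/-- The number of components does not jump when a level is approached from below. -/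
theorem exists_lt_numComponents_le (hs0 : 0 < s) :
    ∃ s' < s, ∀ t, s' ≤ t → 0 < t → numComponents f A Z t ≤ numComponents f A Z s := by
  classical
  have h1 : ∀ z ∈ Z, ∀ z' ∈ Z, ∃ s' < s, z' ∈ levelComponent f A s z →
      z' ∈ levelComponent f A s' z := by
    intro z _ z' _
    by_cases h : z' ∈ levelComponent f A s z
    · obtain ⟨s', h1, h2⟩ := exists_lt_mem_levelComponent hP.isOpen hP.continuousOn h
      exact ⟨s', h1, fun _ => h2⟩
    · exact ⟨s - 1, by linarith, fun h' => absurd h' h⟩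
  choose! σ hσ1 hσ2 using h1
  have h2 : ∀ᶠ s' in 𝓝[<] s, ∀ z ∈ Z, ∀ z' ∈ Z, σ z z' ≤ s' := by
    refine (Z.eventually_all).2 fun z hz => (Z.eventually_all).2 fun z' hz' => ?_
    exact mem_nhdsWithin_of_mem_nhds (Ici_mem_nhds (hσ1 z hz z' hz'))
  obtain ⟨s', h3, h4⟩ := (h2.and self_mem_nhdsWithin).exists
  refine ⟨s', h4, fun t ht ht0 => ?_⟩
  refine card_image_le_of_imp Z _ _ fun z hz z' hz' h => ?_
  obtain ⟨hzA', hz0'⟩ := (hZ z').1 hz'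
  refine levelComponent_eq (levelComponent_mono ((h3 z hz z' hz').trans ht) (hσ2 z hz z' hz' ?_))
  exact (levelComponent_eq_iff hzA' (by simpa [hz0'] using hs0)).1 h

open Classical in
/-- Between two levels, the number of components drops at most by the number of critical points
in between, counted with multiplicity. -/
theorem numComponents_le_add {a : ℝ} (ha : 0 < a) (hab : a ≤ b) (W : Finset ℂ)
    (hW : ∀ w ∈ A, f w ≠ 0 → deriv f w = 0 → w ∈ W) :
    numComponents f A Z a ≤ numComponents f A Z b +
      ∑ w ∈ W with w ∈ A ∧ a ≤ ‖f w‖, analyticOrderNatAt (deriv f) w := by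
  classical
  set μ := fun w => analyticOrderNatAt (deriv f) w with hμ
  -- Continuous induction: the levels up to which the estimate holds contain their supremum, and
  -- the estimate extends beyond each of them below `b`.
  set S := {t ∈ Set.Icc a b | numComponents f A Z a ≤ numComponents f A Z t +
      ∑ w ∈ W with w ∈ A ∧ a ≤ ‖f w‖ ∧ ‖f w‖ < t, μ w} with hS
  have haS : a ∈ S := ⟨⟨le_rfl, hab⟩, by omega⟩
  have hbdd : BddAbove S := ⟨b, fun t ht => ht.1.2⟩
  set c := sSup S with hc
  have hac : a ≤ c := le_csSup hbdd haS
  have hcb : c ≤ b := csSup_le ⟨a, haS⟩ fun t ht => ht.1.2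
  have hc0 : 0 < c := ha.trans_le hac
  have hcS : c ∈ S := by
    refine ⟨⟨hac, hcb⟩, ?_⟩
    obtain ⟨s', hs', hle⟩ := hP.exists_lt_numComponents_le hZ hc0
    obtain ⟨t, htS, ht⟩ := exists_lt_of_lt_csSup ⟨a, haS⟩ hs'
    have h1 := hle t ht.le (ha.trans_le htS.1.1)
    have h2 : ∑ w ∈ W with w ∈ A ∧ a ≤ ‖f w‖ ∧ ‖f w‖ < t, μ w ≤
        ∑ w ∈ W with w ∈ A ∧ a ≤ ‖f w‖ ∧ ‖f w‖ < c, μ w := by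
      refine Finset.sum_le_sum_of_subset fun w hw => ?_
      simp only [Finset.mem_filter] at hw ⊢
      exact ⟨hw.1, hw.2.1, hw.2.2.1, hw.2.2.2.trans_le (le_csSup hbdd htS)⟩
    have h3 := htS.2
    omega
  have hcb' : c = b := by
    by_contra hne
    have hlt : c < b := lt_of_le_of_ne hcb hne
    obtain ⟨c', hc', hc'b, hle⟩ := hP.exists_gt_numComponents_le hZ hlt hc0 W (by
      intro w hw hwc hd
      refine hW w hw (fun h0 => ?_) hd
      rw [h0, norm_zero] at hwc
      exact hc0.ne hwc)
    refine absurd (le_csSup hbdd (a := c') ⟨⟨hac.trans hc'.le, hc'b.le⟩, ?_⟩) (not_le.2 hc')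
    have h2 : ∑ w ∈ W with w ∈ A ∧ a ≤ ‖f w‖ ∧ ‖f w‖ < c, μ w +
        ∑ w ∈ W with w ∈ A ∧ ‖f w‖ = c, μ w ≤
        ∑ w ∈ W with w ∈ A ∧ a ≤ ‖f w‖ ∧ ‖f w‖ < c', μ w := by
      rw [← Finset.sum_union]
      · refine Finset.sum_le_sum_of_subset fun w hw => ?_
        simp only [Finset.mem_filter, Finset.mem_union] at hw ⊢
        rcases hw with hw | hw
        · exact ⟨hw.1, hw.2.1, hw.2.2.1, hw.2.2.2.trans hc'⟩
        · exact ⟨hw.1, hw.2.1, hw.2.2 ▸ hac, hw.2.2 ▸ hc'⟩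
      · rw [Finset.disjoint_left]
        intro w hw hw'
        simp only [Finset.mem_filter] at hw hw'
        exact hw.2.2.2.ne hw'.2.2
    have h3 := hcS.2
    simp only [hμ] at *
    omega
  have h1 := hcS.2
  rw [hcb'] at h1
  refine h1.trans (Nat.add_le_add_left (Finset.sum_le_sum_of_subset fun w hw => ?_) _)
  simp only [Finset.mem_filter] at hw ⊢
  exact ⟨hw.1, hw.2.1, hw.2.2.1⟩

/-- The number of zeros exceeds the number of components at the top level at most by the number
of critical points, counted with multiplicity, that are not zeros. -/
theorem card_zeros_le (hb : 0 < b) (W : Finset ℂ)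
    (hW : ∀ w, w ∈ W ↔ w ∈ A ∧ f w ≠ 0 ∧ deriv f w = 0) :
    Z.card ≤ numComponents f A Z b + ∑ w ∈ W, analyticOrderNatAt (deriv f) w := by
  classical
  obtain ⟨a, ha, hab, h1⟩ := hP.exists_pos_card_le_numComponents hZ hb
  have h2 := hP.numComponents_le_add hZ ha hab.le W fun w h h' h'' => (hW w).2 ⟨h, h', h''⟩
  have h3 : ∑ w ∈ W with w ∈ A ∧ a ≤ ‖f w‖, analyticOrderNatAt (deriv f) w ≤
      ∑ w ∈ W, analyticOrderNatAt (deriv f) w :=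
    Finset.sum_le_sum_of_subset (Finset.filter_subset _ _)
  omega

end IsProperLevel

/-! ### The Riemann–Hurwitz count for polynomials -/

/-- The Riemann–Hurwitz count for `f` on `U`: the number of distinct zeros of `f` in `U` is one
more than the number of critical points of `f` in `U` that are not zeros, counted with
multiplicity. (The value `0` of `analyticOrderNatAt` at infinite order does not occur where `f` is
nowhere locally constant.) -/
def RiemannHurwitz (f : ℂ → ℂ) (U : Set ℂ) : Prop :=
  ∃ Z W : Finset ℂ, (∀ z, z ∈ Z ↔ z ∈ U ∧ f z = 0) ∧
    (∀ w, w ∈ W ↔ w ∈ U ∧ f w ≠ 0 ∧ deriv f w = 0) ∧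
    Z.card = 1 + ∑ w ∈ W, analyticOrderNatAt (deriv f) w

theorem levelComponent_levelComponent {f : ℂ → ℂ} {A : Set ℂ} {t : ℝ} {z w : ℂ}
    (hw : w ∈ levelComponent f A t z) :
    levelComponent f (levelComponent f A t z) t w = levelComponent f A t z := by
  refine (levelComponent_subset.trans fun y hy => hy.1).antisymm ?_
  exact isPreconnected_levelComponent.subset_connectedComponentIn hw
    fun y hy => ⟨hy, (levelComponent_subset hy).2⟩

theorem IsProperLevel.levelComponent {f : ℂ → ℂ} {A : Set ℂ} {b t : ℝ}
    (hP : IsProperLevel f A b) (ht : t ≤ b) (z : ℂ) :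
    IsProperLevel f (levelComponent f A t z) t where
  isOpen := hP.isOpen_levelComponent t z
  analytic y hy := hP.analytic y (levelComponent_subset hy).1
  compact s hs := by
    have hK := hP.compact s (hs.trans_le ht)
    have he : {y ∈ InnerPersistence.levelComponent f A t z | ‖f y‖ ≤ s} =
        {y ∈ A | ‖f y‖ ≤ s} ∩ closure (InnerPersistence.levelComponent f A t z) := by
      ext y
      constructor
      · rintro ⟨h1, h2⟩
        exact ⟨⟨(levelComponent_subset h1).1, h2⟩, subset_closure h1⟩
      · rintro ⟨⟨h1, h2⟩, h3⟩
        exact ⟨hP.mem_levelComponent_of_mem_closure h3 h1 (h2.trans_lt hs), h2⟩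
    rw [he]
    exact hK.inter_right isClosed_closure
  order_ne_top y hy := hP.order_ne_top y (levelComponent_subset hy).1

section Polynomial

open Polynomial

variable {p : ℂ[X]}

theorem analyticOrderNatAt_eval (hp : p ≠ 0) (w : ℂ) :
    analyticOrderNatAt (fun z => p.eval z) w = p.rootMultiplicity w := by
  obtain ⟨q, hq, hdvd⟩ := p.exists_eq_pow_rootMultiplicity_mul_and_not_dvd hp w
  have h : analyticOrderAt (fun z => p.eval z) w = (p.rootMultiplicity w : ℕ) := by
    refine (AnalyticOnNhd.eval_polynomial p w (Set.mem_univ w)).analyticOrderAt_eq_natCast.2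
      ⟨fun z => q.eval z, AnalyticOnNhd.eval_polynomial q w (Set.mem_univ w), ?_, ?_⟩
    · rwa [dvd_iff_isRoot] at hdvd
    · refine Eventually.of_forall fun z => ?_
      conv_lhs => rw [hq]
      simp
  rw [analyticOrderNatAt, h]
  rfl

theorem deriv_eval_eq (p : ℂ[X]) : deriv (fun z => p.eval z) = fun z => p.derivative.eval z := by
  ext z; exact p.deriv

theorem card_roots_eq_one_add_sum (hp : 0 < p.natDegree) :
    p.roots.toFinset.card = 1 + ∑ w ∈ p.derivative.roots.toFinset with p.eval w ≠ 0,
      analyticOrderNatAt (deriv fun z => p.eval z) w := by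
  have hp0 : p ≠ 0 := by rintro rfl; simp at hp
  have hdeg : p.derivative.natDegree = p.natDegree - 1 :=
    natDegree_eq_of_degree_eq_some (degree_derivative hp.ne')
  have hd0 : p.derivative ≠ 0 := by
    intro h
    have := degree_derivative hp.ne'
    rw [h, degree_zero] at this
    exact absurd this (by simp)
  have h1 : ∑ z ∈ p.roots.toFinset, p.rootMultiplicity z = p.natDegree := by
    rw [← IsAlgClosed.card_roots_eq_natDegree, ← Multiset.toFinset_sum_count_eq]
    simp
  have h2 : ∑ w ∈ p.derivative.roots.toFinset, p.derivative.rootMultiplicity w =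
      p.natDegree - 1 := by
    rw [← hdeg, ← IsAlgClosed.card_roots_eq_natDegree, ← Multiset.toFinset_sum_count_eq]
    simp
  -- A root of `p` of multiplicity `k` is a root of `p'` of multiplicity `k - 1`.
  have h3 : ∑ w ∈ p.derivative.roots.toFinset with p.eval w = 0, p.derivative.rootMultiplicity w =
      ∑ z ∈ p.roots.toFinset, (p.rootMultiplicity z - 1) := by
    refine (Finset.sum_subset (fun w hw => ?_) fun w hw hw' => ?_).trans
      (Finset.sum_congr rfl fun w hw => derivative_rootMultiplicity_of_root ?_)
    · rw [Finset.mem_filter] at hw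
      simpa [hp0] using hw.2
    · rw [Multiset.mem_toFinset, mem_roots hp0] at hw
      refine rootMultiplicity_eq_zero fun h => hw' ?_
      rw [Finset.mem_filter, Multiset.mem_toFinset, mem_roots hd0]
      exact ⟨h, hw⟩
    · rwa [Multiset.mem_toFinset, mem_roots hp0] at hw
  have h4 : ∑ z ∈ p.roots.toFinset, (p.rootMultiplicity z - 1) + p.roots.toFinset.card =
      p.natDegree := by
    rw [← h1, Finset.card_eq_sum_ones, ← Finset.sum_add_distrib]
    refine Finset.sum_congr rfl fun z hz => ?_
    rw [Multiset.mem_toFinset, mem_roots hp0] at hz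
    have := (rootMultiplicity_pos hp0).2 hz
    omega
  have h5 := Finset.sum_filter_add_sum_filter_not p.derivative.roots.toFinset
    (fun w => p.eval w = 0) fun w => p.derivative.rootMultiplicity w
  have h6 : ∀ w, analyticOrderNatAt (deriv fun z => p.eval z) w =
      p.derivative.rootMultiplicity w := fun w => by
    rw [deriv_eval_eq, analyticOrderNatAt_eval hd0]
  simp only [h6]
  have h7 : 0 < p.roots.toFinset.card := by
    obtain ⟨z, hz⟩ := IsAlgClosed.exists_root p (natDegree_pos_iff_degree_pos.1 hp).ne'
    exact Finset.card_pos.2 ⟨z, by simpa [hp0] using hz⟩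
  simp only [ne_eq]
  omega

theorem isProperLevel_polynomial (hp : 0 < p.natDegree) (b : ℝ) :
    IsProperLevel (fun z => p.eval z) Set.univ b where
  isOpen := isOpen_univ
  analytic := AnalyticOnNhd.eval_polynomial p
  compact s _ := by
    have h1 : Tendsto (fun z => ‖p.eval z‖) (cocompact ℂ) atTop :=
      p.tendsto_norm_atTop (natDegree_pos_iff_degree_pos.1 hp) tendsto_norm_cocompact_atTop
    obtain ⟨K, hK, hKs⟩ := mem_cocompact.1 (h1.eventually (eventually_gt_atTop s))
    refine hK.of_isClosed_subset ?_ fun z hz => ?_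
    · simpa using isClosed_le (by fun_prop : Continuous fun z => ‖p.eval z‖) continuous_const
    · by_contra h
      exact absurd hz.2 (not_le.2 (hKs h))
  order_ne_top z _ h := by
    have h1 : analyticOrderAt (fun y => (p - C (p.eval z)).eval y) z = ⊤ := by simpa using h
    have han : AnalyticOnNhd ℂ (fun y : ℂ => (p - C (p.eval z)).eval y) Set.univ :=
      AnalyticOnNhd.eval_polynomial _
    have h2 : ∀ y, (p - C (p.eval z)).eval y = 0 := fun y =>
      han.eqOn_zero_of_preconnected_of_eventuallyEq_zero isPreconnected_univ (Set.mem_univ z)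
        (analyticOrderAt_eq_top.1 h1) (Set.mem_univ y)
    have h3 : p - C (p.eval z) = 0 := Polynomial.funext fun y => by simpa using h2 y
    rw [sub_eq_zero.1 h3, natDegree_C] at hp
    exact hp.false

open Classical in
/-- The Riemann–Hurwitz count holds for every component of a polynomial lemniscate domain: the
merging inequality gives one inequality for each component and for the remaining levels, and the
sum of all of them is an equality by counting the roots of `p` and of its derivative. -/
theorem riemannHurwitz_polynomial (hp : 0 < p.natDegree) {b : ℝ} (hb : 0 < b) {z : ℂ}
    (hz : ‖p.eval z‖ < b) :
    RiemannHurwitz (fun z => p.eval z) (levelComponent (fun z => p.eval z) Set.univ b z) := by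
  set f : ℂ → ℂ := fun z => p.eval z with hf
  have hp0 : p ≠ 0 := by rintro rfl; simp at hp
  have hd0 : p.derivative ≠ 0 := by
    intro h
    have := degree_derivative hp.ne'
    rw [h, degree_zero] at this
    exact absurd this (by simp)
  set Z := p.roots.toFinset with hZdef
  set W := p.derivative.roots.toFinset.filter fun w => p.eval w ≠ 0 with hWdef
  set μ := fun w => analyticOrderNatAt (deriv f) w with hμ
  have hZ : ∀ y, y ∈ Z ↔ f y = 0 := fun y => by simp [hZdef, hf, hp0]
  have hW : ∀ y, y ∈ W ↔ f y ≠ 0 ∧ deriv f y = 0 := fun y => by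
    simp only [hWdef, hf, deriv_eval_eq, Finset.mem_filter, Multiset.mem_toFinset, mem_roots hd0]
    exact and_comm
  have htot : Z.card = 1 + ∑ w ∈ W, μ w := card_roots_eq_one_add_sum hp
  -- At a high level `T` all roots lie in one component.
  obtain ⟨R, hR⟩ := Z.finite_toSet.isBounded.subset_ball 0
  obtain ⟨M, hM⟩ := (isCompact_closedBall (0 : ℂ) R).exists_bound_of_continuousOn
    (f := f) (by fun_prop)
  set T := max b (M + 1) with hT
  have hbT : b ≤ T := le_max_left _ _
  have hPT := isProperLevel_polynomial hp T
  have hZT : ∀ y, y ∈ Z ↔ y ∈ Set.univ ∧ f y = 0 := fun y => by simp [hZ]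
  have hnT : numComponents f Set.univ Z T ≤ 1 := by
    rw [numComponents, Finset.card_le_one]
    have hball : ∀ x ∈ Z, ∀ y ∈ Z, levelComponent f Set.univ T x = levelComponent f Set.univ T y := by
      intro x hx y hy
      have hsub : Metric.ball (0 : ℂ) R ⊆ {v ∈ Set.univ | ‖f v‖ < T} := fun v hv => by
        refine ⟨Set.mem_univ _, ?_⟩
        have h1 := hM v (Metric.ball_subset_closedBall hv)
        have h2 : M + 1 ≤ T := le_max_right _ _
        linarith
      exact levelComponent_eq ((convex_ball (0 : ℂ) R).isPreconnected.subset_connectedComponentIn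
        (hR hx) hsub (hR hy))
    intro U hU V hV
    obtain ⟨x, hx, rfl⟩ := Finset.mem_image.1 hU
    obtain ⟨y, hy, rfl⟩ := Finset.mem_image.1 hV
    exact hball x hx y hy
  have hupper : numComponents f Set.univ Z b ≤ numComponents f Set.univ Z T +
      ∑ w ∈ W with ¬ ‖f w‖ < b, μ w := by
    refine (hPT.numComponents_le_add hZT hb hbT W fun w _ h1 h2 => (hW w).2 ⟨h1, h2⟩).trans
      (Nat.add_le_add_left (Finset.sum_le_sum_of_subset fun w hw => ?_) _)
    simp only [Finset.mem_filter] at hw ⊢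
    exact ⟨hw.1, not_lt.2 hw.2.2⟩
  set I := Z.image (levelComponent f Set.univ b) with hI
  have hIb : numComponents f Set.univ Z b = I.card := rfl
  have hPb := isProperLevel_polynomial hp b
  have hmemI : ∀ y, ‖f y‖ < b → levelComponent f Set.univ b y ∈ I := fun y hy =>
    hPb.levelComponent_mem_image hZT le_rfl (Set.mem_univ y) hy
  have hZb : ∀ y ∈ Z, ‖f y‖ < b := fun y hy => by rw [(hZ y).1 hy, norm_zero]; exact hb
  -- The inequality on each component.
  have hle : ∀ U ∈ I, (Z.filter fun y => levelComponent f Set.univ b y = U).card ≤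
      1 + ∑ w ∈ (W.filter fun w => ‖f w‖ < b) with levelComponent f Set.univ b w = U, μ w := by
    intro U hU
    obtain ⟨x, hx, rfl⟩ := Finset.mem_image.1 hU
    have hPU := hPb.levelComponent le_rfl x
    have hZU : ∀ y, y ∈ (Z.filter fun y => levelComponent f Set.univ b y =
        levelComponent f Set.univ b x) ↔ y ∈ levelComponent f Set.univ b x ∧ f y = 0 := by
      intro y
      rw [Finset.mem_filter]
      constructor
      · rintro ⟨h1, h2⟩
        exact ⟨h2 ▸ mem_levelComponent_self (Set.mem_univ y) (hZb y h1), (hZ y).1 h1⟩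
      · rintro ⟨h1, h2⟩
        exact ⟨(hZ y).2 h2, (levelComponent_eq h1).symm⟩
    have hWU : ∀ y, y ∈ ((W.filter fun w => ‖f w‖ < b).filter fun w =>
        levelComponent f Set.univ b w = levelComponent f Set.univ b x) ↔
        y ∈ levelComponent f Set.univ b x ∧ f y ≠ 0 ∧ deriv f y = 0 := by
      intro y
      rw [Finset.mem_filter, Finset.mem_filter, hW]
      constructor
      · rintro ⟨⟨h1, h2⟩, h3⟩
        exact ⟨h3 ▸ mem_levelComponent_self (Set.mem_univ y) h2, h1⟩
      · rintro ⟨h1, h2⟩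
        exact ⟨⟨h2, (levelComponent_subset h1).2⟩, (levelComponent_eq h1).symm⟩
    refine (hPU.card_zeros_le hZU hb _ hWU).trans (Nat.add_le_add_right ?_ _)
    rw [numComponents, Finset.card_le_one]
    intro U hU V hV
    obtain ⟨y, hy, rfl⟩ := Finset.mem_image.1 hU
    obtain ⟨y', hy', rfl⟩ := Finset.mem_image.1 hV
    rw [levelComponent_levelComponent ((hZU y).1 hy).1,
      levelComponent_levelComponent ((hZU y').1 hy').1]
  have hsumZ : Z.card = ∑ U ∈ I, (Z.filter fun y => levelComponent f Set.univ b y = U).card :=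
    Finset.card_eq_sum_card_fiberwise fun y hy => hmemI y (hZb y hy)
  have hsumW : ∑ U ∈ I, ∑ w ∈ (W.filter fun w => ‖f w‖ < b) with
      levelComponent f Set.univ b w = U, μ w = ∑ w ∈ W with ‖f w‖ < b, μ w :=
    Finset.sum_fiberwise_of_maps_to (fun w hw => hmemI w (Finset.mem_filter.1 hw).2) _
  have hsplit := Finset.sum_filter_add_sum_filter_not W (fun w => ‖f w‖ < b) μ
  have hsum1 : ∑ U ∈ I, (1 + ∑ w ∈ (W.filter fun w => ‖f w‖ < b) with
      levelComponent f Set.univ b w = U, μ w) = I.card + ∑ w ∈ W with ‖f w‖ < b, μ w := by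
    rw [Finset.sum_add_distrib, hsumW, Finset.sum_const, smul_eq_mul, mul_one]
  -- The sum of the inequalities is an equality, hence so is each of them.
  have hsumle := Finset.sum_le_sum hle
  have heq := (Finset.sum_eq_sum_iff_of_le hle).1 (by omega) _ (hmemI z hz)
  refine ⟨_, _, fun y => ?_, fun w => ?_, heq⟩
  · rw [Finset.mem_filter, hZ]
    constructor
    · rintro ⟨h1, h2⟩
      exact ⟨h2 ▸ mem_levelComponent_self (Set.mem_univ y) (hZb y ((hZ y).2 h1)), h1⟩
    · rintro ⟨h1, h2⟩
      exact ⟨h2, (levelComponent_eq h1).symm⟩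
  · rw [Finset.mem_filter, Finset.mem_filter, hW]
    constructor
    · rintro ⟨⟨h1, h2⟩, h3⟩
      exact ⟨h3 ▸ mem_levelComponent_self (Set.mem_univ w) h2, h1⟩
    · rintro ⟨h1, h2⟩
      exact ⟨⟨h2, (levelComponent_subset h1).2⟩, (levelComponent_eq h1).symm⟩

end Polynomial

section Approximation

open Polynomial

/-! ### Polynomial approximation with interpolation -/

/-- Newton interpolation: a holomorphic function on an open set is a polynomial modulo a product
of linear factors with roots in that set. -/
theorem exists_eq_eval_add_prod_mul {D : Set ℂ} (hD : IsOpen D) {f : ℂ → ℂ}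
    (hf : DifferentiableOn ℂ f D) (L : Multiset ℂ) (hL : ∀ c ∈ L, c ∈ D) :
    ∃ (P : ℂ[X]) (g : ℂ → ℂ), DifferentiableOn ℂ g D ∧
      ∀ z, f z = P.eval z + (L.map fun c => X - C c).prod.eval z * g z := by
  induction L using Multiset.induction_on with
  | empty => exact ⟨0, f, hf, fun z => by simp⟩
  | cons c L ih =>
    obtain ⟨P, g, hg, h⟩ := ih fun x hx => hL x (Multiset.mem_cons_of_mem hx)
    refine ⟨P + C (g c) * (L.map fun c => X - C c).prod, dslope g c,
      (Complex.differentiableOn_dslope (hD.mem_nhds (hL c (Multiset.mem_cons_self c L)))).2 hg,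
      fun z => ?_⟩
    have h1 := sub_smul_dslope g c z
    rw [smul_eq_mul] at h1
    rw [h z, Multiset.map_cons, Multiset.prod_cons]
    simp only [eval_add, eval_mul, eval_C, eval_sub, eval_X]
    linear_combination -(L.map fun c => X - C c).prod.eval z * h1

/-- Taylor polynomials approximate a holomorphic function on the disk, together with its
derivative, uniformly on compact sets. -/
theorem exists_polynomial_approx {g : ℂ → ℂ} (hg : DifferentiableOn ℂ g disk) {K : Set ℂ}
    (hK : IsCompact K) (hKD : K ⊆ disk) {ε : ℝ} (hε : 0 < ε) :
    ∃ q : ℂ[X], ∀ z ∈ K, ‖q.eval z - g z‖ < ε ∧ ‖q.derivative.eval z - deriv g z‖ < ε := by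
  obtain ⟨R, hR0, hR1, hKR⟩ : ∃ R : NNReal, 0 < R ∧ (R : ℝ) < 1 ∧ K ⊆ Metric.ball 0 (R : ℝ) := by
    rcases K.eq_empty_or_nonempty with rfl | hne
    · exact ⟨1 / 2, by norm_num, by norm_num, Set.empty_subset _⟩
    · obtain ⟨x, hx, hmax⟩ := hK.exists_isMaxOn hne continuous_norm.continuousOn
      have hx1 : ‖x‖ < 1 := by simpa [disk] using hKD hx
      obtain ⟨R, h1, h2⟩ := exists_between hx1
      have hR : 0 < R := (norm_nonneg x).trans_lt h1
      refine ⟨⟨R, hR.le⟩, hR, h2, fun y hy => ?_⟩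
      exact mem_ball_zero_iff.2 ((hmax hy).trans_lt h1)
  have hps := (hg.mono (s := Metric.closedBall (0 : ℂ) R) fun z hz => by
    simp only [disk, Metric.mem_ball, Metric.mem_closedBall] at hz ⊢
    exact hz.trans_lt hR1).hasFPowerSeriesOnBall hR0
  set c := cauchyPowerSeries g 0 R
  set q : ℕ → ℂ[X] := fun n => ∑ i ∈ Finset.range n, C (c.coeff i) * X ^ i with hq
  have hpart : ∀ n z, (q n).eval z = c.partialSum n z := fun n z => by
    simp only [hq, FormalMultilinearSeries.partialSum, eval_finsetSum, eval_mul, eval_C, eval_pow,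
      eval_X, FormalMultilinearSeries.apply_eq_pow_smul_coeff, smul_eq_mul]
    exact Finset.sum_congr rfl fun i _ => mul_comm _ _
  have hlim : TendstoLocallyUniformlyOn (fun n z => (q n).eval z) g atTop
      (Metric.ball (0 : ℂ) R) := by
    have := hps.tendstoLocallyUniformlyOn'
    simp only [sub_zero, ← hpart, Metric.eball_coe] at this
    exact this
  have hlim' := hlim.deriv (Eventually.of_forall fun n => (q n).differentiable.differentiableOn)
    Metric.isOpen_ball
  have h1 := (tendstoLocallyUniformlyOn_iff_forall_isCompact Metric.isOpen_ball).1 hlim K hKR hK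
  have h2 := (tendstoLocallyUniformlyOn_iff_forall_isCompact Metric.isOpen_ball).1 hlim' K hKR hK
  obtain ⟨n, h3, h4⟩ := ((Metric.tendstoUniformlyOn_iff.1 h1 ε hε).and
    (Metric.tendstoUniformlyOn_iff.1 h2 ε hε)).exists
  refine ⟨q n, fun z hz => ⟨?_, ?_⟩⟩
  · rw [← dist_eq_norm, dist_comm]
    exact h3 z hz
  · have := h4 z hz
    rw [dist_comm, dist_eq_norm] at this
    simpa [Function.comp_def, deriv_eval_eq] using this

/-- If `G` vanishes on `K` at least to the order of `F`, then `G` is bounded by a multiple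
of `F` on the compact set `K`. -/
theorem exists_norm_le_mul_norm {K : Set ℂ} (hK : IsCompact K) {F G : ℂ → ℂ}
    (hF : AnalyticOnNhd ℂ F K) (hG : AnalyticOnNhd ℂ G K)
    (htop : ∀ z ∈ K, analyticOrderAt F z ≠ ⊤)
    (hle : ∀ z ∈ K, analyticOrderAt F z ≤ analyticOrderAt G z) :
    ∃ c : ℝ, 0 ≤ c ∧ ∀ z ∈ K, ‖G z‖ ≤ c * ‖F z‖ := by
  refine hK.induction_on (p := fun K => ∃ c : ℝ, 0 ≤ c ∧ ∀ z ∈ K, ‖G z‖ ≤ c * ‖F z‖)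
    ⟨0, le_rfl, by simp⟩ ?_ ?_ ?_
  · rintro s t hst ⟨c, hc, h⟩
    exact ⟨c, hc, fun z hz => h z (hst hz)⟩
  · rintro s t ⟨c, hc, h⟩ ⟨c', hc', h'⟩
    refine ⟨max c c', le_max_of_le_left hc, fun z hz => ?_⟩
    rcases hz with hz | hz
    · exact (h z hz).trans (mul_le_mul_of_nonneg_right (le_max_left _ _) (norm_nonneg _))
    · exact (h' z hz).trans (mul_le_mul_of_nonneg_right (le_max_right _ _) (norm_nonneg _))
  · intro z hz
    obtain ⟨k, hk⟩ := ENat.ne_top_iff_exists.1 (htop z hz)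
    obtain ⟨u, hu, hu0, hFu⟩ := (hF z hz).analyticOrderAt_eq_natCast.1 hk.symm
    obtain ⟨v, hv, hGv⟩ := (natCast_le_analyticOrderAt (hG z hz)).1 (hk ▸ hle z hz)
    have hq : ContinuousAt (fun y => ‖v y / u y‖) z :=
      (hv.continuousAt.div hu.continuousAt hu0).norm
    have hev : ∀ᶠ y in 𝓝 z, ‖G y‖ ≤ (‖v z / u z‖ + 1) * ‖F y‖ := by
      filter_upwards [hFu, hGv, hu.continuousAt.eventually_ne hu0,
        hq.eventually (eventually_lt_nhds (lt_add_one _))] with y h1 h2 h3 h4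
      rw [h1, h2, smul_eq_mul, smul_eq_mul, norm_mul, norm_mul]
      have h5 : ‖v y‖ = ‖v y / u y‖ * ‖u y‖ := by
        rw [← norm_mul, div_mul_cancel₀ _ h3]
      rw [h5]
      have h6 := mul_le_mul_of_nonneg_right h4.le
        (mul_nonneg (norm_nonneg ((y - z) ^ k)) (norm_nonneg (u y)))
      linarith
    exact ⟨_, mem_nhdsWithin_of_mem_nhds hev, _, by positivity, fun y hy => hy⟩

theorem finite_zeros_of_isCompact {K : Set ℂ} (hK : IsCompact K) {F : ℂ → ℂ}
    (hF : AnalyticOnNhd ℂ F K) (htop : ∀ z ∈ K, analyticOrderAt F z ≠ ⊤) :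
    {z ∈ K | F z = 0}.Finite := by
  by_contra hinf
  obtain ⟨x, hx, hacc⟩ := Set.Infinite.exists_accPt_of_subset_isCompact hinf hK fun _ h => h.1
  rcases (hF x hx).eventually_eq_zero_or_eventually_ne_zero with h2 | h2
  · exact htop x hx (analyticOrderAt_eq_top.2 h2)
  · rw [accPt_iff_frequently_nhdsNE] at hacc
    exact hacc (h2.mono fun y hy h => hy h.2)

/-! ### The Riemann–Hurwitz count for relatively compact level components -/

theorem analyticOrderAt_deriv_ne_top {f : ℂ → ℂ} {z : ℂ} (hf : AnalyticAt ℂ f z)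
    (h : analyticOrderAt (fun y => f y - f z) z ≠ ⊤) : analyticOrderAt (deriv f) z ≠ ⊤ := by
  intro h1
  rw [← hf.analyticOrderAt_deriv_add_one, h1, top_add] at h
  exact h rfl

theorem analyticOrderAt_ne_top_of_sub {f : ℂ → ℂ} {z : ℂ}
    (h : analyticOrderAt (fun y => f y - f z) z ≠ ⊤) : analyticOrderAt f z ≠ ⊤ := by
  intro h1
  refine h (analyticOrderAt_eq_top.2 ?_)
  have h2 := analyticOrderAt_eq_top.1 h1
  filter_upwards [h2] with y hy
  rw [hy, h2.self_of_nhds, sub_zero]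

theorem isProperLevel_of_closure_subset {D : Set ℂ} (hD : IsOpen D) (hDb : Bornology.IsBounded D)
    {f : ℂ → ℂ} (hf : DifferentiableOn ℂ f D)
    (hord : ∀ z ∈ D, analyticOrderAt (fun y => f y - f z) z ≠ ⊤) {b : ℝ} {z : ℂ}
    (hcl : closure (levelComponent f D b z) ⊆ D) : IsProperLevel f (levelComponent f D b z) b where
  isOpen := (isOpen_inter_sublevel hD hf.continuousOn b).connectedComponentIn
  analytic y hy := hf.analyticAt (hD.mem_nhds (levelComponent_subset hy).1)
  compact s hs := by
    have hop : IsOpen {y ∈ D | ‖f y‖ < b} := isOpen_inter_sublevel hD hf.continuousOn b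
    have hcomp : IsCompact (closure (levelComponent f D b z)) :=
      Metric.isCompact_of_isClosed_isBounded isClosed_closure (hDb.subset hcl)
    have he : {y ∈ levelComponent f D b z | ‖f y‖ ≤ s} =
        closure (levelComponent f D b z) ∩ (fun y => ‖f y‖) ⁻¹' Set.Iic s := by
      ext y
      constructor
      · rintro ⟨h1, h2⟩
        exact ⟨subset_closure h1, h2⟩
      · rintro ⟨h1, h2⟩
        refine ⟨?_, h2⟩
        have hy : y ∈ {y ∈ D | ‖f y‖ < b} := ⟨hcl h1, lt_of_le_of_lt h2 hs⟩
        have hop' : IsOpen (levelComponent f D b y) := hop.connectedComponentIn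
        obtain ⟨x, hx1, hx2⟩ := mem_closure_iff.1 h1 _ hop' (mem_connectedComponentIn hy)
        rw [levelComponent_eq hx2, ← levelComponent_eq hx1]
        exact mem_connectedComponentIn hy
    rw [he]
    exact hcomp.of_isClosed_subset (((hf.continuousOn.mono hcl).norm).preimage_isClosed_of_isClosed
      isClosed_closure isClosed_Iic) Set.inter_subset_left
  order_ne_top y hy := hord y (levelComponent_subset hy).1

/-- The Riemann–Hurwitz count for a component of `{‖f‖ < b}` with closure in the disk: a polynomial
close to `f` has a level component with the same zeros, critical points and orders. -/
theorem riemannHurwitz_levelComponent {f : ℂ → ℂ} (hf : DifferentiableOn ℂ f disk)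
    (hord : ∀ z ∈ disk, analyticOrderAt (fun y => f y - f z) z ≠ ⊤) {b : ℝ} {z : ℂ}
    (hz : z ∈ disk) (hzb : ‖f z‖ < b) (hcl : closure (levelComponent f disk b z) ⊆ disk) :
    RiemannHurwitz f (levelComponent f disk b z) := by
  classical
  have hD : IsOpen disk := Metric.isOpen_ball
  have han : AnalyticOnNhd ℂ f disk := hf.analyticOnNhd hD
  set A := levelComponent f disk b z with hA
  have hAD : A ⊆ disk := fun y hy => (levelComponent_subset hy).1
  have hP : IsProperLevel f A b :=
    isProperLevel_of_closure_subset hD Metric.isBounded_ball hf hord hcl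
  have hAcomp : IsCompact (closure A) :=
    Metric.isCompact_of_isClosed_isBounded isClosed_closure (Metric.isBounded_ball.subset hcl)
  -- The finite set of zeros and critical points.
  have hfin1 : {y ∈ closure A | f y = 0}.Finite := finite_zeros_of_isCompact hAcomp
    (fun y hy => han y (hcl hy)) fun y hy => analyticOrderAt_ne_top_of_sub (hord y (hcl hy))
  have hfin2 : {y ∈ closure A | deriv f y = 0}.Finite := finite_zeros_of_isCompact hAcomp
    (fun y hy => (han y (hcl hy)).deriv)
    fun y hy => analyticOrderAt_deriv_ne_top (han y (hcl hy)) (hord y (hcl hy))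
  set S : Finset ℂ := (hfin1.toFinset ∪ hfin2.toFinset).filter (· ∈ A) with hSdef
  have hS : ∀ y, y ∈ S ↔ y ∈ A ∧ (f y = 0 ∨ deriv f y = 0) := fun y => by
    simp only [hSdef, Finset.mem_filter, Finset.mem_union, Set.Finite.mem_toFinset,
      Set.mem_ofPred_eq]
    constructor
    · rintro ⟨h | h, h'⟩
      · exact ⟨h', Or.inl h.2⟩
      · exact ⟨h', Or.inr h.2⟩
    · rintro ⟨h, h' | h'⟩
      · exact ⟨Or.inl ⟨subset_closure h, h'⟩, h⟩
      · exact ⟨Or.inr ⟨subset_closure h, h'⟩, h⟩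
  have hzA : z ∈ A := mem_levelComponent_self hz hzb
  obtain ⟨z₀, hz₀, hfz₀⟩ := hP.exists_zero_mem le_rfl hzA hzb
  have hz₀A : z₀ ∈ A := (levelComponent_subset hz₀).1
  have hz₀S : z₀ ∈ S := (hS z₀).2 ⟨hz₀A, Or.inl hfz₀⟩
  have hb0 : 0 < b := (norm_nonneg _).trans_lt hzb
  -- A lower level at which all of them still lie in one component.
  obtain ⟨a, hab, haS⟩ : ∃ a < b, ∀ y ∈ S, y ∈ levelComponent f disk a z₀ := by
    have h1 : ∀ y ∈ S, ∃ a < b, y ∈ levelComponent f disk a z₀ := fun y hy => by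
      refine exists_lt_mem_levelComponent hD hf.continuousOn ?_
      rw [← levelComponent_eq hz₀A]
      exact ((hS y).1 hy).1
    choose! σ h2 h3 using h1
    have h4 : ∀ᶠ a in 𝓝[<] b, ∀ y ∈ S, σ y ≤ a := (S.eventually_all).2 fun y hy =>
      mem_nhdsWithin_of_mem_nhds (Ici_mem_nhds (h2 y hy))
    obtain ⟨a, h5, h6⟩ := (h4.and self_mem_nhdsWithin).exists
    exact ⟨a, h6, fun y hy => levelComponent_mono (h5 y hy) (h3 y hy)⟩
  have ha0 : 0 < a := by
    have := (levelComponent_subset (haS z₀ hz₀S)).2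
    rwa [hfz₀, norm_zero] at this
  obtain ⟨s, has, hsb⟩ := exists_between hab
  obtain ⟨s₂, hss₂, hs₂b⟩ := exists_between hsb
  set K := {y ∈ A | ‖f y‖ ≤ s₂} with hK
  have hKc : IsCompact K := hP.compact s₂ hs₂b
  have hKA : K ⊆ A := fun y hy => hy.1
  have hKD : K ⊆ disk := hKA.trans hAD
  -- The interpolating polynomial and the remainder.
  -- The exponent exceeds the orders of `f` and `f'` on `S` by `2`, so that `M` and `M'` vanish there
  -- to a higher order than both.
  set N : ℕ := 2 + ∑ y ∈ S, (analyticOrderNatAt f y + analyticOrderNatAt (deriv f) y) with hN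
  obtain ⟨P, g, hg, hfg⟩ := exists_eq_eval_add_prod_mul hD hf (N • S.val) fun c hc =>
    hAD ((hS c).1 (Multiset.mem_of_mem_nsmul hc)).1
  set M : ℂ[X] := ((N • S.val).map fun c => X - C c).prod with hM
  have hMS : M = (∏ c ∈ S, (X - C c)) ^ N := by
    rw [hM, Multiset.map_nsmul, Multiset.prod_nsmul]
    rfl
  have hMan : ∀ y, AnalyticAt ℂ (fun x => M.eval x) y := fun y =>
    AnalyticOnNhd.eval_polynomial M y (Set.mem_univ y)
  have hMord : ∀ y ∈ S, (N : ℕ∞) ≤ analyticOrderAt (fun x => M.eval x) y := by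
    intro y hy
    refine (natCast_le_analyticOrderAt (hMan y)).2
      ⟨fun x => ((∏ c ∈ S.erase y, (X - C c)) ^ N).eval x,
        AnalyticOnNhd.eval_polynomial _ y (Set.mem_univ y), Eventually.of_forall fun x => ?_⟩
    rw [hMS, ← Finset.mul_prod_erase S _ hy]
    simp [mul_pow]
  have hordle : ∀ y ∈ S, analyticOrderAt f y + 2 ≤ N ∧ analyticOrderAt (deriv f) y + 2 ≤ N := by
    intro y hy
    have hyD := hAD ((hS y).1 hy).1
    have h1 := Finset.single_le_sum (f := fun y =>
      analyticOrderNatAt f y + analyticOrderNatAt (deriv f) y) (fun _ _ => Nat.zero_le _) hy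
    rw [← Nat.cast_analyticOrderNatAt (analyticOrderAt_ne_top_of_sub (hord y hyD)),
      ← Nat.cast_analyticOrderNatAt (analyticOrderAt_deriv_ne_top (han y hyD) (hord y hyD))]
    constructor <;> norm_cast <;> omega
  have hM'ord : ∀ y ∈ S, ((N - 1 : ℕ) : ℕ∞) ≤ analyticOrderAt (fun x => M.derivative.eval x) y := by
    intro y hy
    have h0 : M.eval y = 0 := by
      have h1 := hMord y hy
      refine apply_eq_zero_of_analyticOrderAt_ne_zero (f := fun x => M.eval x) fun h => ?_
      rw [h] at h1
      have : N = 0 := by exact_mod_cast nonpos_iff_eq_zero.1 h1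
      omega
    have h2 := (analyticOrderAt_deriv_ge_iff (hMan y) h0 (n := N - 1)).2 (by
      have h3 := hMord y hy
      have h4 : ((N - 1 : ℕ) : ℕ∞) + 1 = N := by norm_cast; omega
      rwa [h4])
    rwa [deriv_eval_eq] at h2
  have hN1 : ∀ k : ℕ∞, k + 2 ≤ N → k < ((N - 1 : ℕ) : ℕ∞) ∧ k ≤ N := by
    intro k hk
    have hk' : k ≠ ⊤ := by
      rintro rfl
      simp at hk
    lift k to ℕ using hk'
    norm_cast at hk ⊢
    omega
  -- The remainder terms are dominated by `f` and by its derivative.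
  have hdom : ∀ (F : ℂ → ℂ) (G : ℂ[X]), AnalyticOnNhd ℂ F disk →
      (∀ y ∈ K, analyticOrderAt F y ≠ ⊤) → (∀ y ∈ K, y ∉ S → F y ≠ 0) →
      (∀ y ∈ S, analyticOrderAt F y ≤ analyticOrderAt (fun x => G.eval x) y) →
      ∃ c : ℝ, 0 ≤ c ∧ ∀ y ∈ K, ‖G.eval y‖ ≤ c * ‖F y‖ := by
    intro F G hF htop hne hle
    refine exists_norm_le_mul_norm hKc (hF.mono hKD)
      (fun y _ => AnalyticOnNhd.eval_polynomial G y (Set.mem_univ y)) htop fun y hy => ?_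
    by_cases hyS : y ∈ S
    · exact hle y hyS
    · rw [((hF y (hKD hy)).analyticOrderAt_eq_zero).2 (hne y hy hyS)]
      exact zero_le
  have hfne : ∀ y ∈ K, y ∉ S → f y ≠ 0 := fun y hy hyS h =>
    hyS ((hS y).2 ⟨hKA hy, Or.inl h⟩)
  have hf'ne : ∀ y ∈ K, y ∉ S → deriv f y ≠ 0 := fun y hy hyS h =>
    hyS ((hS y).2 ⟨hKA hy, Or.inr h⟩)
  have hftop : ∀ y ∈ K, analyticOrderAt f y ≠ ⊤ := fun y hy =>
    analyticOrderAt_ne_top_of_sub (hord y (hKD hy))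
  have hf'top : ∀ y ∈ K, analyticOrderAt (deriv f) y ≠ ⊤ := fun y hy =>
    analyticOrderAt_deriv_ne_top (han y (hKD hy)) (hord y (hKD hy))
  obtain ⟨c₁, hc₁, hb₁⟩ := hdom f M han hftop hfne fun y hy =>
    ((hN1 _ (hordle y hy).1).2).trans (hMord y hy)
  obtain ⟨c₂, hc₂, hb₂⟩ := hdom (deriv f) M han.deriv hf'top hf'ne fun y hy =>
    ((hN1 _ (hordle y hy).2).2).trans (hMord y hy)
  obtain ⟨c₃, hc₃, hb₃⟩ := hdom (deriv f) M.derivative han.deriv hf'top hf'ne fun y hy =>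
    ((hN1 _ (hordle y hy).2).1.le).trans (hM'ord y hy)
  have hMbd : ∀ y ∈ K, ‖M.eval y‖ ≤ c₁ * s₂ := fun y hy =>
    (hb₁ y hy).trans (mul_le_mul_of_nonneg_left hy.2 hc₁)
  -- An error so small that on `K` it creates no zeros or critical points and is less than the gaps
  -- between the levels `a < s < s₂`.
  obtain ⟨ε, hε, hε1, hε2, hε3, hε4⟩ : ∃ ε > 0, c₁ * ε < 1 ∧ (c₂ + c₃) * ε < 1 ∧
      c₁ * s₂ * ε < s - a ∧ c₁ * s₂ * ε < s₂ - s := by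
    have hlim : ∀ c : ℝ, Tendsto (fun ε => c * ε) (𝓝[>] 0) (𝓝 0) := fun c => by
      have h1 : Tendsto (fun ε : ℝ => c * ε) (𝓝 0) (𝓝 (c * 0)) := tendsto_id.const_mul c
      rw [mul_zero] at h1
      exact h1.mono_left nhdsWithin_le_nhds
    obtain ⟨ε, h⟩ := (((((hlim c₁).eventually (gt_mem_nhds one_pos)).and
      ((hlim (c₂ + c₃)).eventually (gt_mem_nhds one_pos))).and
      (((hlim (c₁ * s₂)).eventually (gt_mem_nhds (sub_pos.2 has))).and
      ((hlim (c₁ * s₂)).eventually (gt_mem_nhds (sub_pos.2 hss₂))))).and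
      self_mem_nhdsWithin).exists
    exact ⟨ε, h.2, h.1.1.1, h.1.1.2, h.1.2.1, h.1.2.2⟩
  obtain ⟨q, hq⟩ := exists_polynomial_approx hg hKc hKD hε
  set p : ℂ[X] := P + M * q with hp
  have hpf : ∀ y, p.eval y - f y = M.eval y * (q.eval y - g y) := fun y => by
    rw [hfg y, hp]
    simp only [eval_add, eval_mul]
    ring
  have hhan : ∀ y ∈ disk, AnalyticAt ℂ (fun x => q.eval x - g x) y := fun y hy =>
    (AnalyticOnNhd.eval_polynomial q y (Set.mem_univ y)).fun_sub (hg.analyticAt (hD.mem_nhds hy))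
  have hpf' : ∀ y ∈ disk, p.derivative.eval y - deriv f y =
      M.derivative.eval y * (q.eval y - g y) +
        M.eval y * (q.derivative.eval y - deriv g y) := fun y hy => by
    have hgd : DifferentiableAt ℂ g y := hg.differentiableAt (hD.mem_nhds hy)
    have h1 : HasDerivAt f (P.derivative.eval y + (M.derivative.eval y * g y +
        M.eval y * deriv g y)) y := by
      have h2 := (P.hasDerivAt y).add ((M.hasDerivAt y).mul hgd.hasDerivAt)
      exact h2.congr_of_eventuallyEq (Eventually.of_forall hfg)
    rw [h1.deriv, hp]
    simp only [derivative_add, derivative_mul, eval_add, eval_mul]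
    ring
  have hpfε : ∀ y ∈ K, ‖p.eval y - f y‖ ≤ c₁ * s₂ * ε := fun y hy => by
    rw [hpf, norm_mul]
    exact mul_le_mul (hMbd y hy) (hq y hy).1.le (norm_nonneg _)
      ((norm_nonneg _).trans (hMbd y hy))
  -- On `K` the polynomial has the same zeros, critical points and orders as `f`.
  have hzero : ∀ y ∈ K, (p.eval y = 0 ↔ f y = 0) := by
    intro y hy
    have h1 := hpf y
    have h2 := hb₁ y hy
    constructor
    · intro h
      by_contra hne
      rw [h, zero_sub] at h1
      have h3 : ‖f y‖ ≤ c₁ * ‖f y‖ * ε := by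
        calc ‖f y‖ = ‖M.eval y‖ * ‖q.eval y - g y‖ := by rw [← norm_neg, h1, norm_mul]
          _ ≤ _ := mul_le_mul h2 (hq y hy).1.le (norm_nonneg _) (by positivity)
      have h4 := norm_pos_iff.2 hne
      nlinarith
    · intro h
      rw [h, norm_zero, mul_zero] at h2
      rw [norm_le_zero_iff.1 h2, zero_mul, h, sub_zero] at h1
      exact h1
  have hcrit : ∀ y ∈ K, (p.derivative.eval y = 0 ↔ deriv f y = 0) := by
    intro y hy
    have h1 := hpf' y (hKD hy)
    have h2 := hb₂ y hy
    have h3 := hb₃ y hy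
    constructor
    · intro h
      by_contra hne
      rw [h, zero_sub] at h1
      have h5 : ‖M.derivative.eval y * (q.eval y - g y)‖ ≤ c₃ * ‖deriv f y‖ * ε := by
        rw [norm_mul]
        exact mul_le_mul h3 (hq y hy).1.le (norm_nonneg _) (by positivity)
      have h6 : ‖M.eval y * (q.derivative.eval y - deriv g y)‖ ≤ c₂ * ‖deriv f y‖ * ε := by
        rw [norm_mul]
        exact mul_le_mul h2 (hq y hy).2.le (norm_nonneg _) (by positivity)
      have h7 : ‖deriv f y‖ ≤ c₃ * ‖deriv f y‖ * ε + c₂ * ‖deriv f y‖ * ε := by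
        calc ‖deriv f y‖ = ‖M.derivative.eval y * (q.eval y - g y) +
              M.eval y * (q.derivative.eval y - deriv g y)‖ := by rw [← norm_neg, h1]
          _ ≤ _ := (norm_add_le _ _).trans (add_le_add h5 h6)
      have h4 := norm_pos_iff.2 hne
      nlinarith
    · intro h
      rw [h, norm_zero, mul_zero] at h2 h3
      rw [norm_le_zero_iff.1 h2, norm_le_zero_iff.1 h3, zero_mul, zero_mul, h, sub_zero,
        add_zero] at h1
      exact h1
  have hordS : ∀ y ∈ S, analyticOrderAt (deriv fun x => p.eval x) y =
      analyticOrderAt (deriv f) y := by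
    intro y hy
    have hyD := hAD ((hS y).1 hy).1
    have h1 : (deriv fun x => p.eval x) =ᶠ[𝓝 y] deriv f +
        ((fun x => M.derivative.eval x) * (fun x => q.eval x - g x) +
          (fun x => M.eval x) * (deriv fun x => q.eval x - g x)) := by
      filter_upwards [hD.mem_nhds hyD] with x hx
      have h2 := hpf' x hx
      have h3 : deriv (fun x => q.eval x - g x) x = q.derivative.eval x - deriv g x :=
        ((q.hasDerivAt x).sub (hg.differentiableAt (hD.mem_nhds hx)).hasDerivAt).deriv
      rw [deriv_eval_eq]
      simp only [Pi.add_apply, Pi.mul_apply, h3]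
      linear_combination h2
    rw [analyticOrderAt_congr h1]
    refine analyticOrderAt_add_eq_left_of_lt
      (lt_of_lt_of_le (hN1 _ (hordle y hy).2).1 (le_trans (le_min ?_ ?_) le_analyticOrderAt_add))
    · rw [analyticOrderAt_mul (AnalyticOnNhd.eval_polynomial _ y (Set.mem_univ y)) (hhan y hyD)]
      exact (hM'ord y hy).trans le_self_add
    · rw [analyticOrderAt_mul (hMan y) (hhan y hyD).deriv]
      refine le_trans ?_ ((hMord y hy).trans le_self_add)
      norm_cast
      omega
  have hpdeg : 0 < p.natDegree := by
    by_contra h0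
    have h1 := hordS z₀ hz₀S
    have h2 : p.derivative = 0 := by
      rw [natDegree_eq_zero.1 (Nat.eq_zero_of_not_pos h0) |>.choose_spec.symm, derivative_C]
    rw [deriv_eval_eq, h2] at h1
    refine analyticOrderAt_deriv_ne_top (han z₀ (hAD hz₀A)) (hord z₀ (hAD hz₀A)) ?_
    rw [← h1]
    exact analyticOrderAt_eq_top.2 (by simp)
  -- The level component of the polynomial.
  have hz₀K : z₀ ∈ K := ⟨hz₀A, by rw [hfz₀, norm_zero]; linarith⟩
  have hpz₀ : ‖p.eval z₀‖ < s := by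
    rw [(hzero z₀ hz₀K).2 hfz₀, norm_zero]; linarith
  set A' := levelComponent (fun x => p.eval x) Set.univ s z₀ with hA'
  -- Where `‖f‖ = s₂` the polynomial is larger than `s`, so the component cannot leave `K`.
  have hA'K : A' ⊆ K := by
    have hO : IsOpen {y ∈ A | ‖f y‖ < s₂} := isOpen_inter_sublevel hP.isOpen hP.continuousOn s₂
    have hOK : closure {y ∈ A | ‖f y‖ < s₂} ⊆ K :=
      closure_minimal (fun y hy => ⟨hy.1, hy.2.le⟩) hKc.isClosed
    have hsub : A' ⊆ {y ∈ A | ‖f y‖ < s₂} ∪ (closure {y ∈ A | ‖f y‖ < s₂})ᶜ := by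
      intro y hy
      by_contra h
      rw [Set.mem_union, not_or, Set.notMem_compl_iff] at h
      have hyK := hOK h.2
      have h1 : s₂ ≤ ‖f y‖ := not_lt.1 fun h' => h.1 ⟨hyK.1, h'⟩
      have h2 : ‖p.eval y‖ < s := (levelComponent_subset hy).2
      have h3 := hpfε y hyK
      have h4 := norm_sub_norm_le (f y) (p.eval y)
      rw [norm_sub_rev] at h4
      linarith
    have h5 := isPreconnected_levelComponent.subset_left_of_subset_union hO
      isClosed_closure.isOpen_compl
      (disjoint_compl_right.mono_left subset_closure) hsub
      ⟨z₀, mem_levelComponent_self (Set.mem_univ _) hpz₀, hz₀A, by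
        rw [hfz₀, norm_zero]; linarith⟩
    exact h5.trans (subset_closure.trans hOK)
  -- The component of `{‖f‖ < a}` that contains `S` lies in `{‖p‖ < s}`.
  have hSA' : ∀ y ∈ S, y ∈ A' := by
    intro y hy
    have hsub : levelComponent f disk a z₀ ⊆ A := by
      rw [hA, levelComponent_eq hz₀A]
      exact levelComponent_mono hab.le
    have hsub2 : levelComponent f disk a z₀ ⊆ {x ∈ Set.univ | ‖p.eval x‖ < s} := by
      intro x hx
      have h1 : ‖f x‖ < a := (levelComponent_subset hx).2
      have hxK : x ∈ K := ⟨hsub hx, by linarith⟩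
      have h3 := hpfε x hxK
      have h4 := norm_sub_norm_le (p.eval x) (f x)
      exact ⟨Set.mem_univ _, by linarith⟩
    exact isPreconnected_levelComponent.subset_connectedComponentIn (haS z₀ hz₀S) hsub2 (haS y hy)
  obtain ⟨Z, W, hZ, hW, hcard⟩ := riemannHurwitz_polynomial hpdeg (ha0.trans has) hpz₀
  refine ⟨Z, W, fun y => ?_, fun w => ?_, ?_⟩
  · rw [hZ]
    constructor
    · rintro ⟨h1, h2⟩
      exact ⟨hKA (hA'K h1), (hzero y (hA'K h1)).1 h2⟩
    · rintro ⟨h1, h2⟩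
      have h3 := hSA' y ((hS y).2 ⟨h1, Or.inl h2⟩)
      exact ⟨h3, (hzero y (hA'K h3)).2 h2⟩
  · rw [hW, deriv_eval_eq]
    constructor
    · rintro ⟨h1, h2, h3⟩
      exact ⟨hKA (hA'K h1), fun h => h2 ((hzero w (hA'K h1)).2 h), (hcrit w (hA'K h1)).1 h3⟩
    · rintro ⟨h1, h2, h3⟩
      have h4 := hSA' w ((hS w).2 ⟨h1, Or.inr h3⟩)
      exact ⟨h4, fun h => h2 ((hzero w (hA'K h4)).1 h), (hcrit w (hA'K h4)).2 h3⟩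
  · rw [hcard]
    refine congrArg _ (Finset.sum_congr rfl fun w hw => ?_)
    obtain ⟨h1, -, h3⟩ := (hW w).1 hw
    rw [deriv_eval_eq] at h3
    have h4 : w ∈ S := (hS w).2 ⟨hKA (hA'K h1), Or.inr ((hcrit w (hA'K h1)).1 h3)⟩
    rw [analyticOrderNatAt, analyticOrderNatAt, hordS w h4]

end Approximation

/-! ### Barcode of the merge tree -/

/-- A hierarchical clustering of `Z`: an increasing, left-continuous family of equivalence relations,
indexed by the times `t > 0`, in which any two points are eventually related. -/
structure MergeTree (Z : Type*) where
  rel : ℝ → Z → Z → Prop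
  equiv : ∀ {t}, 0 < t → Equivalence (rel t)
  mono : ∀ {s t}, 0 < s → s ≤ t → ∀ {x y}, rel s x y → rel t x y
  left : ∀ {t}, 0 < t → ∀ {x y}, rel t x y → ∃ s, 0 < s ∧ s < t ∧ rel s x y
  total : ∀ x y, ∃ t, 0 < t ∧ rel t x y

namespace MergeTree

variable {Z : Type*} (T : MergeTree Z) {rank : Z → ℕ} {z₀ : Z}

/-- The death time of `z` under the elder rule: the time after which `z` is no longer the point of
least rank in its cluster. -/
noncomputable def death (rank : Z → ℕ) (z : Z) : ℝ :=
  sInf {t | 0 < t ∧ ∃ y, T.rel t z y ∧ rank y < rank z}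

theorem death_nonneg (rank : Z → ℕ) (z : Z) : 0 ≤ T.death rank z :=
  Real.sInf_nonneg fun _ ht => ht.1.le

theorem rank_lt (hr : Function.Injective rank) (h₀ : ∀ z, rank z₀ ≤ rank z) {z : Z} (hz : z ≠ z₀) :
    rank z₀ < rank z :=
  lt_of_le_of_ne (h₀ z) fun h => hz (hr h).symm

theorem le_death_iff (hr : Function.Injective rank) (h₀ : ∀ z, rank z₀ ≤ rank z) {z : Z}
    (hz : z ≠ z₀) {t : ℝ} (ht : 0 < t) :
    t ≤ T.death rank z ↔ ∀ y, T.rel t z y → rank z ≤ rank y := by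
  constructor
  · intro h y hy
    by_contra hlt
    obtain ⟨s, hs0, hst, hs⟩ := T.left ht hy
    have : T.death rank z ≤ s := csInf_le ⟨0, fun _ hu => hu.1.le⟩ ⟨hs0, y, hs, not_le.1 hlt⟩
    linarith
  · intro h
    obtain ⟨u, hu0, hu⟩ := T.total z z₀
    refine le_csInf ⟨u, hu0, z₀, hu, rank_lt hr h₀ hz⟩ ?_
    rintro v ⟨hv0, y, hy, hlt⟩
    by_contra hvt
    exact absurd (h y (T.mono hv0 (not_le.1 hvt).le hy)) (not_le.2 hlt)

theorem exists_parent (hr : Function.Injective rank) (h₀ : ∀ z, rank z₀ ≤ rank z) {z : Z}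
    (hz : z ≠ z₀) : ∃ y, rank y < rank z ∧ ∀ t, T.death rank z < t → T.rel t z y := by
  by_contra! hne
  have hfin : {y | rank y < rank z}.Finite :=
    (Set.finite_lt_nat (rank z)).preimage hr.injOn
  choose! σ h1 h2 using hne
  have hd := T.death_nonneg rank z
  have h3 : ∀ᶠ t in 𝓝[>] (T.death rank z), ∀ y ∈ {y | rank y < rank z}, t ≤ σ y :=
    (eventually_all_finite hfin).2 fun y hy =>
      mem_nhdsWithin_of_mem_nhds (Iic_mem_nhds (h1 y hy))
  obtain ⟨t, h4, h5⟩ := (h3.and self_mem_nhdsWithin).exists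
  have ht : 0 < t := hd.trans_lt h5
  have h6 := mt (T.le_death_iff hr h₀ hz ht).2 (not_le.2 h5)
  push Not at h6
  obtain ⟨y, hy, hlt⟩ := h6
  exact h2 y hlt (T.mono ht (h4 y hlt) hy)

end MergeTree

namespace PersistenceModule

variable {F : Type*} [Field F]

theorem Isomorphic.symm {M N : PersistenceModule F} (h : M.Isomorphic N) : N.Isomorphic M := by
  obtain ⟨φ, ψ, h⟩ := h
  exact ⟨ψ, φ, fun t => (h t).symm⟩

theorem isomorphic_of_bijective {M N : PersistenceModule F} (φ : Hom M N)
    (h : ∀ t, Function.Bijective (φ.app t)) : M.Isomorphic N := by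
  let e : ∀ t, M.V t ≃ₗ[F] N.V t := fun t => LinearEquiv.ofBijective (φ.app t) (h t)
  refine ⟨φ, ⟨fun t => (e t).symm, fun {s t} hst => LinearMap.ext fun x => ?_⟩, fun t => ⟨?_, ?_⟩⟩
  · apply (e t).injective
    have h1 := LinearMap.congr_fun (φ.naturality hst) ((e s).symm x)
    have h2 : φ.app s ((e s).symm x) = x := (e s).apply_symm_apply x
    simp only [LinearMap.comp_apply, LinearEquiv.coe_coe, LinearEquiv.apply_symm_apply, h2] at h1 ⊢
    exact h1.symm
  · exact LinearMap.ext fun x => (e t).symm_apply_apply x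
  · exact LinearMap.ext fun x => (e t).apply_symm_apply x

/-- `M` is the module of a merge tree: for `t > 0`, the space at time `t` is spanned by the classes
`c t z` of the points of `Z`, with the only relations that related points have the same class. -/
structure IsClusterModule (M : PersistenceModule F) {Z : Type*} (T : MergeTree Z)
    (c : ∀ t, Z → M.V t) : Prop where
  subsingleton : ∀ t ≤ 0, Subsingleton (M.V t)
  map_class : ∀ {s t} (h : s ≤ t), 0 < s → ∀ z, M.map h (c s z) = c t z
  class_eq : ∀ {t}, 0 < t → ∀ {x y}, T.rel t x y → c t x = c t y
  span_class : ∀ {t}, 0 < t → Submodule.span F (Set.range (c t)) = ⊤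
  exists_functional : ∀ {t}, 0 < t → ∀ φ : Z → F, (∀ x y, T.rel t x y → φ x = φ y) →
    ∃ l : M.V t →ₗ[F] F, ∀ z, l (c t z) = φ z

section ClusterIso

open scoped DirectSum

variable {M : PersistenceModule F} {Z : Type*} {T : MergeTree Z} {c : ∀ t, Z → M.V t}

open Classical in
/-- The linear map at time `t` from a direct sum of interval modules to `M` that sends the
generators to the vectors `v₀` and `v i`. -/
noncomputable def generatorMap {ι : Type} (b : ι → ℝ) (t : ℝ) (v₀ : M.V t) (v : ι → M.V t) :
    (intervalSpace F (Set.Ioi 0) t × ⨁ i, intervalSpace F (Set.Ioc 0 (b i)) t) →ₗ[F] M.V t :=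
  LinearMap.coprod
    (LinearMap.toSpanSingleton F (M.V t) v₀ ∘ₗ (intervalSpace F (Set.Ioi 0) t).subtype)
    (DirectSum.toModule F ι (M.V t) fun i =>
      LinearMap.toSpanSingleton F (M.V t) (v i) ∘ₗ (intervalSpace F (Set.Ioc 0 (b i)) t).subtype)

theorem generatorMap_apply_left {ι : Type} (b : ι → ℝ) (t : ℝ) (v₀ : M.V t) (v : ι → M.V t)
    (x : intervalSpace F (Set.Ioi 0) t) : generatorMap b t v₀ v (x, 0) = (x : F) • v₀ := by
  simp [generatorMap]

open Classical in
theorem generatorMap_apply_lof {ι : Type} (b : ι → ℝ) (t : ℝ) (v₀ : M.V t) (v : ι → M.V t) (i : ι)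
    (x : intervalSpace F (Set.Ioc 0 (b i)) t) :
    generatorMap b t v₀ v (0, DirectSum.lof F ι _ i x) = (x : F) • v i := by
  simp [generatorMap]

theorem intervalModule_map_coe {J : Set ℝ} (hJ : J.OrdConnected) (hb : BddBelow J) {s t : ℝ}
    (h : s ≤ t) (ht : t ∈ J) (x : intervalSpace F J s) :
    Subtype.val (p := (· ∈ intervalSpace F J t)) ((intervalModule F J hJ hb).map h x) = x := by
  classical
  by_cases hs : s ∈ J
  · simp only [intervalModule, hs, ht, and_self, dif_pos]
    rfl
  · have h1 : x = 0 := Subtype.ext (x.2 hs)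
    have h2 : (intervalModule F J hJ hb).map h x = 0 :=
      (congrArg _ h1).trans (map_zero ((intervalModule F J hJ hb).map h))
    rw [h2, h1]
    rfl

/-- A family of generators which are born at time `0` and satisfy the relations of the interval
modules induces a morphism from the direct sum of these modules. -/
noncomputable def generatorHom {ι : Type} (b : ι → ℝ) (v₀ : ∀ t, M.V t) (v : ∀ t, ι → M.V t)
    (h₀ : ∀ {s t} (h : s ≤ t), 0 < s → M.map h (v₀ s) = v₀ t)
    (h₁ : ∀ {s t} (h : s ≤ t), 0 < s → ∀ i, M.map h (v s i) = v t i)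
    (h₂ : ∀ {t} i, 0 < t → b i < t → v t i = 0) :
    Hom ((intervalIoi F 0).prod (sumIoc F 0 b)) M where
  app t := generatorMap b t (v₀ t) (v t)
  naturality {s t} h := by
    classical
    refine LinearMap.prod_ext ?_ (DirectSum.linearMap_ext F fun i => ?_)
    · refine LinearMap.ext fun (x : intervalSpace F (Set.Ioi 0) s) => ?_
      change generatorMap b t (v₀ t) (v t) ((intervalIoi F 0).map h x, (sumIoc F 0 b).map h 0) =
        M.map h (generatorMap b s (v₀ s) (v s) (x, 0))
      rw [map_zero]
      erw [generatorMap_apply_left, generatorMap_apply_left]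
      rw [map_smul]
      by_cases hs : s ∈ Set.Ioi (0 : ℝ)
      · rw [h₀ h hs]
        congr 1
        exact intervalModule_map_coe _ _ h (lt_of_lt_of_le hs h) x
      · have h1 : x = 0 := Subtype.ext (x.2 hs)
        have h5 : (intervalIoi F 0).map h x = 0 :=
          (congrArg _ h1).trans (map_zero ((intervalIoi F 0).map h))
        rw [h5, h1]
        exact (zero_smul F _).trans (zero_smul F _).symm
    · refine LinearMap.ext fun (x : intervalSpace F (Set.Ioc 0 (b i)) s) => ?_
      have h3 : (sumIoc F 0 b).map h (DirectSum.lof F ι _ i x) =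
          DirectSum.lof F ι (fun i => intervalSpace F (Set.Ioc 0 (b i)) t) i
            ((intervalIoc F 0 (b i)).map h x) :=
        DFinsupp.mapRange_single (hf := fun i => map_zero ((intervalIoc F 0 (b i)).map h))
      change generatorMap b t (v₀ t) (v t) ((intervalIoi F 0).map h 0,
        (sumIoc F 0 b).map h (DirectSum.lof F ι _ i x)) =
        M.map h (generatorMap b s (v₀ s) (v s) (0, DirectSum.lof F ι _ i x))
      rw [map_zero, h3]
      erw [generatorMap_apply_lof, generatorMap_apply_lof]
      rw [map_smul]
      by_cases hs : s ∈ Set.Ioc 0 (b i)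
      · rw [h₁ h hs.1]
        by_cases ht : t ∈ Set.Ioc 0 (b i)
        · congr 1
          exact intervalModule_map_coe _ _ h ht x
        · have ht0 : 0 < t := hs.1.trans_le h
          rw [h₂ i ht0 (not_le.1 fun h' => ht ⟨ht0, h'⟩), smul_zero, smul_zero]
      · have h1 : x = 0 := Subtype.ext (x.2 hs)
        have h5 : (intervalIoc F 0 (b i)).map h x = 0 :=
          (congrArg _ h1).trans (map_zero ((intervalIoc F 0 (b i)).map h))
        rw [h5, h1]
        exact (zero_smul F _).trans (zero_smul F _).symm

/-- The barcode of a merge tree: the module has one bar `(0, ∞)` and one bar `(0, d]` for each point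
other than the eldest, where `d` is its death time. -/
theorem IsClusterModule.isomorphic (hM : IsClusterModule M T c) {rank : Z → ℕ} {z₀ : Z}
    (hr : Function.Injective rank) (hmin : ∀ z, rank z₀ ≤ rank z) {ι : Type}
    (e : ι ≃ {z // z ≠ z₀}) (b : ι → ℝ) (hb : ∀ i, T.death rank (e i) = b i) :
    M.Isomorphic ((intervalIoi F 0).prod (sumIoc F 0 b)) := by
  classical
  have hpar : ∀ i, ∃ y, rank y < rank (e i : Z) ∧ ∀ t, b i < t → T.rel t (e i) y := fun i =>
    hb i ▸ T.exists_parent hr hmin (e i).2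
  choose par hpar1 hpar2 using hpar
  -- The bar of `e i` is generated by its difference with an earlier point that it joins when it dies.
  set v : ∀ t, ι → M.V t := fun t i => c t (e i) - c t (par i) with hv
  have hmin_iff : ∀ i t, 0 < t → t ≤ b i → ∀ y, T.rel t (e i) y → rank (e i : Z) ≤ rank y :=
    fun i t ht htb => (T.le_death_iff hr hmin (e i).2 ht).1 (hb i ▸ htb)
  refine (isomorphic_of_bijective (generatorHom b (fun t => c t z₀) v
    (fun h hs => hM.map_class h hs z₀)
    (fun h hs i => by simp only [hv, map_sub, hM.map_class h hs])
    (fun i ht hbt => sub_eq_zero.2 (hM.class_eq ht (hpar2 i _ hbt)))) fun t => ?_).symm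
  change Function.Bijective (generatorMap b t (c t z₀) (v t))
  rcases le_or_gt t 0 with ht | ht
  · have h1 : Subsingleton (intervalSpace F (Set.Ioi 0) t) :=
      ⟨fun x y => Subtype.ext ((x.2 (not_lt.2 ht)).trans (y.2 (not_lt.2 ht)).symm)⟩
    have h2 : ∀ i, Subsingleton (intervalSpace F (Set.Ioc 0 (b i)) t) := fun i =>
      subsingleton_intervalIoc ht
    have h3 : Subsingleton (⨁ i, intervalSpace F (Set.Ioc 0 (b i)) t) :=
      ⟨fun x y => DFinsupp.ext fun i => (h2 i).elim _ _⟩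
    have h4 := hM.subsingleton t ht
    exact ⟨Function.injective_of_subsingleton _, fun x => ⟨0, Subsingleton.elim _ _⟩⟩
  constructor
  · rw [injective_iff_map_eq_zero]
    rintro ⟨x, y⟩ hxy
    have hsum : generatorMap b t (c t z₀) (v t) (x, y) =
        (x : F) • c t z₀ + ∑ i ∈ DFinsupp.support y, (y i : F) • v t i := by
      have h1 : generatorMap b t (c t z₀) (v t) (x, y) =
          generatorMap b t (c t z₀) (v t) (x, 0) + generatorMap b t (c t z₀) (v t) (0, y) := by
        rw [← map_add]; simp
      set L := generatorMap b t (c t z₀) (v t) ∘ₗ LinearMap.inr F _ _ with hL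
      have h2 : L y = ∑ i ∈ DFinsupp.support y, L (DirectSum.lof F ι _ i (y i)) := by
        rw [← map_sum]
        exact congrArg L (DirectSum.sum_support_of y).symm
      rw [h1, generatorMap_apply_left]
      refine congrArg _ (h2.trans (Finset.sum_congr rfl fun i _ => ?_))
      exact generatorMap_apply_lof b t _ _ i (y i)
    rw [hsum] at hxy
    have hy : y = 0 := by
      by_contra hne
      have hsupp : (DFinsupp.support y).Nonempty := by
        rw [Finset.nonempty_iff_ne_empty]
        exact fun h => hne (DFinsupp.support_eq_empty.1 h)
      -- Test on the cluster of the point of largest rank involved: it contains neither `z₀`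
      -- nor any `par j` nor any other `e j`.
      obtain ⟨i, hi, hmax⟩ := (DFinsupp.support y).exists_max_image
        (fun j => rank (e j : Z)) hsupp
      have halive : ∀ j ∈ DFinsupp.support y, t ≤ b j := by
        intro j hj
        by_contra h
        exact (DFinsupp.mem_support_iff.1 hj) (Subtype.ext ((y j).2 fun h' => h h'.2))
      have hi1 := hmin_iff i t ht (halive i hi)
      obtain ⟨l, hl⟩ := hM.exists_functional ht (fun z => if T.rel t (e i) z then 1 else 0) (by
        intro p q hpq
        have : T.rel t (e i) p ↔ T.rel t (e i) q :=
          ⟨fun h => (T.equiv ht).trans h hpq, fun h => (T.equiv ht).trans h ((T.equiv ht).symm hpq)⟩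
        simp only [this])
      have h0 : ¬ T.rel t (e i) z₀ := fun h =>
        absurd (hi1 z₀ h) (not_le.2 (MergeTree.rank_lt hr hmin (e i).2))
      have hparj : ∀ j ∈ DFinsupp.support y, ¬ T.rel t (e i) (par j) := fun j hj h =>
        absurd (hi1 _ h) (not_le.2 ((hpar1 j).trans_le (hmax j hj)))
      have hej : ∀ j ∈ DFinsupp.support y, j ≠ i → ¬ T.rel t (e i) (e j) := by
        intro j hj hji h
        have h2 := hmin_iff j t ht (halive j hj) _ ((T.equiv ht).symm h)
        exact hji (e.injective (Subtype.ext (hr (le_antisymm h2 (hi1 _ h)))))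
      have h3 := congrArg l hxy
      rw [map_zero, map_add, map_sum, Finset.sum_eq_single i] at h3
      · simp only [map_smul, hv, map_sub, hl, if_neg h0, if_neg (hparj i hi),
          if_pos ((T.equiv ht).refl (e i : Z)), smul_eq_mul] at h3
        exact (DFinsupp.mem_support_iff.1 hi) (Subtype.ext (by simpa using h3))
      · intro j hj hji
        simp only [map_smul, hv, map_sub, hl, if_neg (hparj j hj), if_neg (hej j hj hji), sub_zero,
          smul_zero]
      · exact fun h => absurd hi h
    subst hy
    obtain ⟨l, hl⟩ := hM.exists_functional ht (fun _ => 1) fun _ _ _ => rfl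
    have h3 := congrArg l hxy
    simp only [DFinsupp.support_zero, Finset.sum_empty, add_zero, map_smul, hl, map_zero,
      smul_eq_mul, mul_one] at h3
    have h4 : x = 0 := Subtype.ext h3
    rw [h4]
    rfl
  · rw [← LinearMap.range_eq_top, eq_top_iff, ← hM.span_class ht, Submodule.span_le]
    rintro _ ⟨z, rfl⟩
    -- A point that is still alive differs from an earlier one by a generator, and a dead one has the
    -- class of an earlier one.
    induction hn : rank z using Nat.strong_induction_on generalizing z with
    | _ n ih =>
    by_cases hz : z = z₀
    · subst hz
      exact ⟨(⟨1, fun h => absurd ht h⟩, 0), by rw [generatorMap_apply_left, one_smul]⟩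
    · obtain ⟨i, hi⟩ := e.surjective ⟨z, hz⟩
      have hi' : (e i : Z) = z := by rw [hi]
      have h1 := ih (rank (par i)) (by rw [← hn, ← hi']; exact hpar1 i) (par i) rfl
      rcases le_or_gt t (b i) with htb | htb
      · have h2 : v t i ∈ LinearMap.range (generatorMap b t (c t z₀) (v t)) :=
          ⟨(0, DirectSum.lof F ι _ i ⟨1, fun h => absurd ⟨ht, htb⟩ h⟩), by
            rw [generatorMap_apply_lof, one_smul]⟩
        have h3 := add_mem h2 h1
        simp only [hv, sub_add_cancel, hi'] at h3
        exact h3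
      · rw [← hi', hM.class_eq ht (hpar2 i t htb)]
        exact h1

end ClusterIso

end PersistenceModule

/-! ### Matching the death times with a counting rule -/

/-- An increasing union of sets with at most `B.encard` elements has at most `B.encard` elements. -/
theorem encard_iUnion_le {α β : Type*} {A : ℕ → Set α} (hA : Monotone A) {B : Set β}
    (h : ∀ n, (A n).encard ≤ B.encard) : (⋃ n, A n).encard ≤ B.encard := by
  rw [← ENat.forall_natCast_le_iff_le]
  intro k hk
  obtain ⟨s, hs, hsk⟩ := Set.exists_subset_encard_eq hk
  have hfin : s.Finite := Set.finite_of_encard_eq_coe hsk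
  obtain ⟨n, hn⟩ := hA.directed_le.exists_mem_subset_of_finset_subset_biUnion
    (s := hfin.toFinset) (by simpa using hs)
  rw [← hsk]
  exact (Set.encard_le_encard (by simpa using hn)).trans (h n)

/-- Two functions on countable types with equally large fibres differ by a bijection. -/
theorem exists_equiv_of_encard_fiber_eq {α β γ : Type} [Countable α] [Countable β] (f : α → γ)
    (g : β → γ) (h : ∀ c, {a | f a = c}.encard = {b | g b = c}.encard) :
    ∃ e : α ≃ β, ∀ a, g (e a) = f a := by
  have h1 : ∀ c, Nonempty ({a // f a = c} ≃ {b // g b = c}) := fun c => by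
    rw [← Cardinal.eq, ← Cardinal.toENat_eq_iff_of_le_aleph0 Cardinal.mk_le_aleph0
      Cardinal.mk_le_aleph0]
    exact h c
  let E := fun c => (h1 c).some
  refine ⟨(Equiv.sigmaFiberEquiv f).symm.trans
    ((Equiv.sigmaCongrRight E).trans (Equiv.sigmaFiberEquiv g)), fun a => ?_⟩
  exact (E (f a) ⟨a, rfl⟩).2

/-- A rule assigning to the clusters of a merge tree finite sets of marks such that the number of
points of each cluster is one more than its number of marks; the mark `p` appears after
the time `time p`. -/
structure MarkedTree {Z : Type*} (T : MergeTree Z) (P : Type*) where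
  mem : ℝ → P → Z → Prop
  time : P → ℝ
  time_pos : ∀ p, 0 < time p
  time_lt : ∀ {t p z}, 0 < t → mem t p z → time p < t
  exists_mem : ∀ {t p}, 0 < t → time p < t → ∃ z, mem t p z
  mem_of_rel : ∀ {t p x y}, 0 < t → mem t p x → T.rel t x y → mem t p y
  rel_of_mem : ∀ {t p x y}, 0 < t → mem t p x → mem t p y → T.rel t x y
  mono : ∀ {s t p x}, 0 < s → s ≤ t → mem s p x → mem t p x
  finite_rel : ∀ {t}, 0 < t → ∀ z, {y | T.rel t z y}.Finite
  finite_mem : ∀ {t}, 0 < t → ∀ z, {p | mem t p z}.Finite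
  card_eq : ∀ {t}, 0 < t → ∀ z, {y | T.rel t z y}.ncard = {p | mem t p z}.ncard + 1

namespace MarkedTree

variable {Z P : Type} {T : MergeTree Z} (Q : MarkedTree T P) {rank : Z → ℕ} {z₀ : Z}
  (hr : Function.Injective rank) (hmin : ∀ z, rank z₀ ≤ rank z)
include hr hmin

theorem ncard_death_lt_of_le {s t : ℝ} (hs : 0 < s) (hst : s ≤ t) :
    {y | T.rel t z₀ y ∧ y ≠ z₀ ∧ T.death rank y < s}.ncard =
      {p | Q.mem t p z₀ ∧ Q.time p < s}.ncard := by
  classical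
  have ht : 0 < t := hs.trans_le hst
  have hE := T.equiv hs
  have hEt := T.equiv ht
  -- The eldest point of the cluster at time `s`.
  have hm : ∀ y, ∃ r, T.rel s y r ∧ ∀ y', T.rel s y y' → rank r ≤ rank y' := by
    intro y
    have hne : {k | ∃ r, T.rel s y r ∧ rank r = k}.Nonempty := ⟨_, y, hE.refl y, rfl⟩
    obtain ⟨r, h1, h2⟩ := Nat.sInf_mem hne
    exact ⟨r, h1, fun y' hy' => h2 ▸ Nat.sInf_le ⟨y', hy', rfl⟩⟩
  choose m hm1 hm2 using hm
  have hmR : ∀ y, m y = z₀ ∨ s ≤ T.death rank (m y) := by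
    intro y
    by_cases h : m y = z₀
    · exact Or.inl h
    · exact Or.inr ((T.le_death_iff hr hmin h hs).2 fun y' hy' => hm2 y y' (hE.trans (hm1 y) hy'))
  have hmuniq : ∀ r, (r = z₀ ∨ s ≤ T.death rank r) → ∀ y, T.rel s r y → m y = r := by
    intro r hR y hy
    have h1 : ∀ y', T.rel s r y' → rank r ≤ rank y' := by
      rcases hR with rfl | h
      · exact fun y' _ => hmin y'
      · by_cases hrz : r = z₀
        · exact hrz ▸ fun y' _ => hmin y'
        · exact (T.le_death_iff hr hmin hrz hs).1 h
    exact hr (le_antisymm (hm2 y r (hE.symm hy)) (h1 _ (hE.trans hy (hm1 y))))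
  set C := (Q.finite_rel ht z₀).toFinset with hC
  have hmemC : ∀ y, y ∈ C ↔ T.rel t z₀ y := fun y => by simp [hC]
  set R := C.filter fun y => y = z₀ ∨ s ≤ T.death rank y with hR
  set Qs := ((Q.finite_mem ht z₀).toFinset).filter fun p => Q.time p < s with hQs
  have hmemQ : ∀ p, p ∈ Qs ↔ Q.mem t p z₀ ∧ Q.time p < s := fun p => by simp [hQs]
  have hmC : ∀ y ∈ C, m y ∈ R := fun y hy =>
    Finset.mem_filter.2 ⟨(hmemC _).2 (hEt.trans ((hmemC y).1 hy) (T.mono hs hst (hm1 y))), hmR y⟩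
  have hx : ∀ p ∈ Qs, ∃ x, Q.mem s p x := fun p hp => Q.exists_mem hs ((hmemQ p).1 hp).2
  have : Nonempty Z := ⟨z₀⟩
  choose! x hx using hx
  have hxC : ∀ p ∈ Qs, x p ∈ C := fun p hp =>
    (hmemC _).2 (Q.rel_of_mem ht ((hmemQ p).1 hp).1 (Q.mono hs hst (hx p hp)))
  -- Count the points and the marks of the cluster of `z₀` at time `t` over the eldest points of its
  -- clusters at time `s`; these are the points which have not died before `s`.
  have h1 : C.card = ∑ r ∈ R, (C.filter fun y => m y = r).card :=
    Finset.card_eq_sum_card_fiberwise hmC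
  have h2 : Qs.card = ∑ r ∈ R, (Qs.filter fun p => m (x p) = r).card :=
    Finset.card_eq_sum_card_fiberwise fun p hp => hmC _ (hxC p hp)
  have h3 : ∀ r ∈ R, (C.filter fun y => m y = r).card =
      (Qs.filter fun p => m (x p) = r).card + 1 := by
    intro r hr'
    obtain ⟨hrC, hrR⟩ := Finset.mem_filter.1 hr'
    have e1 : ((C.filter fun y => m y = r : Finset Z) : Set Z) = {y | T.rel s r y} := by
      ext y
      simp only [Finset.coe_filter, Set.mem_ofPred_eq]
      constructor
      · rintro ⟨-, rfl⟩
        exact hE.symm (hm1 y)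
      · intro h
        exact ⟨(hmemC y).2 (hEt.trans ((hmemC r).1 hrC) (T.mono hs hst h)), hmuniq r hrR y h⟩
    have e2 : ((Qs.filter fun p => m (x p) = r : Finset P) : Set P) = {p | Q.mem s p r} := by
      ext p
      simp only [Finset.coe_filter, Set.mem_ofPred_eq]
      constructor
      · rintro ⟨h, rfl⟩
        exact Q.mem_of_rel hs (hx p h) (hm1 _)
      · intro h
        have hp : p ∈ Qs := (hmemQ p).2 ⟨Q.mem_of_rel ht (Q.mono hs hst h)
          (hEt.symm ((hmemC r).1 hrC)), Q.time_lt hs h⟩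
        exact ⟨hp, hmuniq r hrR _ (Q.rel_of_mem hs h (hx p hp))⟩
    rw [← Set.ncard_coe_finset, ← Set.ncard_coe_finset, e1, e2]
    exact Q.card_eq hs r
  rw [Finset.sum_congr rfl h3, Finset.sum_add_distrib, ← h2, Finset.sum_const, smul_eq_mul,
    mul_one] at h1
  have h4 : {y | T.rel t z₀ y ∧ y ≠ z₀ ∧ T.death rank y < s} =
      ((C.filter fun y => ¬ (y = z₀ ∨ s ≤ T.death rank y) : Finset Z) : Set Z) := by
    ext y
    simp [hmemC]
  have h5 : {p | Q.mem t p z₀ ∧ Q.time p < s} = (Qs : Set P) := by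
    ext p
    simp [hmemQ]
  have h6 : R.card + _ = C.card := Finset.card_filter_add_card_filter_not (s := C)
    fun y => y = z₀ ∨ s ≤ T.death rank y
  rw [h4, h5, Set.ncard_coe_finset, Set.ncard_coe_finset]
  omega

theorem ncard_death_lt {t : ℝ} (ht : 0 < t) (s : ℝ) :
    {y | T.rel t z₀ y ∧ y ≠ z₀ ∧ T.death rank y < s}.ncard =
      {p | Q.mem t p z₀ ∧ Q.time p < s}.ncard := by
  rcases le_or_gt s 0 with hs | hs
  · have h1 : {y | T.rel t z₀ y ∧ y ≠ z₀ ∧ T.death rank y < s} = ∅ := by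
      ext y
      simp only [Set.mem_ofPred_eq, Set.mem_empty_iff_false, iff_false]
      rintro ⟨-, -, h⟩
      linarith [T.death_nonneg rank y]
    have h2 : {p | Q.mem t p z₀ ∧ Q.time p < s} = ∅ := by
      ext p
      simp only [Set.mem_ofPred_eq, Set.mem_empty_iff_false, iff_false]
      rintro ⟨-, h⟩
      linarith [Q.time_pos p]
    rw [h1, h2, Set.ncard_empty, Set.ncard_empty]
  · rcases le_total s t with hst | hts
    · exact Q.ncard_death_lt_of_le hr hmin hs hst
    -- All points of the cluster other than `z₀`, and all its marks, have times below `t`.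
    · have h1 : {y | T.rel t z₀ y ∧ y ≠ z₀ ∧ T.death rank y < s} =
          {y | T.rel t z₀ y ∧ y ≠ z₀ ∧ T.death rank y < t} := by
        ext y
        refine and_congr_right fun hy => and_congr_right fun hne =>
          ⟨fun _ => ?_, fun h => h.trans_le hts⟩
        by_contra h
        exact absurd ((T.le_death_iff hr hmin hne ht).1 (not_lt.1 h) z₀ ((T.equiv ht).symm hy))
          (not_le.2 (MergeTree.rank_lt hr hmin hne))
      have h2 : {p | Q.mem t p z₀ ∧ Q.time p < s} = {p | Q.mem t p z₀ ∧ Q.time p < t} := by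
        ext p
        exact and_congr_right fun hp =>
          ⟨fun _ => Q.time_lt ht hp, fun h => h.trans_le hts⟩
      rw [h1, h2]
      exact Q.ncard_death_lt_of_le hr hmin ht le_rfl

theorem ncard_death_eq {t : ℝ} (ht : 0 < t) (s : ℝ) :
    {y | T.rel t z₀ y ∧ y ≠ z₀ ∧ T.death rank y = s}.ncard =
      {p | Q.mem t p z₀ ∧ Q.time p = s}.ncard := by
  -- Only finitely many times occur in the cluster, so none of them lies between `s` and some
  -- `s' > s`.
  obtain ⟨s', hss', h1, h2⟩ : ∃ s' > s, (∀ y ∈ {y | T.rel t z₀ y}, (T.death rank y < s' ↔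
      T.death rank y ≤ s)) ∧ ∀ p ∈ {p | Q.mem t p z₀}, (Q.time p < s' ↔ Q.time p ≤ s) := by
    have key : ∀ d : ℝ, ∀ᶠ s' in 𝓝[>] s, (d < s' ↔ d ≤ s) := by
      intro d
      rcases le_or_gt d s with h | h
      · filter_upwards [self_mem_nhdsWithin] with s' hs'
        exact ⟨fun _ => h, fun _ => h.trans_lt hs'⟩
      · filter_upwards [mem_nhdsWithin_of_mem_nhds (Iic_mem_nhds h)] with s' hs'
        exact ⟨fun h' => absurd h' (not_lt.2 hs'), fun h' => absurd h' (not_le.2 h)⟩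
    obtain ⟨s', h⟩ := (((eventually_all_finite (Q.finite_rel ht z₀)).2 fun y _ =>
      key (T.death rank y)).and (((eventually_all_finite (Q.finite_mem ht z₀)).2 fun p _ =>
      key (Q.time p)).and self_mem_nhdsWithin)).exists
    exact ⟨s', h.2.2, h.1, h.2.1⟩
  have e1 : {y | T.rel t z₀ y ∧ y ≠ z₀ ∧ T.death rank y = s} =
      {y | T.rel t z₀ y ∧ y ≠ z₀ ∧ T.death rank y < s'} \
        {y | T.rel t z₀ y ∧ y ≠ z₀ ∧ T.death rank y < s} := by
    ext y
    simp only [Set.mem_sdiff, Set.mem_ofPred_eq]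
    constructor
    · rintro ⟨h3, h4, h5⟩
      exact ⟨⟨h3, h4, h5 ▸ hss'⟩, fun h => h.2.2.ne h5⟩
    · rintro ⟨⟨h3, h4, h5⟩, h6⟩
      exact ⟨h3, h4, le_antisymm ((h1 y h3).1 h5) (not_lt.1 fun h => h6 ⟨h3, h4, h⟩)⟩
  have e2 : {p | Q.mem t p z₀ ∧ Q.time p = s} =
      {p | Q.mem t p z₀ ∧ Q.time p < s'} \ {p | Q.mem t p z₀ ∧ Q.time p < s} := by
    ext p
    simp only [Set.mem_sdiff, Set.mem_ofPred_eq]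
    constructor
    · rintro ⟨h3, h5⟩
      exact ⟨⟨h3, h5 ▸ hss'⟩, fun h => h.2.ne h5⟩
    · rintro ⟨⟨h3, h5⟩, h6⟩
      exact ⟨h3, le_antisymm ((h2 p h3).1 h5) (not_lt.1 fun h => h6 ⟨h3, h⟩)⟩
  have s1 : {y | T.rel t z₀ y ∧ y ≠ z₀ ∧ T.death rank y < s} ⊆
      {y | T.rel t z₀ y ∧ y ≠ z₀ ∧ T.death rank y < s'} :=
    fun y hy => ⟨hy.1, hy.2.1, hy.2.2.trans hss'⟩
  have s2 : {p | Q.mem t p z₀ ∧ Q.time p < s} ⊆ {p | Q.mem t p z₀ ∧ Q.time p < s'} :=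
    fun p hp => ⟨hp.1, hp.2.trans hss'⟩
  rw [e1, e2, Set.ncard_sdiff s1 ((Q.finite_rel ht z₀).subset fun y hy => hy.1),
    Set.ncard_sdiff s2 ((Q.finite_mem ht z₀).subset fun p hp => hp.1),
    Q.ncard_death_lt hr hmin ht, Q.ncard_death_lt hr hmin ht]

/-- The marks correspond to the points other than the eldest one, in such a way that the time of
a mark is the death time of the point: by the counting rule both have equally many elements with
a given time in each cluster, and the clusters of `z₀` exhaust the tree. -/
theorem exists_equiv : ∃ e : P ≃ {z // z ≠ z₀}, ∀ p, T.death rank (e p : Z) = Q.time p := by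
  have hpos : ∀ n : ℕ, (0 : ℝ) < n + 1 := fun n => by positivity
  have hle : ∀ {m n : ℕ}, m ≤ n → (m : ℝ) + 1 ≤ n + 1 := fun h => by
    have : (_ : ℝ) ≤ _ := Nat.cast_le.2 h
    linarith
  have hP : ∀ p, ∃ n : ℕ, Q.mem (n + 1) p z₀ := by
    intro p
    have h1 : Q.time p < Q.time p + 1 := lt_add_one _
    have h0 : 0 < Q.time p + 1 := by linarith [Q.time_pos p]
    obtain ⟨x, hx⟩ := Q.exists_mem h0 h1
    obtain ⟨u, hu, hxu⟩ := T.total x z₀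
    obtain ⟨n, hn⟩ := exists_nat_ge (max (Q.time p + 1) u)
    have h2 : max (Q.time p + 1) u ≤ n + 1 := by linarith
    exact ⟨n, Q.mem_of_rel (hpos n) (Q.mono h0 ((le_max_left _ _).trans h2) hx)
      (T.mono hu ((le_max_right _ _).trans h2) hxu)⟩
  have hZ : ∀ z, ∃ n : ℕ, T.rel (n + 1) z₀ z := by
    intro z
    obtain ⟨u, hu, hxu⟩ := T.total z₀ z
    obtain ⟨n, hn⟩ := exists_nat_ge u
    exact ⟨n, T.mono hu (by linarith) hxu⟩
  have : Countable Z := hr.countable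
  have : Countable P := by
    rw [← Set.countable_univ_iff]
    refine (Set.countable_iUnion fun n : ℕ => (Q.finite_mem (hpos n) z₀).countable).mono
      fun p _ => ?_
    exact Set.mem_iUnion.2 (hP p)
  refine exists_equiv_of_encard_fiber_eq Q.time (fun z : {z // z ≠ z₀} => T.death rank (z : Z))
    fun s => ?_
  have e1 : {p | Q.time p = s} = ⋃ n : ℕ, {p | Q.mem (n + 1) p z₀ ∧ Q.time p = s} := by
    ext p
    simp only [Set.mem_iUnion, Set.mem_ofPred_eq, exists_and_right]
    exact ⟨fun h => ⟨hP p, h⟩, fun h => h.2⟩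
  have e2 : {z : {z // z ≠ z₀} | T.death rank (z : Z) = s}.encard =
      (⋃ n : ℕ, {y | T.rel (n + 1) z₀ y ∧ y ≠ z₀ ∧ T.death rank y = s}).encard := by
    rw [← Subtype.val_injective.encard_image]
    congr 1
    ext z
    simp only [Set.mem_iUnion, Set.mem_ofPred_eq, exists_and_right]
    constructor
    · rintro ⟨y, hy, rfl⟩
      exact ⟨hZ _, y.2, hy⟩
    · rintro ⟨-, h1, h2⟩
      exact ⟨⟨z, h1⟩, h2, rfl⟩
  have hm1 : Monotone fun n : ℕ => {p | Q.mem (n + 1) p z₀ ∧ Q.time p = s} :=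
    fun m n h p hp => ⟨Q.mono (hpos m) (hle h) hp.1, hp.2⟩
  have hm2 : Monotone fun n : ℕ => {y | T.rel (n + 1) z₀ y ∧ y ≠ z₀ ∧ T.death rank y = s} :=
    fun m n h p hp => ⟨T.mono (hpos m) (hle h) hp.1, hp.2⟩
  have hcard : ∀ n : ℕ, {p | Q.mem (n + 1) p z₀ ∧ Q.time p = s}.encard =
      {y | T.rel (n + 1) z₀ y ∧ y ≠ z₀ ∧ T.death rank y = s}.encard := fun n => by
    rw [← ((Q.finite_mem (hpos n) z₀).subset fun p hp => hp.1).cast_ncard_eq,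
      ← ((Q.finite_rel (hpos n) z₀).subset fun p hp => hp.1).cast_ncard_eq,
      Q.ncard_death_eq hr hmin (hpos n)]
  rw [e1, e2]
  refine le_antisymm (encard_iUnion_le hm1 fun n => ?_) (encard_iUnion_le hm2 fun n => ?_)
  · rw [hcard]
    exact Set.encard_le_encard (Set.subset_iUnion
      (fun n : ℕ => {y | T.rel (n + 1) z₀ y ∧ y ≠ z₀ ∧ T.death rank y = s}) n)
  · rw [← hcard]
    exact Set.encard_le_encard (Set.subset_iUnion
      (fun n : ℕ => {p | Q.mem (n + 1) p z₀ ∧ Q.time p = s}) n)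

end MarkedTree

/-! ### Zeroth singular homology -/

section Homology

open CategoryTheory Limits AlgebraicTopology

variable (F : Type u) [Field F]

/-- The map `F ⟶ H₀(X)` that sends `1` to the class of the point `x`. -/
noncomputable def pointHom (X : TopCat.{0}) (x : X) : ModuleCat.of F F ⟶ (H0 F).obj X :=
  ((TopCat.toSSet.obj X).chainComplex (ModuleCat.of F F)).liftCycles
      (k := (TopCat.toSSet.obj X).ιChainComplex (TopCat.toSSetObj₀Equiv.symm x)) 0 (by simp)
      (by simp) ≫
    ((TopCat.toSSet.obj X).chainComplex (ModuleCat.of F F)).homologyπ 0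

/-- The class of the point `x` in `H₀(X)`. -/
noncomputable def pointClass (X : TopCat.{0}) (x : X) : (H0 F).obj X :=
  (pointHom F X x).hom (1 : F)

/-- `H₀(X)` as the direct sum of copies of `F` indexed by the path components of `X`. -/
noncomputable def h0Iso (X : TopCat.{0}) :
    (H0 F).obj X ≅ ∐ fun _ : ZerothHomotopy X => ModuleCat.of F F :=
  TopCat.singularHomology₀Iso X (ModuleCat.of F F)

theorem pointHom_comp_iso (X : TopCat.{0}) (x : X) :
    pointHom F X x ≫ (h0Iso F X).hom =
      Sigma.ι (fun _ : ZerothHomotopy X => ModuleCat.of F F) (ZerothHomotopy.mk x) := by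
  have h := SSet.liftCycles_ιChainComplex_homologyπ_homology₀Iso_hom_assoc (TopCat.toSSet.obj X)
    (ModuleCat.of F F) (TopCat.toSSetObj₀Equiv.symm x)
    ((sigmaConst.obj (ModuleCat.of F F)).map TopCat.zerothHomotopyEquiv.toIso.inv)
  refine ((Category.assoc _ _ _).trans h).trans ?_
  simp

theorem liftCycles_homologyπ_homologyMap {X Y : SSet.{0}} (f : X ⟶ Y) (R : ModuleCat.{u} F)
    (x : X.obj (.op (.mk 0))) :
    ((X.chainComplex R).liftCycles (k := X.ιChainComplex x) 0 (by simp) (by simp) ≫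
      (X.chainComplex R).homologyπ 0) ≫ SSet.homologyMap f R 0 =
    (Y.chainComplex R).liftCycles (k := Y.ιChainComplex (f.app _ x)) 0 (by simp) (by simp) ≫
      (Y.chainComplex R).homologyπ 0 := by
  rw [Category.assoc, HomologicalComplex.homologyπ_naturality,
    HomologicalComplex.liftCycles_comp_cyclesMap_assoc]
  simp only [SSet.ι_chainComplexMap_f]

theorem map_pointClass {X Y : TopCat.{0}} (f : X ⟶ Y) (x : X) :
    (H0 F).map f (pointClass F X x) = pointClass F Y (f x) := by
  have h : pointHom F X x ≫ (H0 F).map f = pointHom F Y (f x) :=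
    liftCycles_homologyπ_homologyMap F (TopCat.toSSet.map f) (ModuleCat.of F F) _
  rw [pointClass, pointClass, ← h]
  rfl

variable {F}

theorem pointClass_eq_of_joined {X : TopCat.{0}} {x y : X} (h : Joined x y) :
    pointClass F X x = pointClass F X y := by
  have h1 : pointHom F X x = pointHom F X y := by
    rw [← cancel_mono (h0Iso F X).hom, pointHom_comp_iso,
      pointHom_comp_iso, show ZerothHomotopy.mk x = ZerothHomotopy.mk y from Quotient.sound h]
  rw [pointClass, h1, pointClass]

theorem hom_ext_of_pointHom {X : TopCat.{0}} {V : ModuleCat.{u} F} {f g : (H0 F).obj X ⟶ V}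
    (h : ∀ x, pointHom F X x ≫ f = pointHom F X x ≫ g) : f = g := by
  rw [← cancel_epi (h0Iso F X).inv]
  refine Sigma.hom_ext _ _ fun c => ?_
  obtain ⟨x, rfl⟩ : ∃ x, ZerothHomotopy.mk x = c := Quotient.exists_rep c
  rw [← pointHom_comp_iso]
  simpa using h x

theorem span_pointClass (X : TopCat.{0}) :
    Submodule.span F (Set.range (pointClass F X)) = ⊤ := by
  set S := Submodule.span F (Set.range (pointClass F X)) with hS
  have h : ModuleCat.ofHom S.mkQ = 0 := by
    refine hom_ext_of_pointHom fun x => ModuleCat.hom_ext (LinearMap.ext_ring ?_)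
    exact (Submodule.Quotient.mk_eq_zero S).2 (Submodule.subset_span ⟨x, rfl⟩)
  rw [← Submodule.ker_mkQ S]
  exact LinearMap.ker_eq_top.2 (congrArg ModuleCat.Hom.hom h)

/-- A function which is constant on path components extends to a functional on `H₀`. -/
theorem exists_functional_of_joined (X : TopCat.{0}) (φ : X → F)
    (h : ∀ x y, Joined x y → φ x = φ y) :
    ∃ l : (H0 F).obj X →ₗ[F] F, ∀ x, l (pointClass F X x) = φ x := by
  let g : (∐ fun _ : ZerothHomotopy X => ModuleCat.of F F) ⟶ ModuleCat.of F F :=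
    Sigma.desc fun c => ModuleCat.ofHom (LinearMap.toSpanSingleton F F (Quotient.lift φ h c))
  refine ⟨((h0Iso F X).hom ≫ g).hom, fun x => ?_⟩
  have h1 : pointHom F X x ≫ (h0Iso F X).hom ≫ g =
      ModuleCat.ofHom (LinearMap.toSpanSingleton F F (φ x)) := by
    rw [← Category.assoc, pointHom_comp_iso, Sigma.ι_desc]
    rfl
  have h2 := congrArg (fun k => ModuleCat.Hom.hom k (1 : F)) h1
  exact h2.trans (one_smul F _)

end Homology

/-! ### The merge tree of the level sets -/

/-- `theta` is the inverse of the change of parameter which defines the critical times. -/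
theorem lt_theta_iff {x t : ℝ} (h1 : x < 1) (h0 : 0 ≤ x) :
    x < theta t ↔ Real.log ((1 + x) / (1 - x)) < t := by
  have he := Real.exp_pos t
  rw [Real.log_lt_iff_lt_exp (div_pos (by linarith) (by linarith)), theta, lt_div_iff₀ (by linarith),
    div_lt_iff₀ (by linarith)]
  constructor <;> intro h <;> nlinarith

theorem theta_pos {t : ℝ} (ht : 0 < t) : 0 < theta t :=
  (lt_theta_iff one_pos le_rfl).2 (by simpa using ht)

theorem theta_lt_one (t : ℝ) : theta t < 1 := by
  rw [theta, div_lt_one (by linarith [Real.exp_pos t])]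
  linarith

theorem pos_of_theta_pos {t : ℝ} (h : 0 < theta t) : 0 < t :=
  not_le.1 fun ht => absurd h (not_lt.2 (theta_nonpos ht))

theorem isOpen_disk : IsOpen disk := Metric.isOpen_ball

theorem joined_of_mem_connectedComponentIn {U : Set ℂ} (hU : IsOpen U) {x y : U}
    (h : (y : ℂ) ∈ connectedComponentIn U x) : Joined x y := by
  have h1 : IsPathConnected (connectedComponentIn U (x : ℂ)) :=
    hU.connectedComponentIn.isConnected_iff_isPathConnected.1
      (isConnected_connectedComponentIn_iff.2 x.2)
  exact (joinedIn_iff_joined x.2 y.2).1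
    ((h1.joinedIn _ (mem_connectedComponentIn x.2) _ h).mono (connectedComponentIn_subset _ _))

theorem mem_connectedComponentIn_of_joined {U : Set ℂ} {x y : U} (h : Joined x y) :
    (y : ℂ) ∈ connectedComponentIn U x := by
  have h1 := isPathConnected_pathComponentIn x.2
  exact h1.isConnected.isPreconnected.subset_connectedComponentIn (mem_pathComponentIn_self x.2)
    pathComponentIn_subset ((joinedIn_iff_joined x.2 y.2).2 h)

theorem analyticOrderNatAt_deriv_eq_critOrder {B : ℂ → ℂ} {w : ℂ} (hB : AnalyticAt ℂ B w)
    (h : analyticOrderAt (deriv B) w ≠ ⊤) : analyticOrderNatAt (deriv B) w = critOrder B w := by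
  obtain ⟨n, hn⟩ := ENat.ne_top_iff_exists.1 h
  obtain ⟨h1, h2⟩ := (analyticOrderAt_eq_nat_iff_iteratedDeriv_eq_zero hB.deriv).1 hn.symm
  rw [analyticOrderNatAt, ← hn, ENat.toNat_natCast, critOrder]
  simp only [iteratedDeriv_succ']
  refine le_antisymm (le_csInf ⟨n, h2⟩ fun m hm => ?_) (Nat.sInf_le h2)
  exact not_lt.1 fun hlt => hm (h1 m hlt)

/-- Holomorphic maps of the disk to itself which are nowhere locally constant and have
Property `𝔅`. -/
structure IsTrapping (B : ℂ → ℂ) : Prop where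
  differentiableOn : DifferentiableOn ℂ B disk
  norm_lt_one : ∀ z ∈ disk, ‖B z‖ < 1
  order_ne_top : ∀ z ∈ disk, analyticOrderAt (fun y => B y - B z) z ≠ ⊤
  propertyB : PropertyB B

/-- The zeros of `B` in the disk. -/
abbrev ZeroSet (B : ℂ → ℂ) : Type := {z : ℂ // z ∈ disk ∧ B z = 0}

namespace ZeroSet

variable {B : ℂ → ℂ} {t : ℝ} (z : ZeroSet B) (ht : 0 < t)
include ht

theorem norm_lt : ‖B z‖ < theta t := by
  rw [z.2.2, norm_zero]
  exact theta_pos ht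

theorem mem_levelComponent : (z : ℂ) ∈ levelComponent B disk (theta t) z :=
  mem_levelComponent_self z.2.1 (z.norm_lt ht)

/-- A zero as a point of the level set at a positive time. -/
def toSublevel : sublevel B t :=
  ⟨z, z.2.1, z.norm_lt ht⟩

end ZeroSet

open Classical in
/-- The class of a zero in the zeroth homology of the level set at time `t` (with value `0` when
`t ≤ 0`, where the level set is empty). -/
noncomputable def zeroClass (F : Type*) [Field F] (B : ℂ → ℂ) (t : ℝ) (z : ZeroSet B) :
    (sublevelModule F B).V t :=
  if ht : 0 < t then pointClass F (TopCat.of (sublevel B t)) (z.toSublevel ht) else 0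

theorem zeroClass_of_pos {F : Type*} [Field F] {B : ℂ → ℂ} {t : ℝ} (ht : 0 < t) (z : ZeroSet B) :
    zeroClass F B t z = pointClass F (TopCat.of (sublevel B t)) (z.toSublevel ht) :=
  dif_pos ht

namespace IsTrapping

variable {B : ℂ → ℂ} (hB : IsTrapping B) {t : ℝ} {z w : ℂ}
include hB

theorem isOpen_sublevel (t : ℝ) : IsOpen (sublevel B t) :=
  isOpen_inter_sublevel isOpen_disk hB.differentiableOn.continuousOn (theta t)

theorem closure_subset (hz : z ∈ disk) (hzt : ‖B z‖ < theta t) :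
    closure (levelComponent B disk (theta t) z) ⊆ disk :=
  hB.propertyB (theta t) ⟨(norm_nonneg _).trans_lt hzt, theta_lt_one t⟩ z ⟨hz, hzt⟩

theorem exists_zero_mem (hz : z ∈ disk) (hzt : ‖B z‖ < theta t) :
    ∃ y : ZeroSet B, z ∈ levelComponent B disk (theta t) y ∧
      (y : ℂ) ∈ levelComponent B disk (theta t) z := by
  have hP : IsProperLevel B (levelComponent B disk (theta t) z) (theta t) :=
    isProperLevel_of_closure_subset isOpen_disk Metric.isBounded_ball hB.differentiableOn
      hB.order_ne_top (hB.closure_subset hz hzt)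
  have hz' := mem_levelComponent_self hz hzt
  obtain ⟨y, hy, hy0⟩ := hP.exists_zero_mem le_rfl hz' hzt
  rw [levelComponent_levelComponent hz'] at hy
  exact ⟨⟨y, (levelComponent_subset hy).1, hy0⟩, levelComponent_eq hy ▸ hz', hy⟩

theorem riemannHurwitz (hz : z ∈ disk) (hzt : ‖B z‖ < theta t) :
    RiemannHurwitz B (levelComponent B disk (theta t) z) :=
  riemannHurwitz_levelComponent hB.differentiableOn hB.order_ne_top hz hzt
    (hB.closure_subset hz hzt)

theorem critOrder_eq (hw : w ∈ disk) : analyticOrderNatAt (deriv B) w = critOrder B w := by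
  have h := hB.differentiableOn.analyticAt (isOpen_disk.mem_nhds hw)
  exact analyticOrderNatAt_deriv_eq_critOrder h
    (analyticOrderAt_deriv_ne_top h (hB.order_ne_top w hw))

/-- The merge tree of the level sets: two zeros are related at time `t` if they lie in the same
component of the level set at time `t`. -/
def mergeTree : MergeTree (ZeroSet B) where
  rel t x y := (y : ℂ) ∈ levelComponent B disk (theta t) x
  equiv {t} ht :=
    ⟨fun x => x.mem_levelComponent ht, fun {x y} h => levelComponent_eq h ▸ x.mem_levelComponent ht,
      fun {x y z} h1 h2 => by rwa [levelComponent_eq h1]⟩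
  mono _ h _ _ hxy := levelComponent_mono (theta_mono h) hxy
  left {t} _ x y h := by
    obtain ⟨r, hr, hy⟩ := exists_lt_mem_levelComponent isOpen_disk
      hB.differentiableOn.continuousOn h
    have hr0 : 0 < r := (norm_nonneg _).trans_lt (levelComponent_subset hy).2
    obtain ⟨s, hs1, hs2⟩ := exists_between
      ((lt_theta_iff (hr.trans (theta_lt_one t)) hr0.le).1 hr)
    have hrs := (lt_theta_iff (hr.trans (theta_lt_one t)) hr0.le).2 hs1
    exact ⟨s, pos_of_theta_pos (hr0.trans hrs), hs2, levelComponent_mono hrs.le hy⟩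
  total x y := by
    have hseg : segment ℝ (x : ℂ) y ⊆ disk := (convex_ball _ _).segment_subset x.2.1 y.2.1
    have hcpt : IsCompact (segment ℝ (x : ℂ) y) := by
      rw [segment_eq_image_lineMap]
      exact isCompact_Icc.image (by fun_prop)
    obtain ⟨p, hp, hmax⟩ := hcpt.exists_isMaxOn ⟨x, left_mem_segment ℝ _ _⟩
      (hB.differentiableOn.continuousOn.mono hseg).norm
    have hp1 := hB.norm_lt_one p (hseg hp)
    obtain ⟨t, ht⟩ := exists_gt (Real.log ((1 + ‖B p‖) / (1 - ‖B p‖)))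
    have ht' := (lt_theta_iff hp1 (norm_nonneg _)).2 ht
    refine ⟨t, pos_of_theta_pos ((norm_nonneg _).trans_lt ht'), ?_⟩
    exact (convex_segment _ _).isPreconnected.subset_connectedComponentIn
      (left_mem_segment ℝ _ _) (fun q hq => show q ∈ {y ∈ disk | ‖B y‖ < theta t} from
        ⟨hseg hq, (hmax hq).trans_lt ht'⟩)
      (right_mem_segment ℝ _ _)

theorem isClusterModule (F : Type*) [Field F] :
    (sublevelModule F B).IsClusterModule hB.mergeTree (zeroClass F B) where
  subsingleton t ht := by
    have := isEmpty_sublevel B ht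
    exact subsingleton_H0_of_isEmpty F (TopCat.of (sublevel B t))
  map_class {s t} h hs z := by
    rw [zeroClass_of_pos hs, zeroClass_of_pos (hs.trans_le h)]
    exact map_pointClass F (sublevelInclusion B h) _
  class_eq {t} ht x y h := by
    rw [zeroClass_of_pos ht, zeroClass_of_pos ht]
    exact pointClass_eq_of_joined (joined_of_mem_connectedComponentIn (hB.isOpen_sublevel t) h)
  span_class {t} ht := by
    rw [eq_top_iff]
    refine (span_pointClass (F := F) (TopCat.of (sublevel B t))).ge.trans
      (Submodule.span_mono ?_)
    rintro _ ⟨x, rfl⟩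
    obtain ⟨y, hy, -⟩ := hB.exists_zero_mem x.2.1 x.2.2
    exact ⟨y, (zeroClass_of_pos ht y).trans (pointClass_eq_of_joined
      (joined_of_mem_connectedComponentIn (hB.isOpen_sublevel t) hy))⟩
  exists_functional {t} ht φ hφ := by
    choose ζ h1 h2 using fun x : sublevel B t => hB.exists_zero_mem x.2.1 x.2.2
    obtain ⟨l, hl⟩ := exists_functional_of_joined (TopCat.of (sublevel B t)) (fun x => φ (ζ x)) (by
      intro x y hxy
      refine hφ _ _ ?_
      have h3 := mem_connectedComponentIn_of_joined hxy
      have h4 := levelComponent_eq (f := B) (A := disk) (t := theta t) h3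
      have h5 := (levelComponent_eq (h1 x)).trans h4
      change (ζ y : ℂ) ∈ levelComponent B disk (theta t) (ζ x)
      exact h5 ▸ h2 y)
    refine ⟨l, fun z => (congrArg l (zeroClass_of_pos ht z)).trans ?_⟩
    exact (hl _).trans (hφ _ _ (h1 (z.toSublevel ht)))

theorem finite_rel (ht : 0 < t) (z : ZeroSet B) : {y | hB.mergeTree.rel t z y}.Finite := by
  obtain ⟨Z, -, hZ, -⟩ := hB.riemannHurwitz z.2.1 (z.norm_lt ht)
  refine Set.Finite.of_finite_image (f := Subtype.val) (Z.finite_toSet.subset ?_)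
    Subtype.val_injective.injOn
  rintro _ ⟨y, hy, rfl⟩
  exact (hZ y).2 ⟨hy, y.2.2⟩

/-- The critical points, counted with their orders, mark the components of the level sets in
accordance with the Riemann–Hurwitz formula. -/
noncomputable def markedTree :
    MarkedTree hB.mergeTree (Σ w : critPoints B, Fin (critOrder B w)) := by
  have key : ∀ {t}, 0 < t → ∀ z : ZeroSet B,
      ∃ S : Set (Σ w : critPoints B, Fin (critOrder B w)),
        S = {p | (p.1 : ℂ) ∈ levelComponent B disk (theta t) z} ∧ S.Finite ∧
          {y | hB.mergeTree.rel t z y}.ncard = S.ncard + 1 := by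
    intro t ht z
    refine ⟨_, rfl, ?_⟩
    obtain ⟨Z, W, hZ, hW, hcard⟩ := hB.riemannHurwitz z.2.1 (z.norm_lt ht)
    have hWd : ∀ w ∈ W, w ∈ critPoints B := fun w hw =>
      ⟨(levelComponent_subset ((hW w).1 hw).1).1, ((hW w).1 hw).2.2, ((hW w).1 hw).2.1⟩
    have e : {p : Σ w : critPoints B, Fin (critOrder B w) |
        (p.1 : ℂ) ∈ levelComponent B disk (theta t) z} ≃ Σ w : W, Fin (critOrder B w) :=
      { toFun := fun p => ⟨⟨p.1.1, (hW _).2 ⟨p.2, p.1.1.2.2.2, p.1.1.2.2.1⟩⟩, p.1.2⟩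
        invFun := fun p => ⟨⟨⟨p.1, hWd _ p.1.2⟩, p.2⟩, ((hW _).1 p.1.2).1⟩
        left_inv := fun _ => rfl
        right_inv := fun _ => rfl }
    have hfin := Finite.of_equiv _ e.symm
    refine ⟨Set.toFinite _, ?_⟩
    have h1 : {y | hB.mergeTree.rel t z y}.ncard = Z.card := by
      rw [← Set.ncard_image_of_injective _ Subtype.val_injective, ← Set.ncard_coe_finset]
      congr 1
      ext y
      constructor
      · rintro ⟨y, hy, rfl⟩
        exact (hZ y).2 ⟨hy, y.2.2⟩
      · intro hy
        obtain ⟨h2, h3⟩ := (hZ y).1 hy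
        exact ⟨⟨y, (levelComponent_subset h2).1, h3⟩, h2, rfl⟩
    have h2 : {p : Σ w : critPoints B, Fin (critOrder B w) |
        (p.1 : ℂ) ∈ levelComponent B disk (theta t) z}.ncard = ∑ w ∈ W, critOrder B w := by
      rw [← Nat.card_coe_set_eq, Nat.card_congr e, Nat.card_eq_fintype_card, Fintype.card_sigma]
      simp only [Fintype.card_fin]
      exact Finset.sum_coe_sort W fun w => critOrder B w
    rw [h1, h2, hcard, add_comm]
    congr 1
    exact Finset.sum_congr rfl fun w hw => hB.critOrder_eq (hWd w hw).1
  exact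
  { mem := fun t p z => (p.1 : ℂ) ∈ levelComponent B disk (theta t) z
    time := fun p => critTime B p.1
    time_pos := fun p => by
      have h0 := norm_pos_iff.2 p.1.2.2.2
      have h1 := hB.norm_lt_one _ p.1.2.1
      refine Real.log_pos ?_
      rw [lt_div_iff₀ (by linarith)]
      linarith
    time_lt := fun {t p z} _ h =>
      (lt_theta_iff (hB.norm_lt_one _ p.1.2.1) (norm_nonneg _)).1 (levelComponent_subset h).2
    exists_mem := fun {t p} _ h => by
      obtain ⟨y, hy, -⟩ := hB.exists_zero_mem p.1.2.1
        ((lt_theta_iff (hB.norm_lt_one _ p.1.2.1) (norm_nonneg _)).2 h)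
      exact ⟨y, hy⟩
    mem_of_rel := fun {t p x y} _ h1 h2 => levelComponent_eq h2 ▸ h1
    rel_of_mem := fun {t p x y} ht h1 h2 => by
      change (y : ℂ) ∈ levelComponent B disk (theta t) x
      rw [levelComponent_eq h1, ← levelComponent_eq h2]
      exact y.mem_levelComponent ht
    mono := fun _ h hp => levelComponent_mono (theta_mono h) hp
    finite_rel := fun ht z => hB.finite_rel ht z
    finite_mem := fun ht z => by
      obtain ⟨S, hS, hfin, -⟩ := key ht z
      exact hS ▸ hfin
    card_eq := fun ht z => by
      obtain ⟨S, hS, -, hcard⟩ := key ht z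
      exact hS ▸ hcard }

theorem isomorphic (F : Type*) [Field F] :
    (sublevelModule F B).Isomorphic ((PersistenceModule.intervalIoi F 0).prod
      (PersistenceModule.sumIoc F 0
        fun p : Σ w : critPoints B, Fin (critOrder B w) => critTime B p.1)) := by
  have h0 : (0 : ℂ) ∈ disk := by simp [disk]
  obtain ⟨t, ht⟩ := exists_gt (Real.log ((1 + ‖B 0‖) / (1 - ‖B 0‖)))
  obtain ⟨z, -, -⟩ := hB.exists_zero_mem h0
    ((lt_theta_iff (hB.norm_lt_one 0 h0) (norm_nonneg _)).2 ht)
  have : Nonempty (ZeroSet B) := ⟨z⟩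
  have : Countable (ZeroSet B) := by
    rw [← Set.countable_univ_iff]
    refine (Set.countable_iUnion fun n : ℕ =>
      (hB.finite_rel (t := n + 1) (by positivity) z).countable).mono fun y _ => ?_
    obtain ⟨u, hu, hxu⟩ := hB.mergeTree.total z y
    obtain ⟨n, hn⟩ := exists_nat_ge u
    exact Set.mem_iUnion.2 ⟨n, hB.mergeTree.mono hu (by linarith) hxu⟩
  obtain ⟨rank, hr⟩ := exists_injective_nat (ZeroSet B)
  have hmin : ∀ y, rank (Function.argmin rank) ≤ rank y := fun y => Function.argmin_le rank y
  obtain ⟨e, he⟩ := hB.markedTree.exists_equiv hr hmin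
  exact (hB.isClusterModule F).isomorphic hr hmin e _ he

end IsTrapping

open ComplexConjugate

/-! ### Blaschke products -/

/-- The Blaschke factor with zero at `α`, normalized to be positive at the origin. -/
noncomputable def blaschkeFactor (α z : ℂ) : ℂ :=
  (‖α‖ : ℂ) / α * ((α - z) / (1 - conj α * z))

theorem one_sub_norm_mul_le (α z : ℂ) : 1 - ‖α‖ * ‖z‖ ≤ ‖1 - conj α * z‖ := by
  have h := norm_sub_norm_le (1 : ℂ) (conj α * z)
  rwa [norm_one, norm_mul, Complex.norm_conj] at h

theorem one_sub_conj_mul_ne_zero {α z : ℂ} (hα : ‖α‖ < 1) (hz : ‖z‖ < 1) :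
    1 - conj α * z ≠ 0 := by
  have h := one_sub_norm_mul_le α z
  rw [← norm_pos_iff]
  nlinarith [norm_nonneg α, norm_nonneg z]

theorem norm_blaschkeFactor {α : ℂ} (hα : α ≠ 0) (z : ℂ) :
    ‖blaschkeFactor α z‖ = ‖α - z‖ / ‖1 - conj α * z‖ := by
  have h : ‖(‖α‖ : ℂ) / α‖ = 1 := by
    rw [norm_div, Complex.norm_real, norm_norm, div_self (norm_ne_zero_iff.2 hα)]
  rw [blaschkeFactor, norm_mul, h, one_mul, norm_div]

theorem norm_blaschkeFactor_comm {α z : ℂ} (hα : α ≠ 0) (hz : z ≠ 0) :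
    ‖blaschkeFactor α z‖ = ‖blaschkeFactor z α‖ := by
  rw [norm_blaschkeFactor hα, norm_blaschkeFactor hz, norm_sub_rev,
    ← Complex.norm_conj (1 - conj α * z)]
  simp [mul_comm]

theorem norm_blaschkeFactor_le_one {α z : ℂ} (hα : α ∈ disk \ {0}) (hz : z ∈ disk) :
    ‖blaschkeFactor α z‖ ≤ 1 := by
  have h1 : ‖α‖ < 1 := by simpa [disk] using hα.1
  have h2 : ‖z‖ < 1 := by simpa [disk] using hz
  rw [norm_blaschkeFactor hα.2]
  refine div_le_one_of_le₀ (le_of_sq_le_sq ?_ (norm_nonneg _)) (norm_nonneg _)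
  have h3 : ‖1 - conj α * z‖ ^ 2 - ‖α - z‖ ^ 2 = (1 - ‖α‖ ^ 2) * (1 - ‖z‖ ^ 2) := by
    simp only [← Complex.normSq_eq_norm_sq, Complex.normSq_apply, Complex.sub_re, Complex.sub_im,
      Complex.mul_re, Complex.mul_im, Complex.conj_re, Complex.conj_im, Complex.one_re,
      Complex.one_im]
    ring
  have h4 : 0 ≤ (1 - ‖α‖ ^ 2) * (1 - ‖z‖ ^ 2) :=
    mul_nonneg (by nlinarith [norm_nonneg α]) (by nlinarith [norm_nonneg z])
  linarith

theorem norm_blaschkeFactor_sub_one_le {α z : ℂ} (hα : α ∈ disk \ {0}) (hz : z ∈ disk) :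
    ‖blaschkeFactor α z - 1‖ ≤ 2 / (1 - ‖z‖) * (1 - ‖α‖) := by
  have h1 : ‖α‖ < 1 := by simpa [disk] using hα.1
  have h2 : ‖z‖ < 1 := by simpa [disk] using hz
  have h0 : α ≠ 0 := hα.2
  have hp : 0 < ‖α‖ := norm_pos_iff.2 h0
  have hne := one_sub_conj_mul_ne_zero h1 h2
  have hnorm : (‖α‖ : ℂ) * ‖α‖ = α * conj α := by
    rw [Complex.mul_conj, Complex.normSq_eq_norm_sq]
    push_cast
    ring
  have h3 : blaschkeFactor α z - 1 =
      -((1 - ‖α‖ : ℂ) * (α + ‖α‖ * z)) / (α * (1 - conj α * z)) := by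
    rw [blaschkeFactor, div_mul_div_comm, div_sub_one (mul_ne_zero h0 hne)]
    congr 1
    linear_combination (-z) * hnorm
  have h4 : ‖(1 - ‖α‖ : ℂ)‖ = 1 - ‖α‖ := by
    rw [← Complex.ofReal_one, ← Complex.ofReal_sub, Complex.norm_real, Real.norm_of_nonneg]
    linarith
  have h5 : ‖α + ‖α‖ * z‖ ≤ ‖α‖ * 2 := by
    refine (norm_add_le _ _).trans ?_
    rw [norm_mul, Complex.norm_real, norm_norm]
    nlinarith
  have h6 : 1 - ‖z‖ ≤ ‖1 - conj α * z‖ :=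
    le_trans (by nlinarith [norm_nonneg z]) (one_sub_norm_mul_le α z)
  rw [h3, norm_div, norm_neg, norm_mul, norm_mul, h4, div_mul_eq_mul_div]
  rw [div_le_div_iff₀ (mul_pos hp (norm_pos_iff.2 hne)) (by linarith)]
  calc (1 - ‖α‖) * ‖α + ‖α‖ * z‖ * (1 - ‖z‖)
      ≤ (1 - ‖α‖) * (‖α‖ * 2) * ‖1 - conj α * z‖ := by
        gcongr
    _ = 2 * (1 - ‖α‖) * (‖α‖ * ‖1 - conj α * z‖) := by ring

/-- The symmetry of the pseudohyperbolic distance turns the bound for `α` near the circle into one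
for `z` near the circle. -/
theorem one_sub_le_norm_blaschkeFactor {α z : ℂ} (hα : α ∈ disk \ {0}) (hz : z ∈ disk \ {0}) :
    1 - 2 / (1 - ‖z‖) * (1 - ‖α‖) ≤ ‖blaschkeFactor α z‖ ∧
      1 - 2 / (1 - ‖α‖) * (1 - ‖z‖) ≤ ‖blaschkeFactor α z‖ := by
  have key : ∀ {α z : ℂ}, α ∈ disk \ {0} → z ∈ disk →
      1 - 2 / (1 - ‖z‖) * (1 - ‖α‖) ≤ ‖blaschkeFactor α z‖ := by
    intro α z hα hz
    have h1 := norm_blaschkeFactor_sub_one_le hα hz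
    have h2 := norm_sub_norm_le (1 : ℂ) (blaschkeFactor α z)
    rw [norm_one, norm_sub_rev] at h2
    linarith
  exact ⟨key hα hz.1, norm_blaschkeFactor_comm hα.2 hz.2 ▸ key hz hα.1⟩

theorem differentiableOn_blaschkeFactor {α : ℂ} (hα : α ∈ disk) :
    DifferentiableOn ℂ (blaschkeFactor α) disk := by
  have h1 : ‖α‖ < 1 := by simpa [disk] using hα
  unfold blaschkeFactor
  refine DifferentiableOn.const_mul (DifferentiableOn.div (by fun_prop) (by fun_prop) ?_) _
  intro z hz
  exact one_sub_conj_mul_ne_zero h1 (by simpa [disk] using hz)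

theorem hasProdLocallyUniformlyOn_blaschkeFactor {N : Type*} {α : N → ℂ}
    (hα : ∀ n, α n ∈ disk \ {0}) (hs : Summable fun n => 1 - ‖α n‖) :
    HasProdLocallyUniformlyOn (fun n => blaschkeFactor (α n))
      (fun z => ∏' n, blaschkeFactor (α n) z) disk := by
  refine hasProdLocallyUniformlyOn_of_forall_compact isOpen_disk fun K hK hKc => ?_
  obtain ⟨r, hr, hKr⟩ : ∃ r < 1, ∀ z ∈ K, ‖z‖ ≤ r := by
    rcases K.eq_empty_or_nonempty with rfl | hne
    · exact ⟨0, one_pos, by simp⟩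
    · obtain ⟨p, hp, hmax⟩ := hKc.exists_isMaxOn hne continuous_norm.continuousOn
      exact ⟨‖p‖, by simpa [disk] using hK hp, fun z hz => hmax hz⟩
  have h := (hs.mul_left (2 / (1 - r))).hasProdUniformlyOn_one_add
    (f := fun n z => blaschkeFactor (α n) z - 1) hKc
    (Eventually.of_forall fun n z hz => by
      refine (norm_blaschkeFactor_sub_one_le (hα n) (hK hz)).trans ?_
      have h1 : ‖α n‖ < 1 := by simpa [disk] using (hα n).1
      have h2 := hKr z hz
      gcongr)
    (fun n => ((differentiableOn_blaschkeFactor (hα n).1).continuousOn.mono hK).sub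
      continuousOn_const)
  simpa using h

namespace IsBlaschkeProduct

variable {B : ℂ → ℂ} (hB : IsBlaschkeProduct B)
include hB

theorem differentiableOn : DifferentiableOn ℂ B disk := by
  obtain ⟨c, m, N, α, -, hα, hs, hp⟩ := hB
  have h := hasProdLocallyUniformlyOn_blaschkeFactor hα hs
  have hd : DifferentiableOn ℂ (fun z => ∏' n, blaschkeFactor (α n) z) disk :=
    TendstoLocallyUniformlyOn.differentiableOn h (Eventually.of_forall fun s =>
      DifferentiableOn.fun_finsetProd fun n _ => differentiableOn_blaschkeFactor (hα n).1)
      isOpen_disk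
  have hd2 : DifferentiableOn ℂ (fun z => c * z ^ m * ∏' n, blaschkeFactor (α n) z) disk :=
    DifferentiableOn.mul (by fun_prop) hd
  refine hd2.congr fun z hz => ?_
  obtain ⟨p, hp1, hp2⟩ := hp z hz
  rw [hp2]
  exact congrArg _ hp1.tprod_eq.symm

theorem norm_le_one {z : ℂ} (hz : z ∈ disk) : ‖B z‖ ≤ 1 := by
  obtain ⟨c, m, N, α, hc, hα, -, hp⟩ := hB
  obtain ⟨p, hp1, hp2⟩ := hp z hz
  have hz1 : ‖z‖ < 1 := by simpa [disk] using hz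
  have h1 : ‖p‖ ≤ 1 := le_of_tendsto hp1.norm (Eventually.of_forall fun s =>
    Finset.prod_le_one (fun _ _ => norm_nonneg _) fun n _ =>
      norm_blaschkeFactor_le_one (hα n) hz)
  rw [hp2, norm_mul, norm_mul, hc, one_mul, norm_pow]
  exact mul_le_one₀ (pow_le_one₀ (norm_nonneg _) hz1.le) (norm_nonneg _) h1

theorem isTrapping (hnc : ∃ z ∈ disk, ∃ w ∈ disk, B z ≠ B w) (hPB : PropertyB B) :
    IsTrapping B where
  differentiableOn := hB.differentiableOn
  propertyB := hPB
  norm_lt_one z hz := by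
    refine lt_of_le_of_ne (hB.norm_le_one hz) fun h => ?_
    have h1 := Complex.eqOn_of_isPreconnected_of_isMaxOn_norm (convex_ball _ _).isPreconnected
      isOpen_disk hB.differentiableOn hz fun w hw => (hB.norm_le_one hw).trans_eq h.symm
    obtain ⟨x, hx, y, hy, hne⟩ := hnc
    exact hne ((h1 hx).trans (h1 hy).symm)
  order_ne_top z hz h := by
    have h1 : B =ᶠ[𝓝 z] fun _ => B z := by
      filter_upwards [analyticOrderAt_eq_top.1 h] with y hy
      exact sub_eq_zero.1 hy
    have h2 := (hB.differentiableOn.analyticOnNhd isOpen_disk).eqOn_of_preconnected_of_eventuallyEq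
      analyticOnNhd_const (convex_ball _ _).isPreconnected hz h1
    obtain ⟨x, hx, y, hy, hne⟩ := hnc
    exact hne ((h2 hx).trans (h2 hy).symm)

end IsBlaschkeProduct

/-! ### A Blaschke product with infinitely many components in its level sets -/

theorem PersistenceModule.IsClusterModule.not_finiteDimensional {F : Type*} [Field F]
    {M : PersistenceModule F} {Z : Type*} [Infinite Z] {T : MergeTree Z} {c : ∀ t, Z → M.V t}
    (hM : M.IsClusterModule T c) {t : ℝ} (ht : 0 < t) (hfin : ∀ z, {y | T.rel t z y}.Finite) :
    ¬ FiniteDimensional F (M.V t) := by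
  classical
  intro hfd
  let S : Setoid Z := ⟨T.rel t, T.equiv ht⟩
  have hl : ∀ q : Quotient S, ∃ l : M.V t →ₗ[F] F, ∀ z, l (c t z) = if ⟦z⟧ = q then 1 else 0 :=
    fun q => hM.exists_functional ht (fun z => if ⟦z⟧ = q then 1 else 0) fun x y hxy => by
      rw [show (⟦x⟧ : Quotient S) = ⟦y⟧ from Quotient.sound hxy]
  choose l hl using hl
  have hind : LinearIndependent F fun q : Quotient S => c t q.out :=
    LinearIndependent.of_pairwise_dual_eq_zero_one _ l
      (fun p q hpq => (hl p _).trans (by rw [Quotient.out_eq, if_neg hpq.symm]))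
      (fun q => by rw [hl, Quotient.out_eq, if_pos rfl])
  have hQ : Finite (Quotient S) := hind.finite_of_isNoetherian
  refine Set.infinite_univ (α := Z) (Set.Finite.of_finite_fibers (Quotient.mk S)
    (Set.toFinite _) fun q _ => ?_)
  refine (hfin q.out).subset fun z hz => ?_
  exact (T.equiv ht).symm (Quotient.exact ((hz.2 : (⟦z⟧ : Quotient S) = q).trans q.out_eq.symm))

theorem one_sub_sum_le_prod {ι : Type*} {x b : ι → ℝ} (h0 : ∀ i, 0 ≤ b i) (h1 : ∀ i, b i ≤ 1)
    (h : ∀ i, 1 - x i ≤ b i) (s : Finset ι) : 1 - ∑ i ∈ s, x i ≤ ∏ i ∈ s, b i := by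
  classical
  induction s using Finset.induction_on with
  | empty => simp
  | insert a s ha ih =>
    rw [Finset.sum_insert ha, Finset.prod_insert ha]
    have h2 : ∏ i ∈ s, b i ≤ 1 := Finset.prod_le_one (fun i _ => h0 i) fun i _ => h1 i
    nlinarith [h a, h1 a]

/-- The distances `εₖ` of the zeros of `sparseBlaschke` from the unit circle. -/
noncomputable def sparseDist (k : ℕ) : ℝ := (1 / 2) ^ (2 * k ^ 2 + 2 * k + 1)

/-- The distances `ηₙ` from the unit circle of circles on which the modulus of `sparseBlaschke` is
close to `1`. The exponent differs from that of `εₖ` by at least `n + k + 1`, for all `k`. -/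
noncomputable def gapDist (n : ℕ) : ℝ := (1 / 2) ^ (2 * (n + 1) ^ 2)

theorem sparseDist_pos (k : ℕ) : 0 < sparseDist k := by unfold sparseDist; positivity

theorem gapDist_pos (n : ℕ) : 0 < gapDist n := by unfold gapDist; positivity

theorem sparseDist_le (k : ℕ) : sparseDist k ≤ (1 / 2) ^ (k + 1) :=
  pow_le_pow_of_le_one (by norm_num) (by norm_num) (by nlinarith)

theorem gapDist_le (n : ℕ) : gapDist n ≤ (1 / 2) ^ (n + 1) :=
  pow_le_pow_of_le_one (by norm_num) (by norm_num) (by nlinarith)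

theorem half_pow_succ_lt_one (n : ℕ) : (1 / 2 : ℝ) ^ (n + 1) < 1 :=
  pow_lt_one₀ (by norm_num) (by norm_num) (by omega)

theorem half_pow_ratio {a e m : ℕ} (h : e + m + 1 ≤ a) :
    2 / (1 / 2 : ℝ) ^ e * (1 / 2) ^ a ≤ (1 / 2) ^ m := by
  rw [div_mul_eq_mul_div, div_le_iff₀ (by positivity), ← pow_add]
  calc 2 * (1 / 2 : ℝ) ^ a ≤ 2 * (1 / 2) ^ (e + m + 1) := by
        gcongr 2 * ?_
        exact pow_le_pow_of_le_one (by norm_num) (by norm_num) h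
    _ = (1 / 2) ^ (m + e) := by
        rw [pow_succ, add_comm m e]
        ring

/-- The points `1 - εₖ`. -/
noncomputable def sparseZero (k : ℕ) : ℂ := ((1 - sparseDist k : ℝ) : ℂ)

theorem sparseDist_lt_one (k : ℕ) : sparseDist k < 1 :=
  (sparseDist_le k).trans_lt (half_pow_succ_lt_one k)

theorem norm_sparseZero (k : ℕ) : ‖sparseZero k‖ = 1 - sparseDist k := by
  rw [sparseZero, Complex.norm_real, Real.norm_of_nonneg]
  linarith [sparseDist_lt_one k]

theorem sparseZero_mem (k : ℕ) : sparseZero k ∈ disk \ {0} := by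
  have h := sparseDist_lt_one k
  constructor
  · simp only [disk, mem_ball_zero_iff, norm_sparseZero]
    linarith [sparseDist_pos k]
  · rw [Set.mem_singleton_iff, ← norm_eq_zero, norm_sparseZero]
    linarith

theorem sparseZero_injective : Function.Injective sparseZero := by
  intro j k h
  have h1 : sparseDist j = sparseDist k := by
    have := Complex.ofReal_injective h
    linarith
  have h2 := pow_right_injective₀ (by norm_num : (0 : ℝ) < 1 / 2) (by norm_num) h1
  rcases lt_trichotomy j k with hjk | hjk | hjk
  · nlinarith
  · exact hjk
  · nlinarith

/-- The Blaschke product with the simple zeros `1 - εₖ`, which approach the circle so fast that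
they are separated by circles on which the modulus is close to `1`. -/
noncomputable def sparseBlaschke (z : ℂ) : ℂ :=
  ∏' k : (Set.univ : Set ℕ), blaschkeFactor (sparseZero k) z

theorem summable_sparse : Summable fun k : (Set.univ : Set ℕ) => 1 - ‖sparseZero k‖ := by
  have h : Summable fun k : ℕ => 1 - ‖sparseZero k‖ := by
    refine Summable.of_nonneg_of_le (fun k => ?_) (fun k => ?_)
      ((summable_nat_add_iff 1).2 summable_geometric_two)
    · rw [norm_sparseZero]
      linarith [sparseDist_pos k]
    · rw [norm_sparseZero]
      linarith [sparseDist_le k]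
  exact h.subtype Set.univ

theorem hasProd_sparseBlaschke {z : ℂ} (hz : z ∈ disk) :
    HasProd (fun k : (Set.univ : Set ℕ) => blaschkeFactor (sparseZero k) z) (sparseBlaschke z) :=
  (hasProdLocallyUniformlyOn_blaschkeFactor (α := fun k : (Set.univ : Set ℕ) => sparseZero k)
    (fun k => sparseZero_mem k) summable_sparse).hasProd hz

theorem isBlaschkeProduct_sparseBlaschke : IsBlaschkeProduct sparseBlaschke :=
  ⟨1, 0, Set.univ, fun k => sparseZero k, norm_one, fun k => sparseZero_mem k, summable_sparse,
    fun z hz => ⟨sparseBlaschke z, hasProd_sparseBlaschke hz, by simp⟩⟩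

theorem sparseBlaschke_sparseZero (k : ℕ) : sparseBlaschke (sparseZero k) = 0 := by
  refine (hasProd_sparseBlaschke (sparseZero_mem k).1).unique
    (hasProd_zero_of_exists_eq_zero ⟨⟨k, trivial⟩, ?_⟩)
  simp [blaschkeFactor]

/-- On the circle of radius `1 - ηₙ`, the `k`-th factor is at least `1 - 2 ^ (-(n + k))`, since
`εₖ` is much smaller than `ηₙ` for `k > n` and much larger for `k ≤ n`. -/
theorem le_norm_sparseBlaschke {n : ℕ} {z : ℂ} (hz : ‖z‖ = 1 - gapDist n) :
    1 - 2 * (1 / 2 : ℝ) ^ n ≤ ‖sparseBlaschke z‖ := by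
  have hg := gapDist_pos n
  have hg1 : gapDist n < 1 := (gapDist_le n).trans_lt (half_pow_succ_lt_one n)
  have hzd : z ∈ disk \ {0} := by
    constructor
    · simp only [disk, mem_ball_zero_iff, hz]
      linarith
    · rw [Set.mem_singleton_iff, ← norm_eq_zero, hz]
      linarith
  have hfac : ∀ k : (Set.univ : Set ℕ),
      1 - (1 / 2 : ℝ) ^ (n + (k : ℕ)) ≤ ‖blaschkeFactor (sparseZero k) z‖ := by
    rintro ⟨k, -⟩
    obtain ⟨h1, h2⟩ := one_sub_le_norm_blaschkeFactor (sparseZero_mem k) hzd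
    rw [norm_sparseZero, hz, sub_sub_cancel, sub_sub_cancel] at h1 h2
    rcases lt_or_ge n k with hk | hk
    · refine le_trans (sub_le_sub_left (half_pow_ratio (m := n + k) ?_) 1) h1
      obtain ⟨j, rfl⟩ := Nat.exists_eq_add_of_lt hk
      ring_nf
      nlinarith
    · refine le_trans (sub_le_sub_left (half_pow_ratio (m := n + k) ?_) 1) h2
      obtain ⟨j, rfl⟩ := Nat.exists_eq_add_of_le hk
      ring_nf
      nlinarith
  have hsum : ∀ s : Finset (Set.univ : Set ℕ),
      ∑ k ∈ s, (1 / 2 : ℝ) ^ (n + (k : ℕ)) ≤ 2 * (1 / 2) ^ n := by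
    intro s
    have h1 : HasSum (fun k : ℕ => (1 / 2 : ℝ) ^ (n + k)) (2 * (1 / 2) ^ n) := by
      simp only [pow_add]
      rw [mul_comm 2]
      exact hasSum_geometric_two.mul_left _
    have h2 := sum_le_hasSum (s.map (Function.Embedding.subtype _)) (fun k _ => by positivity) h1
    rwa [Finset.sum_map] at h2
  refine ge_of_tendsto (hasProd_sparseBlaschke hzd.1).norm
    (Eventually.of_forall fun s => ?_)
  refine le_trans ?_ (one_sub_sum_le_prod (fun _ => norm_nonneg _)
    (fun k : (Set.univ : Set ℕ) => norm_blaschkeFactor_le_one (sparseZero_mem k) hzd.1) hfac s)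
  linarith [hsum s]

theorem tendsto_gapDist : Tendsto gapDist atTop (𝓝 0) :=
  squeeze_zero (fun n => (gapDist_pos n).le) gapDist_le
    ((tendsto_add_atTop_iff_nat 1).2
      (tendsto_pow_atTop_nhds_zero_of_lt_one (by norm_num) (by norm_num)))

theorem tendsto_one_sub_two_mul : Tendsto (fun n : ℕ => 1 - 2 * (1 / 2 : ℝ) ^ n) atTop (𝓝 1) := by
  have h : Tendsto (fun n : ℕ => (1 / 2 : ℝ) ^ n) atTop (𝓝 0) :=
    tendsto_pow_atTop_nhds_zero_of_lt_one (by norm_num) (by norm_num)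
  simpa using (h.const_mul 2).const_sub 1

theorem propertyB_sparseBlaschke : PropertyB sparseBlaschke := by
  intro θ hθ z hz
  have hz1 : ‖z‖ < 1 := by simpa [disk] using hz.1
  obtain ⟨n, h1, h2⟩ := ((tendsto_gapDist.eventually_lt_const (sub_pos.2 hz1)).and
    (tendsto_one_sub_two_mul.eventually_const_lt hθ.2)).exists
  have hsub : connectedComponentIn (levelSet sparseBlaschke θ) z ⊆
      Metric.closedBall 0 (1 - gapDist n) := by
    intro w hw
    rw [mem_closedBall_zero_iff]
    by_contra hlt
    obtain ⟨y, hy, hy1⟩ := isPreconnected_connectedComponentIn.intermediate_value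
      (mem_connectedComponentIn hz) hw continuous_norm.continuousOn
      (show 1 - gapDist n ∈ Set.Icc ‖z‖ ‖w‖ from ⟨by linarith, (not_le.1 hlt).le⟩)
    have h3 := le_norm_sparseBlaschke hy1
    have h4 := (connectedComponentIn_subset _ _ hy).2
    linarith
  refine (closure_minimal hsub Metric.isClosed_closedBall).trans ?_
  exact Metric.closedBall_subset_ball (by linarith [gapDist_pos n])

theorem isTrapping_sparseBlaschke : IsTrapping sparseBlaschke := by
  refine isBlaschkeProduct_sparseBlaschke.isTrapping
    ⟨sparseZero 0, (sparseZero_mem 0).1, ((1 - gapDist 2 : ℝ) : ℂ), ?_, ?_⟩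
    propertyB_sparseBlaschke
  all_goals
    have hg := gapDist_pos 2
    have hg1 : gapDist 2 < 1 := (gapDist_le 2).trans_lt (half_pow_succ_lt_one 2)
    have hn : ‖((1 - gapDist 2 : ℝ) : ℂ)‖ = 1 - gapDist 2 := by
      rw [Complex.norm_real, Real.norm_of_nonneg (by linarith)]
  · rw [disk, mem_ball_zero_iff, hn]
    linarith
  · intro h
    have h1 := le_norm_sparseBlaschke hn
    rw [← h, sparseBlaschke_sparseZero, norm_zero] at h1
    norm_num at h1

theorem not_isLocallyFiniteType_sparseBlaschke (F : Type*) [Field F] :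
    ¬ (sublevelModule F sparseBlaschke).IsLocallyFiniteType := by
  intro h
  have : Infinite (ZeroSet sparseBlaschke) :=
    Infinite.of_injective
      (fun k : ℕ => (⟨sparseZero k, (sparseZero_mem k).1, sparseBlaschke_sparseZero k⟩ :
        ZeroSet sparseBlaschke))
      fun j k hjk => sparseZero_injective (congrArg Subtype.val hjk)
  exact (isTrapping_sparseBlaschke.isClusterModule F).not_finiteDimensional one_pos
    (isTrapping_sparseBlaschke.finite_rel one_pos) (h.finite 1)

end InnerPersistence

theorem theoremA (F : Type u) [Field F] :
    (∀ B : ℂ → ℂ, IsBlaschkeProduct B → (∃ z ∈ disk, ∃ w ∈ disk, B z ≠ B w) → PropertyB B →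
      (sublevelModule F B).Isomorphic
        ((PersistenceModule.intervalIoi F 0).prod
          (PersistenceModule.sumIoc F 0
            fun p : Σ w : critPoints B, Fin (critOrder B w) => critTime B p.1))) ∧
    ∃ B : ℂ → ℂ, IsBlaschkeProduct B ∧ PropertyB B ∧
      ¬ (sublevelModule F B).IsLocallyFiniteType :=
  ⟨fun _ hB hnc hPB => (hB.isTrapping hnc hPB).isomorphic F,
    sparseBlaschke, isBlaschkeProduct_sparseBlaschke, propertyB_sparseBlaschke,
    not_isLocallyFiniteType_sparseBlaschke F⟩
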